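/- Setting. Let $\mathfrak g$ be a finite-dimensional complex simple Lie algebra, $\mathfrak h$ a Cartan subalgebra, $\Delta$ the roots, $\Pi\subset\Delta^+$ simple and positive roots, $\theta$ the maximal root, and $(\cdot,\cdot)$ the multiple of the Killing form with $(\theta,\theta)=2$. For $\Sigma\subseteq\Pi$ let $\Delta_\Sigma=\Delta\cap\mathbb Z\Sigma$, $$\mathfrak l=\mathfrak h\oplus\bigoplus_{\alpha\in\Delta_\Sigma}\mathfrak g_\alpha,\quad \mathfrak u=\bigoplus_{\alpha\in\Delta^+\setminus\Delta_\Sigma}\mathfrak g_\alpha,\quad \bar{\mathfrak u}=\bigoplus_{\alpha\in\Delta^+\setminus\Delta_\Sigma}\mathfrak g_{-\alpha},\quad \mathfrak p=\mathfrak l\oplus\mathfrak u,$$ so that $\mathfrak g=\bar{\mathfrak u}\oplus\mathfrak p$. Let $\hat{\mathfrak g}=\mathfrak g((t))\oplus\mathbb Cc$ with $c$ central and $[a\otimes f,b\otimes h]=[a,b]\otimes fh-(a,b)\,\mathrm{Res}_{t=0}(f\,dh)\,c$; put $a_n=a\otimes t^n$, $a(z)=\sum_{n}a_nz^{-n-1}$,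 $\bar{\mathfrak u}_{\rm nat}=\bar{\mathfrak u}((t))$, $\mathfrak p_{\rm nat}=\mathfrak p((t))\oplus\mathbb Cc$. Let $(f_\alpha)_{\alpha\in I}$ be a basis of $\bar{\mathfrak u}$, $f_{\alpha,n}=f_\alpha\otimes t^n$, and let $x_{\alpha,n}$ ($\alpha\in I$, $n\in\mathbb Z$) be the corresponding coordinate functions on $\bar{\mathfrak u}_{\rm nat}$. Let $\mathrm{Pol}$ be the algebra of polynomial functions on $\bar{\mathfrak u}_{\rm nat}$ generated by the functionals $\sum_\alpha f_\alpha\otimes u_\alpha\mapsto\sum_\alpha\mathrm{Res}_{t=0}(u_\alpha\omega_\alpha\,dt)$, $\omega_\alpha\in\mathbb C((t))$, let $\mathrm{Fun}$ be its completion with respect to the ideals of polynomials that vanish on $t^{-n}\bar{\mathfrak u}[[t]]$, $n\in\mathbb Z$ (equivalently: the functions on $\bar{\mathfrak u}_{\rm nat}$ that are polynomial on every $t^{n}\bar{\mathfrak u}[[t]]$), and let $\mathrm{Vect}$ be the Lie algebra of continuous derivations of $\mathrm{Fun}$. Put $$a_\alpha(z)=\sum_n\partial_{x_{\alpha,n}}z^{-n-1},\qquad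 a^*_\alpha(z)=\sum_nx_{\alpha,n}z^{n}.$$ The Lie algebra $\mathcal A^{\rm op}_{\le1,\rm loc}$ of local differential operators of order at most one, written with the derivatives on the left, is spanned by the $\mathrm{Res}_{z=0}P f\,dz$ and $\mathrm{Res}_{z=0}a_\beta(z)P f\,dz$, where $P=P(a^*_\alpha(z),\partial_za^*_\alpha(z),\dots)$ is a differential polynomial, $f\in\mathbb C((z))$ and $\beta\in I$; it is identified with a Lie subalgebra of the semidirect sum $\mathrm{Vect}\oplus\mathrm{Fun}$ by letting $\sum\partial_{x_{\alpha,n}}\xi_{\alpha,n}$ correspond to the vector field $\sum\xi_{\alpha,n}\partial_{x_{\alpha,n}}$. Let $\mathcal J_{\rm loc}\subset\mathrm{Fun}\,\hat\otimes\,\mathfrak p_{\rm nat}$ be spanned by the $\mathrm{Res}_{z=0}P\,h(z)f\,dz$ ($h\in\mathfrak p$) and $\mathrm{Res}_{z=0}P\,c f\,dz$ with $P,f$ as before. Let $\mathcal R^{\mathfrak g,\mathfrak p}_{\rm loc}=\mathcal A^{\rm op}_{\le1,\rm loc}\oplus\mathcal J_{\rm loc}$ be the semidirect sum in which vector fields act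 on the $\mathrm{Fun}$-factor of $\mathcal J_{\rm loc}$ and functions act by zero. Finally let $$u(x)=\sum_{\alpha,n}x_{\alpha,n}f_{\alpha,n}\in\mathrm{Fun}\,\hat\otimes\,\hat{\mathfrak g},\qquad u(z)=\sum_\alpha a^*_\alpha(z)f_\alpha .$$ Theorem. The operators $\mathrm{ad}(u(x))$ and $\mathrm{ad}(u(z))$ are nilpotent (so that power series in them are finite sums), and there is an injective Lie algebra homomorphism $\pi:\hat{\mathfrak g}\to\mathcal R^{\mathfrak g,\mathfrak p}_{\rm loc}$ with the following properties. (1) For all $a\in\hat{\mathfrak g}$, $$\pi(a)=-\sum_{\alpha\in I}\sum_{n\in\mathbb Z}\partial_{x_{\alpha,n}}\Big[\frac{\mathrm{ad}(u(x))\,e^{\mathrm{ad}(u(x))}}{e^{\mathrm{ad}(u(x))}-\mathrm{id}}\,(e^{-\mathrm{ad}(u(x))}a)_{\bar{\mathfrak u}_{\rm nat}}\Big]_{\alpha,n}+(e^{-\mathrm{ad}(u(x))}a)_{\mathfrak p_{\rm nat}},$$ where $[b]_{\alpha,n}$ is the coordinate of $b$ at $f_{\alpha,n}$ and the sum of vector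 fields converges on every element of $\mathrm{Fun}$. (2) $\pi(c)=c$ and, for all $a\in\mathfrak g$, $\pi(a(z))=D(a,z)+A(a,z)+C(a,z)$ with $$D(a,z)=-\sum_{\alpha\in I}a_\alpha(z)\Big[\frac{\mathrm{ad}(u(z))\,e^{\mathrm{ad}(u(z))}}{e^{\mathrm{ad}(u(z))}-\mathrm{id}}\,(e^{-\mathrm{ad}(u(z))}a)_{\bar{\mathfrak u}}\Big]_\alpha,$$ $$A(a,z)=(e^{-\mathrm{ad}(u(z))}a(z))_{\mathfrak p},\qquad C(a,z)=-\Big(\frac{e^{\mathrm{ad}(u(z))}-\mathrm{id}}{\mathrm{ad}(u(z))}\,\partial_zu(z),a\Big)c,$$ where $[b]_\alpha$ is the coordinate of $b$ at $f_\alpha$. (3) In particular, for $a\in\bar{\mathfrak u}$, $$\pi(a(z))=-\sum_{\alpha\in I}a_\alpha(z)\Big[\frac{\mathrm{ad}(u(z))}{e^{\mathrm{ad}(u(z))}-\mathrm{id}}\,a\Big]_\alpha,$$ and for $a\in\mathfrak l$, $$\pi(a(z))=\sum_{\alpha\in I}a_\alpha(z)[\mathrm{ad}(u(z))(a)]_\alpha+a(z).$$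 -/

import Mathlib

open scoped TensorProduct

noncomputable section

namespace FreeField

/-! ### Laurent series -/

/-- The field `ℂ((t))` of formal Laurent series. -/
abbrev Lau : Type := LaurentSeries ℂ

/-- The coefficientwise `ℂ`-algebra structure, made the preferred one. -/
instance lauAlgebra : Algebra ℂ Lau := HahnSeries.instAlgebra

/-- The monomial `t ^ n`. -/
def tPow (n : ℤ) : Lau := HahnSeries.single n (1 : ℂ)

/-- The residue `Res_{t=0} f(t) dt`, i.e. the coefficient of `t⁻¹`. -/
def lauRes : Lau →ₗ[ℂ] ℂ where
  toFun f := f.coeff (-1)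
  map_add' _ _ := rfl
  map_smul' _ _ := rfl

theorem lau_derivative_coeff (f : Lau) (n : ℤ) :
    (LaurentSeries.derivative ℂ f).coeff n = ((n : ℂ) + 1) * f.coeff (n + 1) := by
  rw [LaurentSeries.derivative_apply, LaurentSeries.hasseDeriv_coeff]
  simp

/-- If `f` has order at least `k` and `g` order at least `l`, then the coefficients of `f * g` are
given by the obvious finite sums. -/
theorem lau_coeff_mul {f g : Lau} {k l : ℤ} (hf : ∀ m < k, f.coeff m = 0)
    (hg : ∀ m < l, g.coeff m = 0) (m : ℤ) :
    (f * g).coeff m = ∑ i ∈ Finset.Icc k (m - l), f.coeff i * g.coeff (m - i) := by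
  rw [HahnSeries.coeff_mul]
  refine Finset.sum_bij_ne_zero (fun ij _ _ => ij.1) ?_ ?_ ?_ ?_
  · rintro ⟨i, j⟩ h1 h2
    have hi : ¬ i < k := fun h => h2 (by simp [hf i h])
    have hj : ¬ j < l := fun h => h2 (by simp [hg j h])
    simp only [Finset.mem_Icc]
    obtain ⟨_, _, h⟩ := Finset.mem_antidiagonal.1 h1
    simp only at h
    omega
  · rintro ⟨i, j⟩ h1 _ ⟨i', j'⟩ h1' _ h
    have e1 := (Finset.mem_antidiagonal.1 h1).2.2
    have e2 := (Finset.mem_antidiagonal.1 h1').2.2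
    simp only at e1 e2 h
    ext <;> simp only <;> omega
  · intro i _ h2
    refine ⟨(i, m - i), ?_, h2, rfl⟩
    rw [Finset.mem_antidiagonal]
    exact ⟨left_ne_zero_of_mul h2, right_ne_zero_of_mul h2, by simp⟩
  · rintro ⟨i, j⟩ h1 _
    have e1 := (Finset.mem_antidiagonal.1 h1).2.2
    simp only at e1 ⊢
    rw [show m - i = j by omega]

theorem lau_exists_order (f : Lau) : ∃ k : ℤ, ∀ m < k, f.coeff m = 0 :=
  ⟨f.order, fun _ h => HahnSeries.coeff_eq_zero_of_lt_order h⟩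

theorem lau_derivative_mul (f g : Lau) :
    LaurentSeries.derivative ℂ (f * g) =
      f * LaurentSeries.derivative ℂ g + g * LaurentSeries.derivative ℂ f := by
  obtain ⟨k, hk⟩ := lau_exists_order f
  obtain ⟨l, hl⟩ := lau_exists_order g
  have hk' : ∀ m < k - 1, (LaurentSeries.derivative ℂ f).coeff m = 0 := fun m hm => by
    rw [lau_derivative_coeff, hk _ (by omega), mul_zero]
  have hl' : ∀ m < l - 1, (LaurentSeries.derivative ℂ g).coeff m = 0 := fun m hm => by
    rw [lau_derivative_coeff, hl _ (by omega), mul_zero]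
  ext m
  rw [lau_derivative_coeff, HahnSeries.coeff_add, lau_coeff_mul hk hl, lau_coeff_mul hk hl',
    mul_comm g, lau_coeff_mul hk' hl]
  have h2 : ∑ i ∈ Finset.Icc (k - 1) (m - l),
        (LaurentSeries.derivative ℂ f).coeff i * g.coeff (m - i) =
      ∑ i ∈ Finset.Icc k (m + 1 - l), ((i : ℂ) * f.coeff i) * g.coeff (m + 1 - i) := by
    refine Finset.sum_bij (fun i _ => i + 1) ?_ ?_ ?_ ?_
    · intro i hi
      simp only [Finset.mem_Icc] at hi ⊢
      omega
    · intro i _ j _ h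
      omega
    · intro i hi
      simp only [Finset.mem_Icc] at hi
      exact ⟨i - 1, by simp only [Finset.mem_Icc]; omega, by omega⟩
    · intro i _
      rw [lau_derivative_coeff, show m + 1 - (i + 1) = m - i by ring]
      push_cast
      ring
  rw [h2, show m - (l - 1) = m + 1 - l by ring, Finset.mul_sum, ← Finset.sum_add_distrib]
  refine Finset.sum_congr rfl fun i _ => ?_
  rw [lau_derivative_coeff, show m - i + 1 = m + 1 - i by ring]
  push_cast
  ring

/-- The derivation `d/dt` of `ℂ((t))`. -/
def lauD : Derivation ℂ Lau Lau :=
  Derivation.mk' (LaurentSeries.derivative ℂ) fun f g => by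
    simpa [smul_eq_mul] using lau_derivative_mul f g

theorem lauD_coeff (f : Lau) (n : ℤ) : (lauD f).coeff n = ((n : ℂ) + 1) * f.coeff (n + 1) :=
  lau_derivative_coeff f n

theorem lauRes_lauD (f : Lau) : lauRes (lauD f) = 0 := by
  simp [lauRes, lauD_coeff]

/-! ### Central extensions of current algebras

The construction below is used twice: with `A = ℂ((t))` and `B = ℂ` it is the affine Kac–Moody
algebra, and with `A = Fun ⊗̂ ℂ((t))` and `B = Fun` it is the completed tensor product of the algebra
of functions with the affine Kac–Moody algebra. -/

/-- A derivation `∂` of a commutative algebra `A` together with a residue `A → B` that kills the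
image of `∂`. -/
structure ResidueData (A B : Type*) [CommRing A] [Algebra ℂ A] [AddCommGroup B] [Module ℂ B] where
  /-- the derivation -/
  der : Derivation ℂ A A
  /-- the residue -/
  res : A →ₗ[ℂ] B
  res_der : ∀ a, res (der a) = 0

/-- An invariant symmetric bilinear form on a complex Lie algebra. -/
structure InvForm (g : Type*) [LieRing g] [LieAlgebra ℂ g] where
  /-- the bilinear form -/
  form : LinearMap.BilinForm ℂ g
  symm : ∀ x y, form x y = form y x
  inv : ∀ x y z, form ⁅x, y⁆ z = form x ⁅y, z⁆

section Aff

variable {g : Type*} [LieRing g] [LieAlgebra ℂ g]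
variable {A B : Type*} [CommRing A] [Algebra ℂ A] [AddCommGroup B] [Module ℂ B]

/-- The `A`-bilinear extension of the form to `A ⊗ g`. -/
def InvForm.ext (κ : InvForm g) (A : Type*) [CommRing A] [Algebra ℂ A] :
    LinearMap.BilinForm A (A ⊗[ℂ] g) :=
  LinearMap.BilinForm.baseChange A κ.form

@[simp] theorem InvForm.ext_tmul (κ : InvForm g) (a a' : A) (x x' : g) :
    κ.ext A (a ⊗ₜ[ℂ] x) (a' ⊗ₜ[ℂ] x') = κ.form x x' • (a * a') :=
  LinearMap.BilinForm.baseChange_tmul _ _ _ _ _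

theorem InvForm.ext_symm (κ : InvForm g) (x y : A ⊗[ℂ] g) : κ.ext A x y = κ.ext A y x := by
  induction x using TensorProduct.induction_on with
  | zero => simp
  | add x x' hx hx' => simp [hx, hx']
  | tmul a u =>
    induction y using TensorProduct.induction_on with
    | zero => simp
    | add y y' hy hy' => simp [hy, hy']
    | tmul b v => simp [κ.symm u v, mul_comm a b]

theorem InvForm.ext_inv (κ : InvForm g) (x y z : A ⊗[ℂ] g) :
    κ.ext A ⁅x, y⁆ z = κ.ext A x ⁅y, z⁆ := by
  induction x using TensorProduct.induction_on with
  | zero => simp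
  | add x x' hx hx' => simp [hx, hx']
  | tmul a u =>
    induction y using TensorProduct.induction_on with
    | zero => simp
    | add y y' hy hy' => simp [hy, hy']
    | tmul b v =>
      induction z using TensorProduct.induction_on with
      | zero => simp
      | add z z' hz hz' => simp only [map_add, lie_add, hz, hz']
      | tmul c w => simp [κ.inv u v w, mul_assoc]

/-- The derivation `D ⊗ id` of `A ⊗ g`. -/
def derExt (g : Type*) [LieRing g] [LieAlgebra ℂ g] (D : Derivation ℂ A A) :
    LieDerivation ℂ (A ⊗[ℂ] g) (A ⊗[ℂ] g) :=
  Lie.Derivation.ofDerivation g D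

@[simp] theorem derExt_tmul (D : Derivation ℂ A A) (a : A) (x : g) :
    derExt g D (a ⊗ₜ[ℂ] x) = D a ⊗ₜ[ℂ] x := rfl

theorem InvForm.ext_der (κ : InvForm g) (D : Derivation ℂ A A) (x y : A ⊗[ℂ] g) :
    D (κ.ext A x y) = κ.ext A (derExt g D x) y + κ.ext A x (derExt g D y) := by
  induction x using TensorProduct.induction_on with
  | zero => simp
  | add x x' hx hx' => simp only [map_add, LinearMap.add_apply, hx, hx']; abel
  | tmul a u =>
    induction y using TensorProduct.induction_on with
    | zero => simp
    | add y y' hy hy' => simp only [map_add, hy, hy']; abel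
    | tmul b v =>
      have h : D (κ.form u v • (a * b)) = κ.form u v • D (a * b) := D.map_smul _ _
      rw [derExt_tmul, derExt_tmul, InvForm.ext_tmul, InvForm.ext_tmul, InvForm.ext_tmul, h,
        D.leibniz, smul_eq_mul, smul_eq_mul, ← smul_add, mul_comm b, add_comm]

theorem derExt_lie (D : Derivation ℂ A A) (x y : A ⊗[ℂ] g) :
    derExt g D ⁅x, y⁆ = ⁅x, derExt g D y⁆ + ⁅derExt g D x, y⁆ := by
  rw [LieDerivation.apply_lie_eq_sub, ← lie_skew (derExt g D x) y, sub_eq_add_neg]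

/-- The underlying space `(A ⊗ g) ⊕ B c` of the central extension of `A ⊗ g`. -/
def Aff (_κ : InvForm g) (_d : ResidueData A B) : Type _ := (A ⊗[ℂ] g) × B

namespace Aff

variable {κ : InvForm g} {d : ResidueData A B}

instance : AddCommGroup (Aff κ d) := inferInstanceAs (AddCommGroup ((A ⊗[ℂ] g) × B))

instance : Module ℂ (Aff κ d) := inferInstanceAs (Module ℂ ((A ⊗[ℂ] g) × B))

/-- The element `w + b c`. -/
def mk (κ : InvForm g) (d : ResidueData A B) (w : A ⊗[ℂ] g) (b : B) : Aff κ d := (w, b)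

/-- The component in `A ⊗ g`. -/
def cur (x : Aff κ d) : A ⊗[ℂ] g := x.1

/-- The coefficient of the central element `c`. -/
def cen (x : Aff κ d) : B := x.2

@[ext] theorem ext {x y : Aff κ d} (h1 : x.cur = y.cur) (h2 : x.cen = y.cen) : x = y :=
  Prod.ext h1 h2

@[simp] theorem cur_mk (w : A ⊗[ℂ] g) (b : B) : (mk κ d w b).cur = w := rfl
@[simp] theorem cen_mk (w : A ⊗[ℂ] g) (b : B) : (mk κ d w b).cen = b := rfl
@[simp] theorem cur_add (x y : Aff κ d) : (x + y).cur = x.cur + y.cur := rfl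
@[simp] theorem cen_add (x y : Aff κ d) : (x + y).cen = x.cen + y.cen := rfl
@[simp] theorem cur_sub (x y : Aff κ d) : (x - y).cur = x.cur - y.cur := rfl
@[simp] theorem cen_sub (x y : Aff κ d) : (x - y).cen = x.cen - y.cen := rfl
@[simp] theorem cur_neg (x : Aff κ d) : (-x).cur = -x.cur := rfl
@[simp] theorem cen_neg (x : Aff κ d) : (-x).cen = -x.cen := rfl
@[simp] theorem cur_zero : (0 : Aff κ d).cur = 0 := rfl
@[simp] theorem cen_zero : (0 : Aff κ d).cen = 0 := rfl
@[simp] theorem cur_smul (r : ℂ) (x : Aff κ d) : (r • x).cur = r • x.cur := rfl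
@[simp] theorem cen_smul (r : ℂ) (x : Aff κ d) : (r • x).cen = r • x.cen := rfl

/-- The bracket
`[a ⊗ f + r c, b ⊗ h + s c] = [a, b] ⊗ f h - (a, b) Res (f dh) c`. -/
instance : Bracket (Aff κ d) (Aff κ d) where
  bracket x y := mk κ d ⁅x.cur, y.cur⁆ (-d.res (κ.ext A x.cur (derExt g d.der y.cur)))

@[simp] theorem cur_lie (x y : Aff κ d) : ⁅x, y⁆.cur = ⁅x.cur, y.cur⁆ := rfl
@[simp] theorem cen_lie (x y : Aff κ d) :
    ⁅x, y⁆.cen = -d.res (κ.ext A x.cur (derExt g d.der y.cur)) := rfl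

theorem res_swap (x y : A ⊗[ℂ] g) :
    d.res (κ.ext A x (derExt g d.der y)) = -d.res (κ.ext A (derExt g d.der x) y) := by
  have h := d.res_der (κ.ext A x y)
  rw [InvForm.ext_der, map_add] at h
  exact eq_neg_of_add_eq_zero_right h

instance : LieRing (Aff κ d) where
  add_lie x y z := by ext <;> simp; abel
  lie_add x y z := by ext <;> simp; abel
  lie_self x := by
    ext
    · simp
    · have h := res_swap (κ := κ) (d := d) x.cur x.cur
      rw [κ.ext_symm (derExt g d.der x.cur)] at h
      have h2 : (2 : ℂ) • d.res (κ.ext A x.cur (derExt g d.der x.cur)) = 0 := by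
        rw [two_smul]
        nth_rewrite 1 [h]
        simp
      simpa using h2
  leibniz_lie x y z := by
    ext
    · simp
    · have h1 : κ.ext A y.cur (derExt g d.der ⁅x.cur, z.cur⁆) =
          -κ.ext A ⁅x.cur, y.cur⁆ (derExt g d.der z.cur) -
            κ.ext A (derExt g d.der x.cur) ⁅y.cur, z.cur⁆ := by
        rw [derExt_lie, map_add, ← κ.ext_inv, ← κ.ext_inv, ← κ.ext_inv, ← lie_skew y.cur x.cur,
          ← lie_skew y.cur (derExt g d.der x.cur)]
        simp only [map_neg, LinearMap.neg_apply, sub_eq_add_neg]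
      simp only [cen_lie, cur_lie, cen_add, h1, map_sub, map_neg]
      rw [res_swap x.cur]
      abel

instance : LieAlgebra ℂ (Aff κ d) where
  lie_smul r x y := by
    ext
    · simp
    · simp only [cen_lie, cur_smul, cen_smul]
      rw [map_smul, LinearMap.map_smul_of_tower, map_smul, smul_neg]

end Aff
end Aff

/-! ### Functions and vector fields on `K(ū)`

After the choice of a finite basis `f_α`, `α ∈ ι`, of `ū`, the space `K(ū) = ū ⊗ ℂ((t))` is the space
`ι → ℂ((t))` of coordinates: the family `u` stands for the point `∑ α, f_α ⊗ u α`. -/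

section Fun

variable {ι : Type*} [Fintype ι]

/-- The lattice `t ^ n ū[[t]]` in `K(ū)`. -/
def lattice (ι : Type*) (n : ℤ) : Submodule ℂ (ι → Lau) where
  carrier := {u | ∀ α, ∀ m < n, (u α).coeff m = 0}
  add_mem' {u v} hu hv α m hm := by simp [hu α m hm, hv α m hm]
  zero_mem' α m _ := by simp
  smul_mem' r u hu α m hm := by simp [hu α m hm]

theorem mem_lattice {ι : Type*} {n : ℤ} {u : ι → Lau} :
    u ∈ lattice ι n ↔ ∀ α, ∀ m < n, (u α).coeff m = 0 := Iff.rfl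

theorem lattice_anti {ι : Type*} {k n : ℤ} (h : k ≤ n) : lattice ι n ≤ lattice ι k :=
  fun _ hu α m hm => hu α m (by omega)

theorem exists_mem_lattice (u : ι → Lau) : ∃ n, u ∈ lattice ι n := by
  choose k hk using fun α => lau_exists_order (u α)
  rcases isEmpty_or_nonempty ι with h | h
  · exact ⟨0, fun α => (h.false α).elim⟩
  · refine ⟨Finset.univ.inf' Finset.univ_nonempty k, fun α m hm => hk α m ?_⟩
    exact lt_of_lt_of_le hm (Finset.inf'_le _ (Finset.mem_univ α))

/-- The linear function on `K(ū)` given by the pairing `∑ α, Res_{t=0} u α ω α dt` with the element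
`∑ α, x_α ⊗ ω α dt` of `Ω_K(ū*)`. -/
def pairing (ω : ι → Lau) (u : ι → Lau) : ℂ := ∑ α, lauRes (u α * ω α)

/-- The algebra `Pol K(ū) = S(Ω_K(ū*))` of polynomial functions on `K(ū)`. -/
def Pol (ι : Type*) [Fintype ι] : Subalgebra ℂ ((ι → Lau) → ℂ) :=
  Algebra.adjoin ℂ (Set.range pairing)

/-- The completion of `Pol K(ū)` with respect to the ideals `J_n` generated by
`ū* ⊗ t ^ n ℂ[[t]] dt`. Since `J_n` consists of the polynomials that vanish on the lattice
`t ^ (-n) ū[[t]]`, an element of the completion is a function on `K(ū)` that agrees on every lattice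
with a polynomial. -/
def funAlg (ι : Type*) [Fintype ι] : Subalgebra ℂ ((ι → Lau) → ℂ) where
  carrier := {F | ∀ n, ∃ p ∈ Pol ι, ∀ u ∈ lattice ι n, F u = p u}
  mul_mem' {F G} hF hG n := by
    obtain ⟨p, hp, h⟩ := hF n
    obtain ⟨q, hq, h'⟩ := hG n
    exact ⟨p * q, mul_mem hp hq, fun u hu => by simp [h u hu, h' u hu]⟩
  add_mem' {F G} hF hG n := by
    obtain ⟨p, hp, h⟩ := hF n
    obtain ⟨q, hq, h'⟩ := hG n
    exact ⟨p + q, add_mem hp hq, fun u hu => by simp [h u hu, h' u hu]⟩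
  algebraMap_mem' r _ := ⟨algebraMap ℂ _ r, Subalgebra.algebraMap_mem _ r, fun _ _ => rfl⟩

/-- The algebra `Fun K(ū)`. -/
def Fun (ι : Type*) [Fintype ι] : Type _ := ↥(funAlg ι)

namespace Fun

instance : CommRing (Fun ι) := inferInstanceAs (CommRing ↥(funAlg ι))

instance : Algebra ℂ (Fun ι) := inferInstanceAs (Algebra ℂ ↥(funAlg ι))

/-- The underlying function. -/
def val (F : Fun ι) : (ι → Lau) → ℂ := Subtype.val (p := fun F => F ∈ funAlg ι) F

/-- An element of `Fun K(ū)` from a function. -/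
def of (f : (ι → Lau) → ℂ) (hf : f ∈ funAlg ι) : Fun ι := ⟨f, hf⟩

@[simp] theorem val_of (f : (ι → Lau) → ℂ) (hf : f ∈ funAlg ι) : (of f hf).val = f := rfl

instance : CoeFun (Fun ι) (fun _ => (ι → Lau) → ℂ) := ⟨val⟩

theorem prop (F : Fun ι) : F.val ∈ funAlg ι := Subtype.property (p := fun F => F ∈ funAlg ι) F

@[ext] theorem ext {F G : Fun ι} (h : ∀ u, F u = G u) : F = G := Subtype.ext (funext h)

@[simp] theorem add_apply (F G : Fun ι) (u : ι → Lau) : (F + G) u = F u + G u := rfl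
@[simp] theorem sub_apply (F G : Fun ι) (u : ι → Lau) : (F - G) u = F u - G u := rfl
@[simp] theorem neg_apply (F : Fun ι) (u : ι → Lau) : (-F) u = -F u := rfl
@[simp] theorem mul_apply (F G : Fun ι) (u : ι → Lau) : (F * G) u = F u * G u := rfl
@[simp] theorem zero_apply (u : ι → Lau) : (0 : Fun ι) u = 0 := rfl
@[simp] theorem one_apply (u : ι → Lau) : (1 : Fun ι) u = 1 := rfl
@[simp] theorem smul_apply (r : ℂ) (F : Fun ι) (u : ι → Lau) : (r • F) u = r * F u := rfl

/-- Evaluation at a point. -/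
def eval (u : ι → Lau) : Fun ι →ₐ[ℂ] ℂ where
  toFun F := F u
  map_one' := rfl
  map_mul' _ _ := rfl
  map_zero' := rfl
  map_add' _ _ := rfl
  commutes' _ := rfl

theorem sum_apply {σ : Type*} (s : Finset σ) (F : σ → Fun ι) (u : ι → Lau) :
    (∑ i ∈ s, F i) u = ∑ i ∈ s, F i u := map_sum (eval u) F s

theorem mem_of_local {F : (ι → Lau) → ℂ}
    (h : ∀ n, ∃ G : Fun ι, ∀ u ∈ lattice ι n, F u = G u) : F ∈ funAlg ι := fun n => by
  obtain ⟨G, hG⟩ := h n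
  obtain ⟨p, hp, h'⟩ := G.prop n
  exact ⟨p, hp, fun u hu => (hG u hu).trans (h' u hu)⟩

theorem pol_le : Pol ι ≤ funAlg ι := fun p hp _ => ⟨p, hp, fun _ _ => rfl⟩

/-- The linear topology on `Fun K(ū)` in which the ideals of functions vanishing on the lattices (the
closures of the `J_n`) form a basis of neighbourhoods of `0`: the coarsest topology for which the
restrictions to all lattices, with discrete targets, are continuous. -/
instance : TopologicalSpace (Fun ι) :=
  ⨅ n : ℤ, TopologicalSpace.induced (fun F (u : lattice ι n) => F u.1) ⊥

theorem hasBasis_nhds (F : Fun ι) :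
    (nhds F).HasBasis (fun _ : ℤ => True) fun n => {G | ∀ u ∈ lattice ι n, G u = F u} := by
  have h : nhds F = ⨅ n : ℤ, Filter.principal {G : Fun ι | ∀ u ∈ lattice ι n, G u = F u} := by
    rw [nhds_iInf]
    refine iInf_congr fun n => ?_
    let _ : TopologicalSpace (lattice ι n → ℂ) := ⊥
    have _ : DiscreteTopology (lattice ι n → ℂ) := ⟨rfl⟩
    rw [@nhds_induced _ _ ⊥, nhds_discrete, ← Filter.principal_singleton, Filter.comap_principal]
    congr 1
    ext G
    simp [funext_iff]
  rw [h]
  refine Filter.hasBasis_iInf_principal ?_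
  intro n k
  exact ⟨min n k, fun G hG u hu => hG u (lattice_anti (min_le_left _ _) hu),
    fun G hG u hu => hG u (lattice_anti (min_le_right _ _) hu)⟩

end Fun

/-- The coordinate function `x_{α,n}`, the coefficient of `f_α ⊗ t ^ n`. -/
def coordFun (α : ι) (n : ℤ) : Fun ι :=
  Fun.of (fun u => (u α).coeff n) (Fun.pol_le (by
    classical
    refine Algebra.subset_adjoin ⟨Pi.single α (tPow (-n - 1)), ?_⟩
    ext u
    rw [pairing, Finset.sum_eq_single α]
    · rw [Pi.single_eq_same, tPow]
      change (u α * HahnSeries.single (-n - 1) (1 : ℂ)).coeff (-1) = _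
      have := HahnSeries.coeff_mul_single_add (r := (1 : ℂ)) (x := u α) (a := n) (b := -n - 1)
      rw [show n + (-n - 1) = -1 by ring] at this
      simpa using this
    · intro β _ h
      simp [Pi.single_eq_of_ne h]
    · simp))

/-- A linear map `D` of `Fun K(ū)` is continuous iff for every lattice there is another one such that
`D F` vanishes on the former as soon as `F` vanishes on the latter. -/
theorem continuous_iff (D : Derivation ℂ (Fun ι) (Fun ι)) :
    Continuous D ↔ ∀ n, ∃ k, ∀ F : Fun ι, (∀ u ∈ lattice ι k, F u = 0) →
      ∀ u ∈ lattice ι n, D F u = 0 := by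
  rw [continuous_iff_continuousAt]
  constructor
  · intro h n
    have h0 := ((Fun.hasBasis_nhds (0 : Fun ι)).tendsto_iff (Fun.hasBasis_nhds (D 0))).1 (h 0)
      n trivial
    obtain ⟨k, -, hk⟩ := h0
    refine ⟨k, fun F hF u hu => ?_⟩
    have := hk F (fun u hu => by simpa using hF u hu) u hu
    simpa using this
  · intro h F
    refine ((Fun.hasBasis_nhds F).tendsto_iff (Fun.hasBasis_nhds (D F))).2 fun n _ => ?_
    obtain ⟨k, hk⟩ := h n
    refine ⟨k, trivial, fun G hG u hu => ?_⟩
    have := hk (G - F) (fun u hu => by simp [hG u hu]) u hu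
    rw [map_sub, Fun.sub_apply, sub_eq_zero] at this
    exact this

/-- The Lie algebra `Vect K(ū)` of continuous derivations of `Fun K(ū)`. -/
def Vect (ι : Type*) [Fintype ι] : LieSubalgebra ℂ (Derivation ℂ (Fun ι) (Fun ι)) where
  carrier := {D | Continuous D}
  zero_mem' := (continuous_iff _).2 fun n => ⟨n, fun F _ u _ => by simp⟩
  add_mem' {D E} hD hE := (continuous_iff _).2 fun n => by
    obtain ⟨k, hk⟩ := (continuous_iff D).1 hD n
    obtain ⟨l, hl⟩ := (continuous_iff E).1 hE n
    refine ⟨min k l, fun F hF u hu => ?_⟩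
    simp [hk F (fun v hv => hF v (lattice_anti (min_le_left _ _) hv)) u hu,
      hl F (fun v hv => hF v (lattice_anti (min_le_right _ _) hv)) u hu]
  smul_mem' r D hD := (continuous_iff _).2 fun n => by
    obtain ⟨k, hk⟩ := (continuous_iff D).1 hD n
    exact ⟨k, fun F hF u hu => by simp [hk F hF u hu]⟩
  lie_mem' {D E} hD hE := by
    have h1 : Continuous fun F => D (E F) := Continuous.comp hD hE
    have h2 : Continuous fun F => E (D F) := Continuous.comp hE hD
    refine (continuous_iff _).2 fun n => ?_
    obtain ⟨k, hk⟩ := (continuous_iff D).1 hD n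
    obtain ⟨l, hl⟩ := (continuous_iff E).1 hE k
    obtain ⟨k', hk'⟩ := (continuous_iff E).1 hE n
    obtain ⟨l', hl'⟩ := (continuous_iff D).1 hD k'
    refine ⟨min l l', fun F hF u hu => ?_⟩
    rw [Derivation.commutator_apply, Fun.sub_apply,
      hk _ (hl F fun v hv => hF v (lattice_anti (min_le_left _ _) hv)) u hu,
      hk' _ (hl' F fun v hv => hF v (lattice_anti (min_le_right _ _) hv)) u hu, sub_zero]

/-! ### The completed tensor product `Fun K(ū) ⊗̂ ℂ((t))` -/

/-- The functions `G` from `K(ū)` to `ℂ((t))` such that every coefficient `G_m` of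
`G = ∑ m, G_m t ^ m` belongs to `Fun K(ū)` and `G_m → 0` in `Fun K(ū)` as `m → -∞`. -/
def funKAlg (ι : Type*) [Fintype ι] : Subalgebra ℂ ((ι → Lau) → Lau) where
  carrier := {G | (∀ m, (fun u => (G u).coeff m) ∈ funAlg ι) ∧
    ∀ n, ∃ k, ∀ u ∈ lattice ι n, ∀ m < k, (G u).coeff m = 0}
  mul_mem' {G H} hG hH := by
    constructor
    · intro m
      refine Fun.mem_of_local fun n => ?_
      obtain ⟨k, hk⟩ := hG.2 n
      obtain ⟨l, hl⟩ := hH.2 n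
      refine ⟨∑ i ∈ Finset.Icc k (m - l), (Fun.of _ (hG.1 i) * Fun.of _ (hH.1 (m - i)) : Fun ι),
        fun u hu => ?_⟩
      rw [Fun.sum_apply]
      exact lau_coeff_mul (hk u hu) (hl u hu) m
    · intro n
      obtain ⟨k, hk⟩ := hG.2 n
      obtain ⟨l, hl⟩ := hH.2 n
      refine ⟨k + l, fun u hu m hm => ?_⟩
      rw [Pi.mul_apply, lau_coeff_mul (hk u hu) (hl u hu) m, Finset.Icc_eq_empty (by omega),
        Finset.sum_empty]
  add_mem' {G H} hG hH := by
    constructor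
    · intro m
      exact (funAlg ι).add_mem (hG.1 m) (hH.1 m)
    · intro n
      obtain ⟨k, hk⟩ := hG.2 n
      obtain ⟨l, hl⟩ := hH.2 n
      refine ⟨min k l, fun u hu m hm => ?_⟩
      simp [hk u hu m (by omega), hl u hu m (by omega)]
  algebraMap_mem' r := by
    constructor
    · intro m
      exact (funAlg ι).algebraMap_mem ((algebraMap ℂ Lau r).coeff m)
    · intro n
      obtain ⟨k, hk⟩ := lau_exists_order (algebraMap ℂ Lau r)
      exact ⟨k, fun u _ m hm => hk m hm⟩

/-- The algebra `Fun K(ū) ⊗̂ ℂ((t))`. Its elements are at the same time the formal distributions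
`G(z) = ∑ m, G_m z ^ m` with coefficients in `Fun K(ū)` for which all products are defined. -/
def FunK (ι : Type*) [Fintype ι] : Type _ := ↥(funKAlg ι)

namespace FunK

instance : CommRing (FunK ι) := inferInstanceAs (CommRing ↥(funKAlg ι))

instance : Algebra ℂ (FunK ι) := inferInstanceAs (Algebra ℂ ↥(funKAlg ι))

/-- The underlying function. -/
def val (G : FunK ι) : (ι → Lau) → Lau := Subtype.val (p := fun G => G ∈ funKAlg ι) G

/-- An element of `FunK` from a function. -/
def of (f : (ι → Lau) → Lau) (hf : f ∈ funKAlg ι) : FunK ι := ⟨f, hf⟩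

@[simp] theorem val_of (f : (ι → Lau) → Lau) (hf : f ∈ funKAlg ι) : (of f hf).val = f := rfl

instance : CoeFun (FunK ι) (fun _ => (ι → Lau) → Lau) := ⟨val⟩

theorem prop (G : FunK ι) : G.val ∈ funKAlg ι := Subtype.property (p := fun G => G ∈ funKAlg ι) G

@[ext] theorem ext {F G : FunK ι} (h : ∀ u, F u = G u) : F = G := Subtype.ext (funext h)

@[simp] theorem add_apply (F G : FunK ι) (u : ι → Lau) : (F + G) u = F u + G u := rfl
@[simp] theorem sub_apply (F G : FunK ι) (u : ι → Lau) : (F - G) u = F u - G u := rfl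
@[simp] theorem neg_apply (F : FunK ι) (u : ι → Lau) : (-F) u = -F u := rfl
@[simp] theorem mul_apply (F G : FunK ι) (u : ι → Lau) : (F * G) u = F u * G u := rfl
@[simp] theorem zero_apply (u : ι → Lau) : (0 : FunK ι) u = 0 := rfl
@[simp] theorem one_apply (u : ι → Lau) : (1 : FunK ι) u = 1 := rfl
@[simp] theorem smul_apply (r : ℂ) (F : FunK ι) (u : ι → Lau) : (r • F) u = r • F u := rfl

/-- The coefficient `G_m ∈ Fun K(ū)` of `G = ∑ m, G_m t ^ m`. -/
def coeff (m : ℤ) : FunK ι →ₗ[ℂ] Fun ι where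
  toFun G := Fun.of _ (G.prop.1 m)
  map_add' _ _ := rfl
  map_smul' _ _ := rfl

@[simp] theorem coeff_apply (m : ℤ) (G : FunK ι) (u : ι → Lau) :
    coeff m G u = (G u).coeff m := rfl

theorem ext_coeff {G H : FunK ι} (h : ∀ m, coeff m G = coeff m H) : G = H := by
  ext u m
  exact congrArg (fun F : Fun ι => F u) (h m)

/-- The inclusion `ℂ((t)) → Fun K(ū) ⊗̂ ℂ((t))`. -/
def const (ι : Type*) [Fintype ι] : Lau →ₐ[ℂ] FunK ι where
  toFun f := of (fun _ => f) ⟨fun m => (funAlg ι).algebraMap_mem (f.coeff m), fun _ => by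
    obtain ⟨k, hk⟩ := lau_exists_order f
    exact ⟨k, fun u _ m hm => hk m hm⟩⟩
  map_one' := rfl
  map_mul' _ _ := rfl
  map_zero' := rfl
  map_add' _ _ := rfl
  commutes' _ := rfl

@[simp] theorem const_apply (f : Lau) (u : ι → Lau) : const ι f u = f := rfl

/-- The derivation `∂_t` (or `∂_z`) of `Fun K(ū) ⊗̂ ℂ((t))`. -/
def der (ι : Type*) [Fintype ι] : Derivation ℂ (FunK ι) (FunK ι) where
  toFun G := of (fun u => lauD (G u)) ⟨fun m => by
    simp only [lauD_coeff]
    exact (funAlg ι).smul_mem (G.prop.1 (m + 1)) ((m : ℂ) + 1), fun n => by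
    obtain ⟨k, hk⟩ := G.prop.2 n
    refine ⟨k - 1, fun u hu m hm => ?_⟩
    rw [lauD_coeff, hk u hu _ (by omega), mul_zero]⟩
  map_add' G H := by ext u : 1; exact map_add lauD _ _
  map_smul' r G := by ext u : 1; exact lauD.map_smul r _
  map_one_eq_zero' := by ext u : 1; exact lauD.map_one_eq_zero
  leibniz' G H := by ext u : 1; exact lauD.leibniz _ _

@[simp] theorem der_apply (G : FunK ι) (u : ι → Lau) : der ι G u = lauD (G u) := rfl

/-- The residue `Fun K(ū) ⊗̂ ℂ((t)) → Fun K(ū)`. -/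
def res (ι : Type*) [Fintype ι] : FunK ι →ₗ[ℂ] Fun ι := coeff (-1)

/-- The formal distribution `a*_α(z) = ∑ n, x_{α,n} z ^ n`. -/
def aStar (α : ι) : FunK ι :=
  of (fun u => u α) ⟨fun m => (coordFun α m).prop, fun n => ⟨n, fun _ hu m hm => hu α m hm⟩⟩

@[simp] theorem aStar_apply (α : ι) (u : ι → Lau) : aStar α u = u α := rfl

theorem lift_lattice (D : Vect ι) (G : FunK ι) (n : ℤ) :
    ∃ k, ∀ u ∈ lattice ι n, ∀ m < k, D.1 (coeff m G) u = 0 := by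
  obtain ⟨l, hl⟩ := (continuous_iff D.1).1 D.2 n
  obtain ⟨k, hk⟩ := G.prop.2 l
  exact ⟨k, fun u hu m hm => hl (coeff m G) (fun v hv => hk v hv m hm) u hu⟩

/-- The value at `u` of the result of applying a vector field to all coefficients of `G`. -/
def liftVal (D : Vect ι) (G : FunK ι) (u : ι → Lau) : Lau :=
  HahnSeries.ofSuppBddBelow (fun m => D.1 (coeff m G) u) <| by
    obtain ⟨n, hn⟩ := exists_mem_lattice u
    obtain ⟨k, hk⟩ := lift_lattice D G n
    refine ⟨k, fun m hm => ?_⟩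
    by_contra h
    exact hm (hk u hn m (by omega))

@[simp] theorem liftVal_coeff (D : Vect ι) (G : FunK ι) (u : ι → Lau) (m : ℤ) :
    (liftVal D G u).coeff m = D.1 (coeff m G) u := rfl

/-- A vector field acts on the coefficients of the elements of `Fun K(ū) ⊗̂ ℂ((t))`. -/
def liftFun (D : Vect ι) (G : FunK ι) : FunK ι :=
  of (liftVal D G) ⟨fun m => (D.1 (coeff m G)).prop, fun n => lift_lattice D G n⟩

@[simp] theorem coeff_liftFun (D : Vect ι) (G : FunK ι) (m : ℤ) :
    coeff m (liftFun D G) = D.1 (coeff m G) := rfl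

theorem coeff_mul_local (G H : FunK ι) (n m : ℤ) {k l : ℤ}
    (hk : ∀ u ∈ lattice ι n, ∀ m < k, (G u).coeff m = 0)
    (hl : ∀ u ∈ lattice ι n, ∀ m < l, (H u).coeff m = 0) :
    ∀ u ∈ lattice ι n, (coeff m (G * H) -
      ∑ i ∈ Finset.Icc k (m - l), coeff i G * coeff (m - i) H) u = 0 := fun u hu => by
  rw [Fun.sub_apply, Fun.sum_apply, sub_eq_zero]
  exact lau_coeff_mul (hk u hu) (hl u hu) m

theorem liftFun_mul (D : Vect ι) (G H : FunK ι) :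
    liftFun D (G * H) = G * liftFun D H + H * liftFun D G := by
  ext u m
  obtain ⟨n, hn⟩ := exists_mem_lattice u
  obtain ⟨n', hn'⟩ := (continuous_iff D.1).1 D.2 n
  obtain ⟨k1, hk1⟩ := G.prop.2 n'
  obtain ⟨l1, hl1⟩ := H.prop.2 n'
  obtain ⟨k2, hk2⟩ := G.prop.2 n
  obtain ⟨l2, hl2⟩ := H.prop.2 n
  obtain ⟨k3, hk3⟩ := lift_lattice D G n
  obtain ⟨l3, hl3⟩ := lift_lattice D H n
  obtain ⟨k, hk⟩ : ∃ k, k ≤ k1 ∧ k ≤ k2 ∧ k ≤ k3 := ⟨min k1 (min k2 k3), by omega⟩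
  obtain ⟨l, hl⟩ : ∃ l, l ≤ l1 ∧ l ≤ l2 ∧ l ≤ l3 := ⟨min l1 (min l2 l3), by omega⟩
  have h := hn' _ (coeff_mul_local G H n' m (k := k) (l := l)
    (fun u hu m hm => hk1 u hu m (by omega)) (fun u hu m hm => hl1 u hu m (by omega))) u hn
  rw [map_sub, Fun.sub_apply, sub_eq_zero] at h
  have e1 := lau_coeff_mul (f := G u) (g := liftVal D H u) (k := k) (l := l)
    (fun m hm => hk2 u hn m (by omega)) (fun m hm => hl3 u hn m (by omega)) m
  have e2 := lau_coeff_mul (f := liftVal D G u) (g := H u) (k := k) (l := l)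
    (fun m hm => hk3 u hn m (by omega)) (fun m hm => hl2 u hn m (by omega)) m
  change (D.1 (coeff m (G * H))) u = (G u * liftVal D H u + H u * liftVal D G u).coeff m
  rw [h, HahnSeries.coeff_add, mul_comm (H u), e1, e2, map_sum, Fun.sum_apply,
    ← Finset.sum_add_distrib]
  refine Finset.sum_congr rfl fun i _ => ?_
  rw [Derivation.leibniz]
  simp [mul_comm]

/-- The action of the vector fields on `Fun K(ū) ⊗̂ ℂ((t))`. -/
def lift (ι : Type*) [Fintype ι] : Vect ι →ₗ⁅ℂ⁆ Derivation ℂ (FunK ι) (FunK ι) where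
  toFun D := Derivation.mk'
    { toFun := liftFun D
      map_add' := fun G H => ext_coeff fun m => by
        rw [coeff_liftFun, map_add, map_add, map_add]; rfl
      map_smul' := fun r G => ext_coeff fun m => by
        rw [coeff_liftFun, map_smul, Derivation.map_smul, map_smul]; rfl }
    fun G H => liftFun_mul D G H
  map_add' D E := by
    refine Derivation.ext fun G => ext_coeff fun m => ?_
    rfl
  map_smul' r D := by
    refine Derivation.ext fun G => ext_coeff fun m => ?_
    rfl
  map_lie' {D E} := by
    refine Derivation.ext fun G => ext_coeff fun m => ?_
    rw [Derivation.commutator_apply, map_sub]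
    exact Derivation.commutator_apply (coeff m G)

@[simp] theorem coeff_lift (D : Vect ι) (G : FunK ι) (m : ℤ) :
    coeff m (lift ι D G) = D.1 (coeff m G) := rfl

theorem coeff_der (G : FunK ι) (m : ℤ) :
    coeff m (der ι G) = ((m : ℂ) + 1) • coeff (m + 1) G := by
  ext u
  simp [lauD_coeff]

theorem lift_der (D : Vect ι) (G : FunK ι) : lift ι D (der ι G) = der ι (lift ι D G) :=
  ext_coeff fun m => by
    rw [coeff_lift, coeff_der, coeff_der, Derivation.map_smul, coeff_lift]

theorem res_lift (D : Vect ι) (G : FunK ι) : res ι (lift ι D G) = D.1 (res ι G) := rfl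

end FunK

/-! ### Vector fields with given coefficients -/

/-- The derivative of `F` at `u` in the direction `v`. The functions in question are polynomials in
the parameter. -/
def dirDeriv {ι : Type*} (F : (ι → Lau) → ℂ) (u v : ι → Lau) : ℂ := deriv (fun s : ℂ => F (u + s • v)) 0

theorem add_zero_smul {ι : Type*} (u v : ι → Lau) : u + (0 : ℂ) • v = u := by
  ext α m
  simp

theorem pairing_line (ω u v : ι → Lau) (s : ℂ) :
    pairing ω (u + s • v) = pairing ω u + s * pairing ω v := by
  have h : ∀ α, lauRes ((u + s • v) α * ω α) = lauRes (u α * ω α) + s * lauRes (v α * ω α) := by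
    intro α
    have h1 : (u + s • v) α * ω α = u α * ω α + s • (v α * ω α) := by
      rw [Pi.add_apply, add_mul, Pi.smul_apply]
      congr 1
      exact Algebra.smul_mul_assoc s (v α) (ω α)
    rw [h1, map_add, map_smul, smul_eq_mul]
  simp only [pairing, h, Finset.sum_add_distrib, Finset.mul_sum]

theorem Pol.differentiable {p : (ι → Lau) → ℂ} (hp : p ∈ Pol ι) (u v : ι → Lau) :
    Differentiable ℂ fun s : ℂ => p (u + s • v) := by
  induction hp using Algebra.adjoin_induction with
  | mem p h =>
    obtain ⟨ω, rfl⟩ := h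
    have : (fun s : ℂ => pairing ω (u + s • v)) = fun s => pairing ω u + s * pairing ω v := by
      ext s
      exact pairing_line ω u v s
    rw [this]
    fun_prop
  | algebraMap r => exact differentiable_const r
  | add p q _ _ h1 h2 => exact h1.add h2
  | mul p q _ _ h1 h2 => exact h1.mul h2

theorem Fun.differentiable (F : Fun ι) (u v : ι → Lau) :
    Differentiable ℂ fun s : ℂ => F (u + s • v) := by
  obtain ⟨n, hn⟩ := exists_mem_lattice u
  obtain ⟨k, hk⟩ := exists_mem_lattice v
  obtain ⟨p, hp, h⟩ := F.prop (min n k)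
  have : (fun s : ℂ => F (u + s • v)) = fun s : ℂ => p (u + s • v) := by
    ext s
    exact h _ (Submodule.add_mem _ (lattice_anti (min_le_left _ _) hn)
      (Submodule.smul_mem _ _ (lattice_anti (min_le_right _ _) hk)))
  rw [this]
  exact Pol.differentiable hp u v

theorem dirDeriv_congr {ι : Type*} {F G : (ι → Lau) → ℂ} {n : ℤ} (h : ∀ u ∈ lattice ι n, F u = G u)
    {u v : ι → Lau} (hu : u ∈ lattice ι n) (hv : v ∈ lattice ι n) :
    dirDeriv F u v = dirDeriv G u v := by
  unfold dirDeriv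
  congr 1
  ext s
  exact h _ (Submodule.add_mem _ hu (Submodule.smul_mem _ _ hv))

theorem pairing_mem (ω : ι → Lau) (ξ : ι → FunK ι) :
    (fun u => pairing ω fun α => ξ α u) ∈ funAlg ι := by
  have : (fun u => pairing ω fun α => ξ α u) =
      (∑ α, FunK.res ι (ξ α * FunK.const ι (ω α)) : Fun ι).val := by
    ext u
    rw [Fun.sum_apply]
    rfl
  rw [this]
  exact Fun.prop _

theorem Pol.dirDeriv_mem {p : (ι → Lau) → ℂ} (hp : p ∈ Pol ι) (ξ : ι → FunK ι) :
    (fun u => dirDeriv p u fun α => ξ α u) ∈ funAlg ι := by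
  induction hp using Algebra.adjoin_induction with
  | mem p h =>
    obtain ⟨ω, rfl⟩ := h
    have : (fun u => dirDeriv (pairing ω) u fun α => ξ α u) =
        fun u => pairing ω fun α => ξ α u := by
      ext u
      have : (fun s : ℂ => pairing ω (u + s • fun α => ξ α u)) =
          fun s => pairing ω u + s * pairing ω (fun α => ξ α u) := by
        ext s
        exact pairing_line ω u _ s
      rw [dirDeriv, this]
      simp
    rw [this]
    exact pairing_mem ω ξ
  | algebraMap r =>
    convert (funAlg ι).zero_mem using 1
    ext u
    exact deriv_const 0 r
  | add p q hp hq h1 h2 =>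
    convert (funAlg ι).add_mem h1 h2 using 1
    ext u
    exact deriv_add (Pol.differentiable hp _ _ 0) (Pol.differentiable hq _ _ 0)
  | mul p q hp hq h1 h2 =>
    convert (funAlg ι).add_mem ((funAlg ι).mul_mem h1 (Fun.pol_le hq))
      ((funAlg ι).mul_mem (Fun.pol_le hp) h2) using 1
    ext u
    have := deriv_mul (Pol.differentiable hp u (fun α => ξ α u) 0)
      (Pol.differentiable hq u (fun α => ξ α u) 0)
    rw [add_zero_smul] at this
    exact this

theorem exists_lattice_map (ξ : ι → FunK ι) (n : ℤ) :
    ∃ k ≤ n, ∀ u ∈ lattice ι n, (fun α => ξ α u) ∈ lattice ι k := by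
  choose k hk using fun α => (ξ α).prop.2 n
  rcases isEmpty_or_nonempty ι with h | h
  · exact ⟨n, le_rfl, fun u _ α => (h.false α).elim⟩
  · refine ⟨min n (Finset.univ.inf' Finset.univ_nonempty k), min_le_left _ _,
      fun u hu α m hm => hk α u hu m ?_⟩
    exact lt_of_lt_of_le hm ((min_le_right _ _).trans (Finset.inf'_le _ (Finset.mem_univ α)))

theorem Fun.dirDeriv_mem (F : Fun ι) (ξ : ι → FunK ι) :
    (fun u => dirDeriv F u fun α => ξ α u) ∈ funAlg ι := by
  refine Fun.mem_of_local fun n => ?_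
  obtain ⟨k, hkn, hk⟩ := exists_lattice_map ξ n
  obtain ⟨p, hp, h⟩ := F.prop k
  exact ⟨Fun.of _ (Pol.dirDeriv_mem hp ξ), fun u hu =>
    dirDeriv_congr h (lattice_anti hkn hu) (hk u hu)⟩

/-- The vector field `∑ α, ∑ n, ∂_{x_{α,n}} ξ_{α,n}` with coefficients `ξ α = ∑ n, ξ_{α,n} t ^ n`;
it differentiates a function at `u` in the direction `ξ(u)`. -/
def vf (ξ : ι → FunK ι) : Vect ι :=
  ⟨Derivation.mk'
    { toFun := fun F => Fun.of _ (F.dirDeriv_mem ξ)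
      map_add' := fun F G => by
        ext u
        exact deriv_add (F.differentiable _ _ 0) (G.differentiable _ _ 0)
      map_smul' := fun r F => by
        ext u
        exact deriv_const_mul r (F.differentiable _ _ 0) }
    fun F G => by
      ext u
      have := deriv_mul (F.differentiable u (fun α => ξ α u) 0)
        (G.differentiable u (fun α => ξ α u) 0)
      rw [add_zero_smul, add_comm, mul_comm (deriv _ _)] at this
      exact this,
   (continuous_iff _).2 fun n => by
    obtain ⟨k, hkn, hk⟩ := exists_lattice_map ξ n
    refine ⟨k, fun F hF u hu => ?_⟩
    refine (dirDeriv_congr (G := fun _ => (0 : ℂ)) hF (lattice_anti hkn hu) (hk u hu)).trans ?_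
    exact deriv_const 0 (0 : ℂ)⟩

theorem vf_apply (ξ : ι → FunK ι) (F : Fun ι) (u : ι → Lau) :
    (vf ξ).1 F u = dirDeriv F u fun α => ξ α u := rfl

open Classical in
/-- The vector field `∂_{x_{α,n}}`. -/
def partialX (α : ι) (n : ℤ) : Vect ι := vf (Pi.single α (FunK.const ι (tPow n)))

end Fun

section Local

variable {ι : Type*} [Fintype ι]

/-! ### Vector fields are determined by their coefficients -/

theorem Fun.exists_coord (F : Fun ι) (n : ℤ) :
    ∃ q ∈ Algebra.adjoin ℂ (Set.range fun i : ι × ℤ => coordFun i.1 i.2),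
      ∀ u ∈ lattice ι n, F u = q u := by
  obtain ⟨p, hp, h⟩ := F.prop n
  suffices H : ∃ q ∈ Algebra.adjoin ℂ (Set.range fun i : ι × ℤ => coordFun i.1 i.2),
      ∀ u ∈ lattice ι n, p u = (q : Fun ι) u by
    obtain ⟨q, hq, h'⟩ := H
    exact ⟨q, hq, fun u hu => (h u hu).trans (h' u hu)⟩
  clear h
  induction hp using Algebra.adjoin_induction with
  | mem p h =>
    obtain ⟨ω, rfl⟩ := h
    choose l hl using fun α => lau_exists_order (ω α)
    refine ⟨∑ α, ∑ i ∈ Finset.Icc n (-1 - l α), (ω α).coeff (-1 - i) • coordFun α i,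
      Subalgebra.sum_mem _ fun α _ => Subalgebra.sum_mem _ fun i _ => Subalgebra.smul_mem _
        (Algebra.subset_adjoin (Set.mem_range_self (α, i))) _, fun u hu => ?_⟩
    rw [Fun.sum_apply]
    refine Finset.sum_congr rfl fun α _ => ?_
    rw [Fun.sum_apply]
    refine (lau_coeff_mul (hu α) (hl α) (-1)).trans (Finset.sum_congr rfl fun i _ => ?_)
    rw [Fun.smul_apply, mul_comm]
    rfl
  | algebraMap r => exact ⟨algebraMap ℂ _ r, Subalgebra.algebraMap_mem _ r, fun u _ => rfl⟩
  | add p q _ _ h1 h2 =>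
    obtain ⟨p', hp', h1⟩ := h1
    obtain ⟨q', hq', h2⟩ := h2
    exact ⟨p' + q', add_mem hp' hq', fun u hu => by simp [h1 u hu, h2 u hu]⟩
  | mul p q _ _ h1 h2 =>
    obtain ⟨p', hp', h1⟩ := h1
    obtain ⟨q', hq', h2⟩ := h2
    exact ⟨p' * q', mul_mem hp' hq', fun u hu => by simp [h1 u hu, h2 u hu]⟩

theorem Vect.ext_coord {D E : Vect ι} (h : ∀ α n, D.1 (coordFun α n) = E.1 (coordFun α n)) :
    D = E := by
  refine Subtype.ext (Derivation.ext fun F => Fun.ext fun u => ?_)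
  obtain ⟨n, hn⟩ := exists_mem_lattice u
  obtain ⟨k, hk⟩ := (continuous_iff D.1).1 D.2 n
  obtain ⟨l, hl⟩ := (continuous_iff E.1).1 E.2 n
  obtain ⟨q, hq, hF⟩ := F.exists_coord (min k l)
  have e1 := hk (F - q) (fun v hv => by
    simp [hF v (lattice_anti (min_le_left _ _) hv)]) u hn
  have e2 := hl (F - q) (fun v hv => by
    simp [hF v (lattice_anti (min_le_right _ _) hv)]) u hn
  have e3 : D.1 q = E.1 q := by
    clear e1 e2 hF
    induction hq using Algebra.adjoin_induction with
    | mem p h' =>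
      obtain ⟨i, rfl⟩ := h'
      exact h i.1 i.2
    | algebraMap r => rw [Derivation.map_algebraMap, Derivation.map_algebraMap]
    | add p q _ _ h1 h2 => rw [map_add, map_add, h1, h2]
    | mul p q _ _ h1 h2 => rw [Derivation.leibniz, Derivation.leibniz, h1, h2]
  rw [map_sub, Fun.sub_apply, sub_eq_zero] at e1 e2
  rw [e1, e2, e3]

theorem vf_coordFun (ξ : ι → FunK ι) (α : ι) (n : ℤ) :
    (vf ξ).1 (coordFun α n) = FunK.coeff n (ξ α) := by
  ext u
  rw [vf_apply, dirDeriv]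
  have : (fun s : ℂ => coordFun α n (u + s • fun α => ξ α u)) =
      fun s => (u α).coeff n + s * (ξ α u).coeff n := by
    ext s
    change ((u α) + s • (ξ α u)).coeff n = _
    simp
  rw [this]
  simp

theorem lift_vf_aStar (ξ : ι → FunK ι) (α : ι) :
    FunK.lift ι (vf ξ) (FunK.aStar α) = ξ α :=
  FunK.ext_coeff fun m => vf_coordFun ξ α m

theorem lift_const (D : Vect ι) (f : Lau) : FunK.lift ι D (FunK.const ι f) = 0 :=
  FunK.ext_coeff fun m => D.1.map_algebraMap (f.coeff m)

theorem vf_add (ξ η : ι → FunK ι) : vf ξ + vf η = vf (ξ + η) :=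
  Vect.ext_coord fun α n => by
    change (vf ξ).1 _ + (vf η).1 _ = _
    simp only [vf_coordFun, Pi.add_apply, map_add]

theorem vf_smul (r : ℂ) (ξ : ι → FunK ι) : r • vf ξ = vf (r • ξ) :=
  Vect.ext_coord fun α n => by
    change r • (vf ξ).1 _ = _
    simp only [vf_coordFun, Pi.smul_apply, map_smul]

theorem vf_zero : vf (0 : ι → FunK ι) = 0 := by
  have := vf_smul (0 : ℂ) (0 : ι → FunK ι)
  simpa using this.symm

theorem vf_lie (ξ η : ι → FunK ι) :
    ⁅vf ξ, vf η⁆ = vf fun α => FunK.lift ι (vf ξ) (η α) - FunK.lift ι (vf η) (ξ α) :=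
  Vect.ext_coord fun α n => by
    rw [vf_coordFun, map_sub, FunK.coeff_lift, FunK.coeff_lift, LieSubalgebra.coe_bracket,
      Derivation.commutator_apply, vf_coordFun, vf_coordFun]

/-! ### Local functions -/

/-- The subalgebra of `Fun K(ū) ⊗̂ ℂ((z))` generated by `ℂ((z))` and the `∂_z ^ k a*_α(z)`. Its
elements are the finite sums of products `P(a*_α(z), ∂_z a*_α(z), …) f(z)` of a differential
polynomial and a Laurent series. -/
def locAlg (ι : Type*) [Fintype ι] : Subalgebra ℂ (FunK ι) :=
  Algebra.adjoin ℂ (Set.range (FunK.const ι) ∪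
    {G | ∃ (k : ℕ) (α : ι), G = (FunK.der ι)^[k] (FunK.aStar α)})

theorem const_mem_locAlg (f : Lau) : FunK.const ι f ∈ locAlg ι :=
  Algebra.subset_adjoin (Or.inl ⟨f, rfl⟩)

theorem aStar_mem_locAlg (α : ι) : FunK.aStar α ∈ locAlg ι :=
  Algebra.subset_adjoin (Or.inr ⟨0, α, rfl⟩)

theorem locAlg_of_derivation (D : Derivation ℂ (FunK ι) (FunK ι))
    (h1 : ∀ f, D (FunK.const ι f) ∈ locAlg ι)
    (h2 : ∀ k α, D ((FunK.der ι)^[k] (FunK.aStar α)) ∈ locAlg ι) {G : FunK ι}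
    (hG : G ∈ locAlg ι) : D G ∈ locAlg ι := by
  induction hG using Algebra.adjoin_induction with
  | mem G h =>
    rcases h with ⟨f, rfl⟩ | ⟨k, α, rfl⟩
    · exact h1 f
    · exact h2 k α
  | algebraMap r => rw [Derivation.map_algebraMap]; exact zero_mem _
  | add p q _ _ h h' => rw [map_add]; exact add_mem h h'
  | mul p q hp hq h h' =>
    rw [Derivation.leibniz]
    exact add_mem (mul_mem hp h') (mul_mem hq h)

theorem der_mem_locAlg {G : FunK ι} (hG : G ∈ locAlg ι) : FunK.der ι G ∈ locAlg ι := by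
  refine locAlg_of_derivation _ (fun f => ?_) (fun k α => ?_) hG
  · exact const_mem_locAlg (lauD f)
  · rw [← Function.iterate_succ_apply' (FunK.der ι)]
    exact Algebra.subset_adjoin (Or.inr ⟨k + 1, α, rfl⟩)

theorem lift_iterate_der (D : Vect ι) (k : ℕ) (G : FunK ι) :
    FunK.lift ι D ((FunK.der ι)^[k] G) = (FunK.der ι)^[k] (FunK.lift ι D G) := by
  induction k with
  | zero => rfl
  | succ k ih => rw [Function.iterate_succ_apply', Function.iterate_succ_apply', FunK.lift_der, ih]

theorem lift_mem_locAlg {ξ : ι → FunK ι} (hξ : ∀ α, ξ α ∈ locAlg ι) {G : FunK ι}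
    (hG : G ∈ locAlg ι) : FunK.lift ι (vf ξ) G ∈ locAlg ι := by
  refine locAlg_of_derivation _ (fun f => ?_) (fun k α => ?_) hG
  · rw [lift_const]
    exact zero_mem _
  · rw [lift_iterate_der, lift_vf_aStar]
    induction k with
    | zero => exact hξ α
    | succ k ih =>
      rw [Function.iterate_succ_apply']
      exact der_mem_locAlg ih

end Local

/-! ### The affine Kac–Moody algebra and its completed tensor product with the functions -/

/-- The derivation `d/dt` and the residue of `ℂ((t))`. -/
def lauData : ResidueData Lau ℂ := ⟨lauD, lauRes, lauRes_lauD⟩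

/-- The derivation `∂_t` and the residue of `Fun K(ū) ⊗̂ ℂ((t))`. -/
def funData (ι : Type*) [Fintype ι] : ResidueData (FunK ι) (Fun ι) :=
  ⟨FunK.der ι, FunK.res ι, fun G => by
    rw [FunK.res, FunK.coeff_der]
    simp⟩

section Affine

variable {g : Type*} [LieRing g] [LieAlgebra ℂ g]

/-- The affine Kac–Moody algebra `ĝ = g((t)) ⊕ ℂ c`. -/
abbrev AffLie (κ : InvForm g) : Type _ := Aff κ lauData

/-- The completed tensor product `Fun K(ū) ⊗̂ ĝ`. -/
abbrev FunAff (κ : InvForm g) (ι : Type*) [Fintype ι] : Type _ := Aff κ (funData ι)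

namespace AffLie

/-- The element `a_n = a ⊗ t ^ n`. -/
def mode (κ : InvForm g) (a : g) (n : ℤ) : AffLie κ := Aff.mk κ lauData (tPow n ⊗ₜ[ℂ] a) 0

/-- The central element `c`. -/
def c (κ : InvForm g) : AffLie κ := Aff.mk κ lauData 0 1

end AffLie

/-- The element `1 ⊗ a` of `Fun K(ū) ⊗̂ ĝ` for `a ∈ ĝ`. -/
def FunAff.const {κ : InvForm g} (ι : Type*) [Fintype ι] (a : AffLie κ) : FunAff κ ι :=
  Aff.mk κ (funData ι) (LinearMap.rTensor g (FunK.const ι).toLinearMap a.cur)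
    (algebraMap ℂ (Fun ι) a.cen)

end Affine

/-! ### The ambient Lie algebra -/

section Amb

variable {g : Type*} [LieRing g] [LieAlgebra ℂ g] {κ : InvForm g} {ι : Type*} [Fintype ι]

theorem lift_res_ext (D : Vect ι) (x y : FunK ι ⊗[ℂ] g) :
    D.1 ((funData ι).res (κ.ext (FunK ι) x (derExt g (funData ι).der y))) =
      (funData ι).res (κ.ext (FunK ι) x (derExt g (funData ι).der (derExt g (FunK.lift ι D) y))) +
      (funData ι).res
        (κ.ext (FunK ι) (derExt g (FunK.lift ι D) x) (derExt g (funData ι).der y)) := by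
  have h : derExt g (FunK.lift ι D) (derExt g (funData ι).der y) =
      derExt g (funData ι).der (derExt g (FunK.lift ι D) y) := by
    induction y using TensorProduct.induction_on with
    | zero => simp
    | add y y' hy hy' => simp only [map_add, hy, hy']
    | tmul b v =>
      simp only [derExt_tmul]
      exact congrArg (· ⊗ₜ[ℂ] v) (FunK.lift_der D b)
  have h2 : ∀ G, D.1 ((funData ι).res G) = (funData ι).res (FunK.lift ι D G) := fun G => rfl
  rw [h2, InvForm.ext_der, map_add, h, add_comm]

/-- The action of the vector fields on `Fun K(ū) ⊗̂ ĝ` through the first factor. -/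
def vectAct (D : Vect ι) (x : FunAff κ ι) : FunAff κ ι :=
  Aff.mk κ (funData ι) (derExt g (FunK.lift ι D) x.cur) (D.1 x.cen)

@[simp] theorem cur_vectAct (D : Vect ι) (x : FunAff κ ι) :
    (vectAct D x).cur = derExt g (FunK.lift ι D) x.cur := rfl

@[simp] theorem cen_vectAct (D : Vect ι) (x : FunAff κ ι) : (vectAct D x).cen = D.1 x.cen := rfl

theorem derExt_add (D E : Derivation ℂ (FunK ι) (FunK ι)) (x : FunK ι ⊗[ℂ] g) :
    derExt g (D + E) x = derExt g D x + derExt g E x := by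
  induction x using TensorProduct.induction_on with
  | zero => simp
  | add y y' hy hy' => simp only [map_add, hy, hy']; abel
  | tmul b v => simp [TensorProduct.add_tmul]

theorem derExt_smul (r : ℂ) (D : Derivation ℂ (FunK ι) (FunK ι)) (x : FunK ι ⊗[ℂ] g) :
    derExt g (r • D) x = r • derExt g D x := by
  induction x using TensorProduct.induction_on with
  | zero => simp
  | add y y' hy hy' => simp only [map_add, hy, hy', smul_add]
  | tmul b v => simp [TensorProduct.smul_tmul']

theorem derExt_commutator (D E : Derivation ℂ (FunK ι) (FunK ι)) (x : FunK ι ⊗[ℂ] g) :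
    derExt g ⁅D, E⁆ x = derExt g D (derExt g E x) - derExt g E (derExt g D x) := by
  induction x using TensorProduct.induction_on with
  | zero => simp
  | add y y' hy hy' => simp only [map_add, hy, hy']; abel
  | tmul b v => simp [Derivation.commutator_apply, TensorProduct.sub_tmul]

theorem vectAct_add (D : Vect ι) (x y : FunAff κ ι) :
    vectAct D (x + y) = vectAct D x + vectAct D y := by
  ext1 <;> simp

theorem vectAct_smul (r : ℂ) (D : Vect ι) (x : FunAff κ ι) :
    vectAct D (r • x) = r • vectAct D x := by
  ext1 <;> simp

theorem add_vectAct (D E : Vect ι) (x : FunAff κ ι) :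
    vectAct (D + E) x = vectAct D x + vectAct E x := by
  ext1
  · simp [derExt_add]
  · rfl

theorem smul_vectAct (r : ℂ) (D : Vect ι) (x : FunAff κ ι) :
    vectAct (r • D) x = r • vectAct D x := by
  ext1
  · simp [derExt_smul]
  · rfl

theorem lie_vectAct (D E : Vect ι) (x : FunAff κ ι) :
    vectAct ⁅D, E⁆ x = vectAct D (vectAct E x) - vectAct E (vectAct D x) := by
  ext1
  · simp [derExt_commutator]
  · exact Derivation.commutator_apply _

theorem vectAct_lie (D : Vect ι) (x y : FunAff κ ι) :
    vectAct D ⁅x, y⁆ = ⁅x, vectAct D y⁆ + ⁅vectAct D x, y⁆ := by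
  ext1
  · simp only [cur_vectAct, Aff.cur_lie, Aff.cur_add, derExt_lie]
  · rw [cen_vectAct, Aff.cen_lie, map_neg, lift_res_ext, Aff.cen_add, Aff.cen_lie, Aff.cen_lie,
      neg_add]
    rfl

/-- The semidirect sum `(Vect K(ū) ⊕ Fun K(ū)) ⊕ (Fun K(ū) ⊗̂ ĝ)`, in which the vector fields act on
the functions and on the second summand through its first factor. The first summand is the Lie algebra
of the differential operators of order at most one; the operator in which all `∂_{x_{α,n}}` stand to
the left of the functions, `∑ ∂_{x_{α,n}} ξ_{α,n}`, corresponds to the vector field with the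
coefficients `ξ_{α,n}`. -/
def Amb (κ : InvForm g) (ι : Type*) [Fintype ι] : Type _ := ↥(Vect ι) × Fun ι × FunAff κ ι

namespace Amb

instance : AddCommGroup (Amb κ ι) := inferInstanceAs (AddCommGroup (↥(Vect ι) × Fun ι × FunAff κ ι))

instance : Module ℂ (Amb κ ι) := inferInstanceAs (Module ℂ (↥(Vect ι) × Fun ι × FunAff κ ι))

/-- The element with the given components. -/
def mk (D : Vect ι) (F : Fun ι) (x : FunAff κ ι) : Amb κ ι := (D, F, x)

/-- The vector field component. -/
def vec (X : Amb κ ι) : Vect ι := X.1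

/-- The function component. -/
def fn (X : Amb κ ι) : Fun ι := X.2.1

/-- The component in `Fun K(ū) ⊗̂ ĝ`. -/
def aff (X : Amb κ ι) : FunAff κ ι := X.2.2

@[ext] theorem ext {X Y : Amb κ ι} (h1 : X.vec = Y.vec) (h2 : X.fn = Y.fn) (h3 : X.aff = Y.aff) :
    X = Y := Prod.ext h1 (Prod.ext h2 h3)

@[simp] theorem vec_mk (D : Vect ι) (F : Fun ι) (x : FunAff κ ι) : (mk D F x).vec = D := rfl
@[simp] theorem fn_mk (D : Vect ι) (F : Fun ι) (x : FunAff κ ι) : (mk D F x).fn = F := rfl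
@[simp] theorem aff_mk (D : Vect ι) (F : Fun ι) (x : FunAff κ ι) : (mk D F x).aff = x := rfl
@[simp] theorem vec_add (X Y : Amb κ ι) : (X + Y).vec = X.vec + Y.vec := rfl
@[simp] theorem fn_add (X Y : Amb κ ι) : (X + Y).fn = X.fn + Y.fn := rfl
@[simp] theorem aff_add (X Y : Amb κ ι) : (X + Y).aff = X.aff + Y.aff := rfl
@[simp] theorem vec_zero : (0 : Amb κ ι).vec = 0 := rfl
@[simp] theorem fn_zero : (0 : Amb κ ι).fn = 0 := rfl
@[simp] theorem aff_zero : (0 : Amb κ ι).aff = 0 := rfl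
@[simp] theorem vec_smul (r : ℂ) (X : Amb κ ι) : (r • X).vec = r • X.vec := rfl
@[simp] theorem fn_smul (r : ℂ) (X : Amb κ ι) : (r • X).fn = r • X.fn := rfl
@[simp] theorem aff_smul (r : ℂ) (X : Amb κ ι) : (r • X).aff = r • X.aff := rfl

instance : Bracket (Amb κ ι) (Amb κ ι) where
  bracket X Y := mk ⁅X.vec, Y.vec⁆ (X.vec.1 Y.fn - Y.vec.1 X.fn)
    (vectAct X.vec Y.aff - vectAct Y.vec X.aff + ⁅X.aff, Y.aff⁆)

@[simp] theorem vec_lie (X Y : Amb κ ι) : ⁅X, Y⁆.vec = ⁅X.vec, Y.vec⁆ := rfl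
@[simp] theorem fn_lie (X Y : Amb κ ι) : ⁅X, Y⁆.fn = X.vec.1 Y.fn - Y.vec.1 X.fn := rfl
@[simp] theorem aff_lie (X Y : Amb κ ι) :
    ⁅X, Y⁆.aff = vectAct X.vec Y.aff - vectAct Y.vec X.aff + ⁅X.aff, Y.aff⁆ := rfl

theorem vectAct_sub (D : Vect ι) (x y : FunAff κ ι) :
    vectAct D (x - y) = vectAct D x - vectAct D y := by
  ext1 <;> simp

instance : LieRing (Amb κ ι) where
  add_lie X Y Z := by
    ext1
    · simp
    · simp [Derivation.add_apply]
      abel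
    · simp only [aff_lie, vec_add, aff_add, add_vectAct, vectAct_add, add_lie]
      abel
  lie_add X Y Z := by
    ext1
    · simp
    · simp [Derivation.add_apply]
      abel
    · simp only [aff_lie, vec_add, aff_add, add_vectAct, vectAct_add, lie_add]
      abel
  lie_self X := by
    ext1 <;> simp
  leibniz_lie X Y Z := by
    ext1
    · simp
    · simp only [fn_lie, fn_add, vec_lie, LieSubalgebra.coe_bracket, Derivation.commutator_apply,
        map_sub]
      abel
    · simp only [aff_lie, aff_add, vec_lie, lie_vectAct, vectAct_add, vectAct_sub, vectAct_lie,
        lie_add, add_lie, lie_sub, sub_lie]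
      rw [leibniz_lie X.aff Y.aff Z.aff, ← lie_skew (vectAct Y.vec X.aff) Z.aff,
        ← lie_skew (vectAct Z.vec X.aff) Y.aff]
      abel

instance : LieAlgebra ℂ (Amb κ ι) where
  lie_smul r X Y := by
    ext1
    · simp
    · simp [smul_sub]
    · simp [smul_vectAct, vectAct_smul, smul_sub, smul_add]

end Amb

/-! ### The local Lie algebra -/

/-- The local part of `Fun K(ū) ⊗̂ p((t))`: the span of the Fourier coefficients
`Res_{z=0} P(z) h(z) f(z) dz = P(t) f(t) ⊗ h` with `h ∈ p`. -/
def locCur (p : LieSubalgebra ℂ g) (ι : Type*) [Fintype ι] : Submodule ℂ (FunK ι ⊗[ℂ] g) :=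
  Submodule.span ℂ {x | ∃ G ∈ locAlg ι, ∃ h ∈ p, x = G ⊗ₜ[ℂ] h}

/-- The local functions `Res_{z=0} P(a*_α(z), ∂_z a*_α(z), …) f(z) dz`. -/
def locFun (ι : Type*) [Fintype ι] : Submodule ℂ (Fun ι) :=
  (Subalgebra.toSubmodule (locAlg ι)).map (FunK.res ι)

theorem vectAct_mem_locCur {p : LieSubalgebra ℂ g} {ξ : ι → FunK ι} (hξ : ∀ α, ξ α ∈ locAlg ι)
    {x : FunK ι ⊗[ℂ] g} (hx : x ∈ locCur p ι) :
    derExt g (FunK.lift ι (vf ξ)) x ∈ locCur p ι := by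
  induction hx using Submodule.span_induction with
  | mem x h =>
    obtain ⟨G, hG, h, hh, rfl⟩ := h
    exact Submodule.subset_span ⟨_, lift_mem_locAlg hξ hG, h, hh, rfl⟩
  | zero => rw [map_zero]; exact zero_mem _
  | add x y _ _ h h' => rw [map_add]; exact add_mem h h'
  | smul r x _ h => rw [map_smul]; exact Submodule.smul_mem _ r h

theorem lie_mem_locCur {p : LieSubalgebra ℂ g} {x y : FunK ι ⊗[ℂ] g} (hx : x ∈ locCur p ι)
    (hy : y ∈ locCur p ι) : ⁅x, y⁆ ∈ locCur p ι := by
  induction hx using Submodule.span_induction with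
  | mem x h =>
    obtain ⟨G, hG, h, hh, rfl⟩ := h
    induction hy using Submodule.span_induction with
    | mem y h =>
      obtain ⟨G', hG', h', hh', rfl⟩ := h
      exact Submodule.subset_span ⟨_, mul_mem hG hG', _, p.lie_mem hh hh', rfl⟩
    | zero => rw [lie_zero]; exact zero_mem _
    | add x y _ _ h h' => rw [lie_add]; exact add_mem h h'
    | smul r x _ h => rw [lie_smul]; exact Submodule.smul_mem _ r h
  | zero => rw [zero_lie]; exact zero_mem _
  | add x y _ _ h h' => rw [add_lie]; exact add_mem h h'
  | smul r x _ h => rw [smul_lie]; exact Submodule.smul_mem _ r h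

theorem res_mem_locFun {p : LieSubalgebra ℂ g} {x y : FunK ι ⊗[ℂ] g} (hx : x ∈ locCur p ι)
    (hy : y ∈ locCur p ι) :
    (funData ι).res (κ.ext (FunK ι) x (derExt g (funData ι).der y)) ∈ locFun ι := by
  have key : κ.ext (FunK ι) x (derExt g (funData ι).der y) ∈ locAlg ι := by
    induction hx using Submodule.span_induction with
    | mem x h =>
      obtain ⟨G, hG, h, hh, rfl⟩ := h
      induction hy using Submodule.span_induction with
      | mem y h =>
        obtain ⟨G', hG', h', hh', rfl⟩ := h
        rw [derExt_tmul, InvForm.ext_tmul]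
        exact Subalgebra.smul_mem _ (mul_mem hG (der_mem_locAlg hG')) _
      | zero => rw [map_zero, map_zero]; exact zero_mem _
      | add x y _ _ h h' => rw [map_add, map_add]; exact add_mem h h'
      | smul r x _ h =>
        rw [map_smul, LinearMap.map_smul_of_tower]; exact Subalgebra.smul_mem _ h r
    | zero => rw [map_zero, LinearMap.zero_apply]; exact zero_mem _
    | add x y _ _ h h' => rw [map_add, LinearMap.add_apply]; exact add_mem h h'
    | smul r x _ h =>
      rw [LinearMap.map_smul_of_tower, LinearMap.smul_apply]; exact Subalgebra.smul_mem _ h r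
  exact Submodule.mem_map_of_mem key

theorem vf_mem_locFun {ξ : ι → FunK ι} (hξ : ∀ α, ξ α ∈ locAlg ι) {F : Fun ι}
    (hF : F ∈ locFun ι) : (vf ξ).1 F ∈ locFun ι := by
  obtain ⟨G, hG, rfl⟩ := hF
  exact ⟨_, lift_mem_locAlg hξ hG, rfl⟩

/-- The local vector fields: the span of the `Res_{z=0} a_β(z) P(a*_α(z), ∂_z a*_α(z), …) f(z) dz`,
i.e. the vector fields `∑ α, ∑ n, ∂_{x_{α,n}} ξ_{α,n}` for which `ξ_α(z) = ∑ n, ξ_{α,n} z ^ n` is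
local. -/
def locVect (ι : Type*) [Fintype ι] : Submodule ℂ (Vect ι) where
  carrier := {D | ∃ ξ : ι → FunK ι, (∀ α, ξ α ∈ locAlg ι) ∧ D = vf ξ}
  add_mem' := by
    rintro _ _ ⟨ξ, hξ, rfl⟩ ⟨η, hη, rfl⟩
    exact ⟨ξ + η, fun α => add_mem (hξ α) (hη α), vf_add ξ η⟩
  zero_mem' := ⟨0, fun α => zero_mem _, vf_zero.symm⟩
  smul_mem' := by
    rintro r _ ⟨ξ, hξ, rfl⟩
    exact ⟨r • ξ, fun α => Subalgebra.smul_mem _ (hξ α) r, vf_smul r ξ⟩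

/-- The local Lie algebra `R_loc`, the semidirect sum of the local differential operators of order at
most one and of the local part of `Fun K(ū) ⊗̂ (p((t)) ⊕ ℂ c)`. -/
def Rloc (κ : InvForm g) (p : LieSubalgebra ℂ g) (ι : Type*) [Fintype ι] :
    LieSubalgebra ℂ (Amb κ ι) where
  carrier := {X | X.vec ∈ locVect ι ∧ X.fn ∈ locFun ι ∧ X.aff.cur ∈ locCur p ι ∧
    X.aff.cen ∈ locFun ι}
  add_mem' hX hY := ⟨add_mem hX.1 hY.1, add_mem hX.2.1 hY.2.1, add_mem hX.2.2.1 hY.2.2.1,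
    add_mem hX.2.2.2 hY.2.2.2⟩
  zero_mem' := ⟨zero_mem _, zero_mem _, zero_mem _, zero_mem _⟩
  smul_mem' r _ hX := ⟨Submodule.smul_mem _ r hX.1, Submodule.smul_mem _ r hX.2.1,
    Submodule.smul_mem _ r hX.2.2.1, Submodule.smul_mem _ r hX.2.2.2⟩
  lie_mem' {X Y} hX hY := by
    obtain ⟨⟨ξ, hξ, h1⟩, h2, h3, h4⟩ := hX
    obtain ⟨⟨η, hη, h1'⟩, h2', h3', h4'⟩ := hY
    change ⁅X, Y⁆.vec ∈ locVect ι ∧ ⁅X, Y⁆.fn ∈ locFun ι ∧ ⁅X, Y⁆.aff.cur ∈ locCur p ι ∧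
      ⁅X, Y⁆.aff.cen ∈ locFun ι
    rw [Amb.vec_lie, Amb.fn_lie, Amb.aff_lie, h1, h1', vf_lie]
    refine ⟨⟨_, fun α => sub_mem (lift_mem_locAlg hξ (hη α)) (lift_mem_locAlg hη (hξ α)), rfl⟩,
      sub_mem (vf_mem_locFun hξ h2') (vf_mem_locFun hη h2),
      add_mem (sub_mem (vectAct_mem_locCur hξ h3') (vectAct_mem_locCur hη h3))
        (lie_mem_locCur h3 h3'),
      add_mem (sub_mem (vf_mem_locFun hξ h4') (vf_mem_locFun hη h4))
        (neg_mem (res_mem_locFun h3 h3'))⟩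

end Amb

/-! ### Standard parabolic subalgebras -/

section Parabolic

open LieAlgebra LieAlgebra.IsKilling LieModule

variable {g : Type*} [LieRing g] [LieAlgebra ℂ g] [FiniteDimensional ℂ g] [IsKilling ℂ g]
variable {H : LieSubalgebra ℂ g} [H.IsCartanSubalgebra]

/-- The sums of simple roots. -/
def posCone (b : (rootSystem H).Base) : AddSubmonoid (Module.Dual ℂ H) :=
  AddSubmonoid.closure ((rootSystem H).root '' b.support)

/-- The subgroup `ℤΣ` of the root lattice. -/
def latticeSpan (Sig : Set H.root) : AddSubgroup (Module.Dual ℂ H) :=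
  AddSubgroup.closure ((rootSystem H).root '' Sig)

/-- The roots of the nilradical: the positive roots outside `Δ_Σ = Δ ∩ ℤΣ`. -/
def IsNilRoot (b : (rootSystem H).Base) (Sig : Set H.root) (α : H.root) : Prop :=
  (rootSystem H).root α ∈ posCone b ∧ (rootSystem H).root α ∉ latticeSpan Sig

/-- The Levi subalgebra `l = h ⊕ ⨁_{α ∈ Δ_Σ} g_α`. -/
def levi (Sig : Set H.root) : Submodule ℂ g :=
  H.toSubmodule ⊔ ⨆ (α : H.root) (_ : (rootSystem H).root α ∈ latticeSpan Sig),
    (rootSpace H α.1).toSubmodule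

/-- The nilradical `u = ⨁ g_α`, the sum over the positive roots outside `Δ_Σ`. -/
def nilrad (b : (rootSystem H).Base) (Sig : Set H.root) : Submodule ℂ g :=
  ⨆ (α : H.root) (_ : IsNilRoot b Sig α), (rootSpace H α.1).toSubmodule

/-- The opposite nilradical `ū = ⨁ g_{-α}`, the sum over the positive roots outside `Δ_Σ`. -/
def nilradOpp (b : (rootSystem H).Base) (Sig : Set H.root) : Submodule ℂ g :=
  ⨆ (α : H.root) (_ : IsNilRoot b Sig α), (rootSpace H (-α.1 : Weight ℂ H g)).toSubmodule

open Classical in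
/-- The linear form on the dual of `H` that vanishes on the simple roots in `Σ` and is `1` on the
other simple roots. -/
def grade (b : (rootSystem H).Base) (Sig : Set H.root) : Module.Dual ℂ H →ₗ[ℂ] ℂ :=
  b.toWeightBasis.constr ℂ fun i => if i.1 ∈ Sig then 0 else 1

theorem grade_simple_mem (b : (rootSystem H).Base) {Sig : Set H.root} {i : H.root}
    (hi : i ∈ b.support) (h : i ∈ Sig) : grade b Sig ((rootSystem H).root i) = 0 := by
  rw [← b.toWeightBasis_apply ⟨i, hi⟩, grade, Module.Basis.constr_basis, if_pos h]

theorem grade_simple_not_mem (b : (rootSystem H).Base) {Sig : Set H.root} {i : H.root}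
    (hi : i ∈ b.support) (h : i ∉ Sig) : grade b Sig ((rootSystem H).root i) = 1 := by
  rw [← b.toWeightBasis_apply ⟨i, hi⟩, grade, Module.Basis.constr_basis, if_neg h]

theorem grade_posCone (b : (rootSystem H).Base) (Sig : Set H.root) {x : Module.Dual ℂ H}
    (hx : x ∈ posCone b) : ∃ n : ℕ, grade b Sig x = n ∧ (n = 0 → x ∈ latticeSpan Sig) := by
  induction hx using AddSubmonoid.closure_induction with
  | mem x h =>
    obtain ⟨i, hi, rfl⟩ := h
    by_cases h : i ∈ Sig
    · exact ⟨0, by rw [grade_simple_mem b hi h, Nat.cast_zero], fun _ => AddSubgroup.subset_closure ⟨i, h, rfl⟩⟩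
    · exact ⟨1, by rw [grade_simple_not_mem b hi h, Nat.cast_one], by simp⟩
  | zero => exact ⟨0, by simp, fun _ => zero_mem _⟩
  | add x y _ _ hx hy =>
    obtain ⟨n, h1, h2⟩ := hx
    obtain ⟨m, h3, h4⟩ := hy
    exact ⟨n + m, by simp [h1, h3], fun h => add_mem (h2 (by omega)) (h4 (by omega))⟩

theorem grade_latticeSpan (b : (rootSystem H).Base) {Sig : Set H.root} (hS : Sig ⊆ b.support)
    {x : Module.Dual ℂ H} (hx : x ∈ latticeSpan Sig) : grade b Sig x = 0 := by
  induction hx using AddSubgroup.closure_induction with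
  | mem x h =>
    obtain ⟨i, hi, rfl⟩ := h
    exact grade_simple_mem b (hS hi) hi
  | zero => exact map_zero _
  | add x y _ _ hx hy => rw [map_add, hx, hy, add_zero]
  | neg x _ hx => rw [map_neg, hx, neg_zero]

theorem root_trichotomy (b : (rootSystem H).Base) (Sig : Set H.root) (α : H.root) :
    (rootSystem H).root α ∈ latticeSpan Sig ∨ IsNilRoot b Sig α ∨
      (-(rootSystem H).root α ∈ posCone b ∧ -(rootSystem H).root α ∉ latticeSpan Sig) := by
  by_cases h : (rootSystem H).root α ∈ latticeSpan Sig
  · exact Or.inl h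
  · rcases b.root_mem_or_neg_mem α with h' | h'
    · exact Or.inr (Or.inl ⟨h', h⟩)
    · exact Or.inr (Or.inr ⟨h', fun h2 => h (by simpa using neg_mem h2)⟩)

/-- The sum of the weight spaces of non-negative grade. -/
def gradeNonneg (b : (rootSystem H).Base) (Sig : Set H.root) : Submodule ℂ g :=
  ⨆ (χ : Weight ℂ H g) (_ : ∃ n : ℕ, grade b Sig χ.toLinear = n), (genWeightSpace g χ).toSubmodule

theorem rootSpace_weight_zero {g : Type*} [LieRing g] [LieAlgebra ℂ g] [FiniteDimensional ℂ g]
    {H : LieSubalgebra ℂ g} [H.IsCartanSubalgebra] {χ : Weight ℂ H g} (h : χ.IsZero) :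
    (genWeightSpace g χ).toSubmodule = H.toSubmodule := by
  have h1 : (χ : H → ℂ) = 0 := h
  rw [h1]
  exact congrArg LieSubmodule.toSubmodule (rootSpace_zero_eq ℂ g H)

theorem levi_sup_nilrad (b : (rootSystem H).Base) {Sig : Set H.root} (hS : Sig ⊆ b.support) :
    levi Sig ⊔ nilrad b Sig = gradeNonneg b Sig := by
  apply le_antisymm
  · refine sup_le (sup_le ?_ (iSup₂_le fun α hα => ?_)) (iSup₂_le fun α hα => ?_)
    · by_cases hb : (rootSpace H (0 : H → ℂ)) = ⊥
      · rw [rootSpace_zero_eq] at hb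
        have : H.toSubmodule = ⊥ := congrArg LieSubmodule.toSubmodule hb
        rw [this]
        exact bot_le
      · refine le_trans (rootSpace_weight_zero (χ := ⟨0, hb⟩) rfl).ge
          (le_iSup₂_of_le (⟨0, hb⟩ : Weight ℂ H g) ⟨0, ?_⟩ le_rfl)
        have : (⟨0, hb⟩ : Weight ℂ H g).toLinear = 0 := rfl
        rw [this]
        simp
    · exact le_iSup₂_of_le α.1 ⟨0, by simpa using grade_latticeSpan b hS hα⟩ le_rfl
    · obtain ⟨n, hn, -⟩ := grade_posCone b Sig hα.1
      exact le_iSup₂_of_le α.1 ⟨n, hn⟩ le_rfl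
  · refine iSup₂_le fun χ hχ => ?_
    obtain ⟨n, hn⟩ := hχ
    by_cases h0 : χ.IsZero
    · rw [rootSpace_weight_zero h0]
      exact le_sup_left.trans le_sup_left
    · have hmem : χ ∈ H.root := by simpa using h0
      rcases root_trichotomy b Sig ⟨χ, hmem⟩ with h | h | h
      · exact (le_iSup₂_of_le (f := fun (α : H.root) (_ : (rootSystem H).root α ∈ latticeSpan Sig) =>
          (rootSpace H α.1).toSubmodule) ⟨χ, hmem⟩ h le_rfl).trans (le_sup_right.trans le_sup_left)
      · exact (le_iSup₂_of_le (f := fun (α : H.root) (_ : IsNilRoot b Sig α) =>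
          (rootSpace H α.1).toSubmodule) ⟨χ, hmem⟩ h le_rfl).trans le_sup_right
      · exfalso
        obtain ⟨m, hm, hm'⟩ := grade_posCone b Sig h.1
        have e : grade b Sig ((rootSystem H).root ⟨χ, hmem⟩) = n := hn
        rw [map_neg, e] at hm
        have : (n : ℂ) + m = 0 := by rw [← hm]; ring
        have : n + m = 0 := by exact_mod_cast this
        exact h.2 (hm' (by omega))

theorem lie_mem_gradeNonneg (b : (rootSystem H).Base) (Sig : Set H.root) {x y : g}
    (hx : x ∈ gradeNonneg b Sig) (hy : y ∈ gradeNonneg b Sig) : ⁅x, y⁆ ∈ gradeNonneg b Sig := by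
  have key : ∀ (χ ψ : Weight ℂ H g), (∃ n : ℕ, grade b Sig χ.toLinear = n) →
      (∃ n : ℕ, grade b Sig ψ.toLinear = n) → ∀ x ∈ genWeightSpace g χ, ∀ y ∈ genWeightSpace g ψ,
      ⁅x, y⁆ ∈ gradeNonneg b Sig := by
    rintro χ ψ ⟨n, hn⟩ ⟨m, hm⟩ x hx y hy
    have h1 : ⁅x, y⁆ ∈ genWeightSpace g ((χ : H → ℂ) + (ψ : H → ℂ)) :=
      lie_mem_genWeightSpace_of_mem_genWeightSpace hx hy
    by_cases hb : genWeightSpace g ((χ : H → ℂ) + (ψ : H → ℂ)) = ⊥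
    · rw [hb, LieSubmodule.mem_bot] at h1
      rw [h1]
      exact zero_mem _
    · have e : (⟨_, hb⟩ : Weight ℂ H g).toLinear = χ.toLinear + ψ.toLinear := by
        ext z
        rfl
      have h2 : ∃ k : ℕ, grade b Sig (⟨_, hb⟩ : Weight ℂ H g).toLinear = k :=
        ⟨n + m, by rw [e, map_add, hn, hm, Nat.cast_add]⟩
      exact (le_iSup₂_of_le (f := fun (χ : Weight ℂ H g)
        (_ : ∃ n : ℕ, grade b Sig χ.toLinear = n) => (genWeightSpace g χ).toSubmodule)
        ⟨_, hb⟩ h2 le_rfl) h1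
  unfold gradeNonneg at hx hy
  induction hx using Submodule.iSup_induction' with
  | zero => rw [zero_lie]; exact zero_mem _
  | add x y _ _ h h' => rw [add_lie]; exact add_mem h h'
  | mem χ x hx =>
    induction hx using Submodule.iSup_induction' with
    | zero => rw [zero_lie]; exact zero_mem _
    | add x y _ _ h h' => rw [add_lie]; exact add_mem h h'
    | mem hχ x hx =>
      induction hy using Submodule.iSup_induction' with
      | zero => rw [lie_zero]; exact zero_mem _
      | add x y _ _ h h' => rw [lie_add]; exact add_mem h h'
      | mem ψ y hy =>
        induction hy using Submodule.iSup_induction' with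
        | zero => rw [lie_zero]; exact zero_mem _
        | add x y _ _ h h' => rw [lie_add]; exact add_mem h h'
        | mem hψ y hy => exact key χ ψ hχ hψ x hx y hy

/-- The standard parabolic subalgebra `p = l ⊕ u`. -/
def parabolic (b : (rootSystem H).Base) {Sig : Set H.root} (hS : Sig ⊆ b.support) :
    LieSubalgebra ℂ g :=
  { levi Sig ⊔ nilrad b Sig with
    lie_mem' := fun {x y} hx hy => by
      change ⁅x, y⁆ ∈ levi Sig ⊔ nilrad b Sig
      change x ∈ levi Sig ⊔ nilrad b Sig at hx
      change y ∈ levi Sig ⊔ nilrad b Sig at hy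
      rw [levi_sup_nilrad b hS] at hx hy ⊢
      exact lie_mem_gradeNonneg b Sig hx hy }

theorem nilradOpp_eq (b : (rootSystem H).Base) {Sig : Set H.root} (hS : Sig ⊆ b.support) :
    nilradOpp b Sig = ⨆ (χ : Weight ℂ H g) (_ : ¬∃ n : ℕ, grade b Sig χ.toLinear = n),
      (genWeightSpace g χ).toSubmodule := by
  have hneg : ∀ χ : Weight ℂ H g, (-χ).toLinear = -χ.toLinear := fun χ => by
    ext z
    rfl
  apply le_antisymm
  · refine iSup₂_le fun α hα => ?_
    refine le_iSup₂_of_le (-α.1) ?_ le_rfl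
    rintro ⟨n, hn⟩
    obtain ⟨m, hm, hm'⟩ := grade_posCone b Sig hα.1
    rw [hneg, map_neg] at hn
    have e : grade b Sig α.1.toLinear = m := hm
    rw [e] at hn
    have : (n : ℂ) + m = 0 := by rw [← hn]; ring
    have : n + m = 0 := by exact_mod_cast this
    exact hα.2 (hm' (by omega))
  · refine iSup₂_le fun χ hχ => ?_
    by_cases h0 : χ.IsZero
    · exfalso
      refine hχ ⟨0, ?_⟩
      have : χ.toLinear = 0 := by
        ext z
        exact congrFun h0 z
      rw [this]
      simp
    · have hmem : χ ∈ H.root := by simpa using h0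
      have hmem' : -χ ∈ H.root := by simpa using h0
      rcases root_trichotomy b Sig ⟨χ, hmem⟩ with h | h | h
      · exact (hχ ⟨0, by simpa using grade_latticeSpan b hS h⟩).elim
      · obtain ⟨n, hn, -⟩ := grade_posCone b Sig h.1
        exact (hχ ⟨n, hn⟩).elim
      · have e : (rootSystem H).root ⟨-χ, hmem'⟩ = -(rootSystem H).root ⟨χ, hmem⟩ := hneg χ
        refine le_iSup₂_of_le (⟨-χ, hmem'⟩ : H.root) ⟨?_, ?_⟩ ?_
        · rw [e]; exact h.1
        · rw [e]; exact h.2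
        · rw [neg_neg]

/-- The decomposition `g = ū ⊕ p`. -/
theorem isCompl_parabolic (b : (rootSystem H).Base) {Sig : Set H.root} (hS : Sig ⊆ b.support) :
    IsCompl (nilradOpp b Sig) (parabolic b hS).toSubmodule := by
  change IsCompl (nilradOpp b Sig) (levi Sig ⊔ nilrad b Sig)
  rw [levi_sup_nilrad b hS, nilradOpp_eq b hS, gradeNonneg]
  have hind : iSupIndep fun χ : Weight ℂ H g => (genWeightSpace g χ).toSubmodule :=
    (LieSubmodule.iSupIndep_toSubmodule).2 (iSupIndep_genWeightSpace' ℂ H g)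
  have htop : ⨆ χ : Weight ℂ H g, (genWeightSpace g χ).toSubmodule = ⊤ := by
    rw [← LieSubmodule.iSup_toSubmodule, iSup_genWeightSpace_eq_top', LieSubmodule.top_toSubmodule]
  constructor
  · exact hind.disjoint_biSup_biSup (s := {χ : Weight ℂ H g | ¬∃ n : ℕ, grade b Sig χ.toLinear = n})
      (t := {χ : Weight ℂ H g | ∃ n : ℕ, grade b Sig χ.toLinear = n})
      (Set.disjoint_left.2 fun χ h h' => h h')
  · rw [codisjoint_iff, eq_top_iff, ← htop]
    refine iSup_le fun χ => ?_
    by_cases h : ∃ n : ℕ, grade b Sig χ.toLinear = n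
    · exact (le_iSup₂_of_le (f := fun (χ : Weight ℂ H g)
        (_ : ∃ n : ℕ, grade b Sig χ.toLinear = n) => (genWeightSpace g χ).toSubmodule)
        χ h le_rfl).trans le_sup_right
    · exact (le_iSup₂_of_le (f := fun (χ : Weight ℂ H g) (_ : ¬∃ n : ℕ, grade b Sig χ.toLinear = n) =>
        (genWeightSpace g χ).toSubmodule) χ h le_rfl).trans le_sup_left

/-- `θ` is the maximal root: `θ - β` is a sum of simple roots for all roots `β`. -/
def IsMaximalRoot (b : (rootSystem H).Base) (θ : H.root) : Prop :=
  ∀ β : H.root, (rootSystem H).root θ - (rootSystem H).root β ∈ posCone b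

/-- The multiple of the Killing form for which the induced form on the dual of `H` satisfies
`(θ, θ) = 2`. The Killing form induces the value `θ (h_θ)`, where `h_θ ∈ H` represents `θ`. -/
def normForm (θ : H.root) : InvForm g where
  form := ((rootSystem H).root θ ((cartanEquivDual H).symm ((rootSystem H).root θ)) / 2) •
    killingForm ℂ g
  symm x y := by
    rw [LinearMap.smul_apply, LinearMap.smul_apply, LinearMap.smul_apply, LinearMap.smul_apply,
      killingForm, traceForm_comm]
  inv x y z := by
    rw [LinearMap.smul_apply, LinearMap.smul_apply, LinearMap.smul_apply, LinearMap.smul_apply,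
      killingForm, traceForm_apply_lie_apply]

end Parabolic

/-! ### The formulas -/

/-- The value `φ(T)` of a formal power series at a nilpotent endomorphism. -/
def nilEval {V : Type*} [AddCommGroup V] [Module ℂ V] (φ : PowerSeries ℂ) (T : Module.End ℂ V) :
    Module.End ℂ V :=
  ∑ k ∈ Finset.range (nilpotencyClass T), PowerSeries.coeff k φ • T ^ k

/-- The power series `e ^ X`. -/
def expSeries : PowerSeries ℂ := PowerSeries.exp ℂ

/-- The power series `X e ^ X / (e ^ X - 1)`. -/
def bernPlus : PowerSeries ℂ := bernoulli'PowerSeries ℂ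

theorem bernPlus_mul : bernPlus * (expSeries - 1) = PowerSeries.X * expSeries :=
  bernoulli'PowerSeries_mul_exp_sub_one ℂ

/-- The power series `X / (e ^ X - 1)`. -/
def bernMinus : PowerSeries ℂ := bernoulliPowerSeries ℂ

theorem bernMinus_mul : bernMinus * (expSeries - 1) = PowerSeries.X :=
  bernoulliPowerSeries_mul_exp_sub_one ℂ

/-- The power series `(e ^ X - 1) / X`. -/
def expQuot : PowerSeries ℂ := PowerSeries.mk fun k => ((k + 1).factorial : ℂ)⁻¹

theorem X_mul_expQuot : PowerSeries.X * expQuot = expSeries - 1 := by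
  ext k
  cases k with
  | zero => simp [expSeries]
  | succ k => simp [expSeries, expQuot, PowerSeries.coeff_succ_X_mul, PowerSeries.coeff_one]

section Formulas

variable {g : Type*} [LieRing g] [LieAlgebra ℂ g] {ι : Type*} [Fintype ι]
variable {V P : Submodule ℂ g}

/-- The adjoint action `ad x`. -/
def adEnd {L : Type*} [LieRing L] [LieAlgebra ℂ L] (x : L) : Module.End ℂ L := LieAlgebra.ad ℂ L x

/-- The generic point `u(z) = ∑ α, a*_α(z) f_α` in `Fun K(ū) ⊗̂ ℂ((z)) ⊗ g`. -/
def uDist (f : Module.Basis ι ℂ V) : FunK ι ⊗[ℂ] g := ∑ α, FunK.aStar α ⊗ₜ[ℂ] (f α : g)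

/-- The generic point `u(x) = ∑ α, ∑ n, x_{α,n} f_{α,n}` as an element of `Fun K(ū) ⊗̂ ĝ`. -/
def uPoint (κ : InvForm g) (f : Module.Basis ι ℂ V) : FunAff κ ι := Aff.mk κ (funData ι) (uDist f) 0

/-- The component in `Fun K(ū) ⊗̂ V((t))` with respect to `g = V ⊕ P`. -/
def compl1 (ι : Type*) [Fintype ι] (hc : IsCompl V P) : FunK ι ⊗[ℂ] g →ₗ[ℂ] FunK ι ⊗[ℂ] g :=
  TensorProduct.map LinearMap.id (V.projection P hc)

/-- The component in `Fun K(ū) ⊗̂ P((t))` with respect to `g = V ⊕ P`. -/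
def compl2 (ι : Type*) [Fintype ι] (hc : IsCompl V P) : FunK ι ⊗[ℂ] g →ₗ[ℂ] FunK ι ⊗[ℂ] g :=
  TensorProduct.map LinearMap.id (P.projection V hc.symm)

/-- The `α`-th coordinate, an element of `Fun K(ū) ⊗̂ ℂ((t))`, with respect to the basis `f` of the
component in `V`. Its coefficient at `t ^ n` is the `(α, n)`-th coordinate. -/
def coordV (f : Module.Basis ι ℂ V) (hc : IsCompl V P) (α : ι) : FunK ι ⊗[ℂ] g →ₗ[ℂ] FunK ι :=
  (TensorProduct.rid ℂ (FunK ι)).toLinearMap ∘ₗ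
    TensorProduct.map LinearMap.id (f.coord α ∘ₗ V.projectionOnto P hc)

/-- The component in `Fun K(ū) ⊗̂ ū_nat`, where `ū_nat = ū((t))`. -/
def natV {κ : InvForm g} (hc : IsCompl V P) (x : FunAff κ ι) : FunAff κ ι :=
  Aff.mk κ (funData ι) (compl1 ι hc x.cur) 0

/-- The component in `Fun K(ū) ⊗̂ p_nat`, where `p_nat = p((t)) ⊕ ℂ c`. -/
def natP {κ : InvForm g} (hc : IsCompl V P) (x : FunAff κ ι) : FunAff κ ι :=
  Aff.mk κ (funData ι) (compl2 ι hc x.cur) x.cen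

/-- The element `e^{-ad u(x)} a` for `a ∈ ĝ`. -/
def expAff {κ : InvForm g} (f : Module.Basis ι ℂ V) (a : AffLie κ) : FunAff κ ι :=
  nilEval expSeries (-adEnd (uPoint κ f)) (FunAff.const ι a)

/-- The element `(ad u(x) e^{ad u(x)} / (e^{ad u(x)} - id)) (e^{-ad u(x)} a)_{ū_nat}` for `a ∈ ĝ`. -/
def tAff {κ : InvForm g} (f : Module.Basis ι ℂ V) (hc : IsCompl V P) (a : AffLie κ) : FunAff κ ι :=
  nilEval bernPlus (adEnd (uPoint κ f)) (natV hc (expAff f a))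

/-- The element `e^{-ad u(z)} a` for `a ∈ g`. -/
def expDist (f : Module.Basis ι ℂ V) (a : g) : FunK ι ⊗[ℂ] g :=
  nilEval expSeries (-adEnd (uDist f)) (1 ⊗ₜ[ℂ] a)

/-- The element `T(a,z) = (ad u(z) e^{ad u(z)} / (e^{ad u(z)} - id)) (e^{-ad u(z)} a)_ū` for `a ∈ g`. -/
def tDist (f : Module.Basis ι ℂ V) (hc : IsCompl V P) (a : g) : FunK ι ⊗[ℂ] g :=
  nilEval bernPlus (adEnd (uDist f)) (compl1 ι hc (expDist f a))

open Classical in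
/-- The vector field `Res_{z=0} a_α(z) G(z) dz = ∑ n, ∂_{x_{α,n}} G_n` for `G(z) = ∑ n, G_n z ^ n`,
where `a_α(z) = ∑ n, ∂_{x_{α,n}} z ^ (-n-1)`. -/
def resVect (α : ι) (G : FunK ι) : Vect ι := vf (Pi.single α G)

/-- The element `z ^ n` of `Fun K(ū) ⊗̂ ℂ((z))`. -/
def zPow (ι : Type*) [Fintype ι] (n : ℤ) : FunK ι := FunK.const ι (tPow n)

/-- The distribution `D(a,z) = -∑ α, a_α(z) [T(a,z)]_α`: its coefficient at `z ^ (-n-1)`, which is the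
residue of `z ^ n D(a,z)`. -/
def distD (κ : InvForm g) (f : Module.Basis ι ℂ V) (hc : IsCompl V P) (a : g) (n : ℤ) : Amb κ ι :=
  Amb.mk (-∑ α, resVect α (zPow ι n * coordV f hc α (tDist f hc a))) 0 0

/-- The distribution `A(a,z) = (e^{-ad u(z)} a(z))_p`: its coefficient at `z ^ (-n-1)`. For
`h(z) = ∑ m, (h ⊗ t ^ m) z ^ (-m-1)` and `G(z) = ∑ m, G_m z ^ m` the coefficient of `G(z) h(z)` at
`z ^ (-n-1)` is `∑ m, G_m ⊗ (h ⊗ t ^ (m+n))`, the element `t ^ n G(t) ⊗ h`. -/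
def distA (κ : InvForm g) (f : Module.Basis ι ℂ V) (hc : IsCompl V P) (a : g) (n : ℤ) : Amb κ ι :=
  Amb.mk 0 0 (Aff.mk κ (funData ι) (zPow ι n • compl2 ι hc (expDist f a)) 0)

/-- The distribution `C(a,z) = -(((e^{ad u(z)} - id) / ad u(z)) ∂_z u(z), a) c`: its coefficient at
`z ^ (-n-1)`. -/
def distC (κ : InvForm g) (f : Module.Basis ι ℂ V) (a : g) (n : ℤ) : Amb κ ι :=
  Amb.mk 0 0 (Aff.mk κ (funData ι) 0 (-FunK.res ι (zPow ι n * κ.ext (FunK ι)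
    (nilEval expQuot (adEnd (uDist f)) (derExt g (FunK.der ι) (uDist f))) (1 ⊗ₜ[ℂ] a))))

/-- The distribution `-∑ α, a_α(z) [(ad u(z) / (e^{ad u(z)} - id)) a]_α`: its coefficient at
`z ^ (-n-1)`. -/
def distNil (κ : InvForm g) (f : Module.Basis ι ℂ V) (hc : IsCompl V P) (a : g) (n : ℤ) : Amb κ ι :=
  Amb.mk (-∑ α, resVect α (zPow ι n *
    coordV f hc α (nilEval bernMinus (adEnd (uDist f)) (1 ⊗ₜ[ℂ] a)))) 0 0

/-- The distribution `∑ α, a_α(z) [ad u(z) a]_α + a(z)`: its coefficient at `z ^ (-n-1)`. -/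
def distLevi (κ : InvForm g) (f : Module.Basis ι ℂ V) (hc : IsCompl V P) (a : g) (n : ℤ) :
    Amb κ ι :=
  Amb.mk (∑ α, resVect α (zPow ι n * coordV f hc α (adEnd (uDist f) (1 ⊗ₜ[ℂ] a)))) 0
    (Aff.mk κ (funData ι) (zPow ι n ⊗ₜ[ℂ] a) 0)

end Formulas

end FreeField

end

/-!
Let `u = u(x)` be the generic point of `V((t))`, where `V = ū` and `g = V ⊕ p`. In the semidirect sum
of the vector fields and of `Fun ⊗̂ ĝ`, the element `u` has a nilpotent adjoint action, so `e^{-ad u}` is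
an automorphism. It maps a vector field `D` to `D + ((1 - e^{-ad u}) / ad u) (D u)`
(`nilEval_expSeries_amb`, `expAmb_apply`) and a constant `a ∈ ĝ` to `e^{-ad u} a`.

Let `X_a` be the vector field with `X_a u = -(ad u / (1 - e^{-ad u})) (e^{-ad u} a)_V`. Since the two
power series are inverse to each other, `e^{-ad u} (X_a + a) = X_a + (e^{-ad u} a)_p`, which is the element
`π(a)` of the theorem (`expAmb_piVect`). Vector fields commute with constants, so
`⁅π(a), π(b)⁆ - π(⁅a, b⁆) = e^{-ad u} Y` with the vector field `Y = ⁅X_a, X_b⁆ - X_⁅a, b⁆`. Apart from `Y`,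
the right hand side consists of the element `((1 - e^{-ad u}) / ad u) (Y u)` of `Fun ⊗̂ V((t))`, while the
left hand side involves only `Fun ⊗̂ p_nat`. As `V ∩ p = 0`, this element is zero, hence `Y u = 0`, and
`Y = 0` because a vector field is determined by what it does to the coordinates (`piAmb_lie`). The central
terms do no harm, because the invariant form vanishes on `V`, so that `Fun ⊗̂ V((t))` is a subalgebra of
`Fun ⊗̂ ĝ` (`lie_mem_affSub`). Injectivity is clear, as `a` can be recovered from `e^{-ad u} (X_a + a)`.

The central component of `e^{-ad u} a` is computed in `cen_expAff`; together with the linearity of all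
the operators over the functions this gives the formal distributions (`piAmb_mode`), and `⁅V, V⁆ ⊆ V`,
`⁅V, l⁆ ⊆ V` and the orthogonality of `V` to `V + l` give the special cases. Locality holds because all
operators preserve the span of the `G ⊗ x` with `G` local (`piAmb_mem_Rloc`). The sum of vector fields
converges because on each lattice a function is a polynomial in finitely many coordinates
(`hasSum_vf`). The facts about `V`, `l` and `p`, and the nilpotency of `ad u`, come from the grading of
`g` in which the simple roots outside `Σ` have degree `1` and those in `Σ` degree `0`.
-/

noncomputable section

namespace FreeField

/-! ### Power series in a nilpotent endomorphism -/

section NilEval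

variable {V W : Type*} [AddCommGroup V] [Module ℂ V] [AddCommGroup W] [Module ℂ W]

theorem nilEval_eq_sum (φ : PowerSeries ℂ) {T : Module.End ℂ V} {N : ℕ} (h : T ^ N = 0) :
    nilEval φ T = ∑ k ∈ Finset.range N, PowerSeries.coeff k φ • T ^ k := by
  have hle : nilpotencyClass T ≤ N := Nat.sInf_le h
  refine Finset.sum_subset (Finset.range_mono hle) fun k _ hk => ?_
  have : T ^ k = 0 :=
    pow_eq_zero_of_le (by simpa using hk) (pow_nilpotencyClass ⟨N, h⟩)
  rw [this, smul_zero]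

theorem nilEval_apply (φ : PowerSeries ℂ) {T : Module.End ℂ V} {N : ℕ} (h : T ^ N = 0) (x : V) :
    nilEval φ T x = ∑ k ∈ Finset.range N, PowerSeries.coeff k φ • (T ^ k) x := by
  rw [nilEval_eq_sum φ h, LinearMap.sum_apply]
  rfl

theorem nilEval_coe (p : Polynomial ℂ) {T : Module.End ℂ V} (hT : IsNilpotent T) :
    nilEval (p : PowerSeries ℂ) T = Polynomial.aeval T p := by
  obtain ⟨N, hN⟩ := hT
  have h : T ^ max N (p.natDegree + 1) = 0 := pow_eq_zero_of_le (le_max_left _ _) hN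
  rw [nilEval_eq_sum _ h,
    Polynomial.aeval_eq_sum_range' (n := max N (p.natDegree + 1))
      (lt_of_lt_of_le (Nat.lt_succ_self _) (le_max_right _ _))]
  simp

theorem nilEval_trunc (φ : PowerSeries ℂ) {T : Module.End ℂ V} {N : ℕ} (h : T ^ N = 0) :
    nilEval (PowerSeries.trunc N φ : PowerSeries ℂ) T = nilEval φ T := by
  rw [nilEval_eq_sum _ h, nilEval_eq_sum _ h]
  refine Finset.sum_congr rfl fun k hk => ?_
  rw [Polynomial.coeff_coe, PowerSeries.coeff_trunc, if_pos (Finset.mem_range.1 hk)]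

theorem nilEval_mul (φ ψ : PowerSeries ℂ) {T : Module.End ℂ V} (hT : IsNilpotent T) :
    nilEval (φ * ψ) T = nilEval φ T * nilEval ψ T := by
  obtain ⟨N, hN⟩ := id hT
  rw [← nilEval_trunc (φ * ψ) hN, ← PowerSeries.trunc_trunc_mul_trunc, ← Polynomial.coe_mul,
    nilEval_trunc _ hN, nilEval_coe _ hT, map_mul, ← nilEval_coe _ hT, ← nilEval_coe _ hT,
    nilEval_trunc _ hN, nilEval_trunc _ hN]

theorem nilEval_one {T : Module.End ℂ V} (hT : IsNilpotent T) : nilEval 1 T = 1 := by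
  have := nilEval_coe 1 hT
  rwa [Polynomial.coe_one, map_one] at this

theorem nilEval_X {T : Module.End ℂ V} (hT : IsNilpotent T) : nilEval PowerSeries.X T = T := by
  have := nilEval_coe Polynomial.X hT
  rwa [Polynomial.coe_X, Polynomial.aeval_X] at this

theorem nilEval_sub (φ ψ : PowerSeries ℂ) (T : Module.End ℂ V) :
    nilEval (φ - ψ) T = nilEval φ T - nilEval ψ T := by
  simp [nilEval, sub_smul]

theorem neg_pow_eq_zero {T : Module.End ℂ V} {N : ℕ} (h : T ^ N = 0) : (-T) ^ N = 0 := by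
  rw [neg_pow, h, mul_zero]

theorem nilEval_neg (φ : PowerSeries ℂ) {T : Module.End ℂ V} (hT : IsNilpotent T) :
    nilEval φ (-T) = nilEval (PowerSeries.evalNegHom φ) T := by
  obtain ⟨N, hN⟩ := hT
  rw [nilEval_eq_sum _ hN, nilEval_eq_sum _ (neg_pow_eq_zero hN)]
  refine Finset.sum_congr rfl fun k _ => ?_
  rw [PowerSeries.evalNegHom, PowerSeries.coeff_rescale, neg_pow, mul_smul, smul_comm]
  congr 1
  rcases Nat.even_or_odd k with h | h <;> simp [h.neg_one_pow]

/-- Power series in nilpotent endomorphisms commute with intertwining maps. -/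
theorem map_nilEval (φ : PowerSeries ℂ) {T : Module.End ℂ V} {T' : Module.End ℂ W}
    (hT : IsNilpotent T) (hT' : IsNilpotent T') (S : V →ₗ[ℂ] W) (h : ∀ x, S (T x) = T' (S x))
    (x : V) : S (nilEval φ T x) = nilEval φ T' (S x) := by
  obtain ⟨N, hN⟩ := hT
  obtain ⟨M, hM⟩ := hT'
  have hk : ∀ k x, S ((T ^ k) x) = (T' ^ k) (S x) := fun k => by
    induction k with
    | zero => intro x; rfl
    | succ k ih => intro x; rw [pow_succ, pow_succ, Module.End.mul_apply, ih, h]; rfl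
  rw [nilEval_apply φ (pow_eq_zero_of_le (le_max_left N M) hN),
    nilEval_apply φ (pow_eq_zero_of_le (le_max_right N M) hM), map_sum]
  exact Finset.sum_congr rfl fun k _ => by rw [map_smul, hk]

theorem nilEval_mem (φ : PowerSeries ℂ) (T : Module.End ℂ V) {S : Submodule ℂ V}
    (h : ∀ x ∈ S, T x ∈ S) {x : V} (hx : x ∈ S) : nilEval φ T x ∈ S := by
  rw [nilEval, LinearMap.sum_apply]
  refine Submodule.sum_mem _ fun k hk => Submodule.smul_mem _ _ ?_
  clear hk
  induction k with
  | zero => exact hx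
  | succ k ih => rw [pow_succ', Module.End.mul_apply]; exact h _ ih

/-- If `φ` has constant term `1`, then `φ(T) x - x` is a combination of the `T ^ k x` with `k ≥ 1`, and
so lies in every `T`-stable subspace that contains `T x`. -/
theorem nilEval_sub_self_mem {φ : PowerSeries ℂ} (hφ : PowerSeries.coeff 0 φ = 1)
    {T : Module.End ℂ V} (hT : IsNilpotent T) {S : Submodule ℂ V} (h : ∀ x ∈ S, T x ∈ S) {x : V}
    (hx : T x ∈ S) : nilEval φ T x - x ∈ S := by
  obtain ⟨N, hN⟩ := hT
  rw [nilEval_apply φ (pow_eq_zero_of_le (Nat.le_succ N) hN), Finset.sum_range_succ', hφ, pow_zero,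
    one_smul, Module.End.one_apply, add_sub_cancel_right]
  refine Submodule.sum_mem _ fun k hk => Submodule.smul_mem _ _ ?_
  clear hk
  induction k with
  | zero => rwa [zero_add, pow_one]
  | succ k ih => rw [pow_succ', Module.End.mul_apply]; exact h _ ih

/-- Here and below `evalNegHom φ` is `φ(-X)`; in particular `evalNegHom expQuot` is
`(1 - e ^ (-X)) / X`. -/
theorem X_mul_evalNegHom_expQuot :
    PowerSeries.X * PowerSeries.evalNegHom expQuot = 1 - PowerSeries.evalNegHom expSeries := by
  have h := congrArg PowerSeries.evalNegHom X_mul_expQuot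
  rw [map_mul, map_sub, map_one, PowerSeries.evalNegHom_X] at h
  linear_combination -h

theorem expSeries_mul_evalNegHom : expSeries * PowerSeries.evalNegHom expSeries = 1 :=
  PowerSeries.exp_mul_exp_neg_eq_one

/-- `((1 - e ^ (-X)) / X) (X e ^ X / (e ^ X - 1)) = 1`. -/
theorem evalNegHom_expQuot_mul_bernPlus : PowerSeries.evalNegHom expQuot * bernPlus = 1 := by
  have hX : (PowerSeries.X : PowerSeries ℂ) ≠ 0 := PowerSeries.X_ne_zero
  refine mul_left_cancel₀ hX ?_
  linear_combination bernPlus * X_mul_evalNegHom_expQuot +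
    PowerSeries.evalNegHom expSeries * bernPlus_mul +
    (PowerSeries.X - bernPlus) * expSeries_mul_evalNegHom

/-- `(X e ^ X / (e ^ X - 1)) e ^ (-X) = X / (e ^ X - 1)`. -/
theorem bernPlus_mul_evalNegHom_expSeries :
    bernPlus * PowerSeries.evalNegHom expSeries = bernMinus := by
  have h0 : (expSeries - 1 : PowerSeries ℂ) ≠ 0 := fun h => by
    have := bernMinus_mul
    rw [h, mul_zero] at this
    exact PowerSeries.X_ne_zero this.symm
  refine mul_right_cancel₀ h0 ?_
  linear_combination PowerSeries.evalNegHom expSeries * bernPlus_mul - bernMinus_mul +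
    PowerSeries.X * expSeries_mul_evalNegHom

theorem coeff_zero_evalNegHom_expSeries :
    PowerSeries.coeff 0 (PowerSeries.evalNegHom expSeries) = 1 := by
  simp [PowerSeries.evalNegHom, PowerSeries.coeff_rescale, expSeries]

theorem coeff_expSeries (k : ℕ) : PowerSeries.coeff k expSeries = ((k.factorial : ℂ))⁻¹ := by
  simp [expSeries, PowerSeries.coeff_exp]

theorem nilEval_expSeries_apply {T : Module.End ℂ V} (hT : IsNilpotent T) (x : V) :
    nilEval expSeries T x = x + nilEval expQuot T (T x) := by
  have h : expSeries - 1 = expQuot * PowerSeries.X := by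
    rw [mul_comm, X_mul_expQuot]
  have h' := nilEval_sub expSeries 1 T
  rw [h, nilEval_mul _ _ hT, nilEval_X hT, nilEval_one hT] at h'
  have := LinearMap.congr_fun h' x
  rw [LinearMap.sub_apply, Module.End.one_apply, Module.End.mul_apply] at this
  rw [this, add_sub_cancel]

end NilEval

/-- The exponential of a nilpotent inner derivation is an automorphism. -/
theorem nilEval_expSeries_lie {L : Type*} [LieRing L] [LieAlgebra ℂ L] {x : L}
    (hx : IsNilpotent (adEnd x)) (y z : L) :
    nilEval expSeries (adEnd x) ⁅y, z⁆ =
      ⁅nilEval expSeries (adEnd x) y, nilEval expSeries (adEnd x) z⁆ := by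
  -- the library exponential of a nilpotent derivation is defined over `ℚ`
  let _ : Module ℚ L := Module.compHom L (algebraMap ℚ ℂ)
  let _ : LieAlgebra ℚ L := ⟨fun r y z => lie_smul (algebraMap ℚ ℂ r) y z⟩
  have hD : (LieDerivation.ad ℂ L x).toLinearMap = adEnd x := by
    ext y
    exact LinearMap.congr_fun (LieDerivation.coe_ad_apply_eq_ad_apply x) y
  have hn : IsNilpotent (LieDerivation.ad ℂ L x).toLinearMap := by rwa [hD]
  have key : ∀ y, nilEval expSeries (adEnd x) y = LieDerivation.exp _ hn y := fun y => by
    rw [LieDerivation.exp_map_apply, hD]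
    obtain ⟨N, hN⟩ := hx
    rw [nilEval_eq_sum _ hN, IsNilpotent.exp_eq_sum hN, LinearMap.sum_apply, LinearMap.sum_apply]
    refine Finset.sum_congr rfl fun k _ => ?_
    rw [coeff_expSeries]
    have h : ∀ (r : ℚ) (w : L), r • w = algebraMap ℚ ℂ r • w := fun _ _ => rfl
    rw [LinearMap.smul_apply, LinearMap.smul_apply, h, map_inv₀, map_natCast]
  rw [key, key, key, LieEquiv.map_lie]

theorem adEnd_apply {L : Type*} [LieRing L] [LieAlgebra ℂ L] (x y : L) : adEnd x y = ⁅x, y⁆ := rfl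

theorem adEnd_neg {L : Type*} [LieRing L] [LieAlgebra ℂ L] (x : L) : adEnd (-x) = -adEnd x :=
  map_neg (LieAlgebra.ad ℂ L) x

/-! ### Subspaces of `A ⊗ g` -/

section Tens

variable {g : Type*} [LieRing g] [LieAlgebra ℂ g] {A : Type*} [CommRing A] [Algebra ℂ A]

/-- The span of the `a ⊗ x` with `a ∈ S` and `x ∈ V`. -/
def tens (S : Submodule ℂ A) (V : Submodule ℂ g) : Submodule ℂ (A ⊗[ℂ] g) :=
  Submodule.map₂ (TensorProduct.mk ℂ A g) S V

theorem tmul_mem_tens {S : Submodule ℂ A} {V : Submodule ℂ g} {a : A} {x : g} (ha : a ∈ S)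
    (hx : x ∈ V) : a ⊗ₜ[ℂ] x ∈ tens S V :=
  Submodule.apply_mem_map₂ _ ha hx

theorem map_mem_of_mem_tens {M : Type*} [AddCommGroup M] [Module ℂ M] {S : Submodule ℂ A}
    {V : Submodule ℂ g} {Q : Submodule ℂ M} (Φ : A ⊗[ℂ] g →ₗ[ℂ] M)
    (h : ∀ a ∈ S, ∀ x ∈ V, Φ (a ⊗ₜ[ℂ] x) ∈ Q) {w : A ⊗[ℂ] g} (hw : w ∈ tens S V) : Φ w ∈ Q :=
  (Submodule.map₂_le.2 h : tens S V ≤ Q.comap Φ) hw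

theorem eqOn_tens {M : Type*} [AddCommGroup M] [Module ℂ M] {S : Submodule ℂ A}
    {V : Submodule ℂ g} (Φ Ψ : A ⊗[ℂ] g →ₗ[ℂ] M)
    (h : ∀ a ∈ S, ∀ x ∈ V, Φ (a ⊗ₜ[ℂ] x) = Ψ (a ⊗ₜ[ℂ] x)) {w : A ⊗[ℂ] g} (hw : w ∈ tens S V) :
    Φ w = Ψ w := by
  have := map_mem_of_mem_tens (Q := ⊥) (Φ - Ψ) (fun a ha x hx => by simp [h a ha x hx]) hw
  simpa [sub_eq_zero] using this

theorem tens_mono {S S' : Submodule ℂ A} {V V' : Submodule ℂ g} (hS : S ≤ S') (hV : V ≤ V') :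
    tens S V ≤ tens S' V' := Submodule.map₂_le_map₂ hS hV

theorem tens_top_top : tens (⊤ : Submodule ℂ A) (⊤ : Submodule ℂ g) = ⊤ := by
  rw [eq_top_iff, ← TensorProduct.span_tmul_eq_top, Submodule.span_le]
  rintro _ ⟨a, x, rfl⟩
  exact tmul_mem_tens trivial trivial

theorem mem_tens_top (w : A ⊗[ℂ] g) : w ∈ tens (⊤ : Submodule ℂ A) (⊤ : Submodule ℂ g) := by
  rw [tens_top_top]
  trivial

theorem lie_mem_tens {S S' S'' : Submodule ℂ A} {V V' V'' : Submodule ℂ g}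
    (hS : ∀ a ∈ S, ∀ b ∈ S', a * b ∈ S'') (hV : ∀ x ∈ V, ∀ y ∈ V', ⁅x, y⁆ ∈ V'')
    {w w' : A ⊗[ℂ] g} (hw : w ∈ tens S V) (hw' : w' ∈ tens S' V') : ⁅w, w'⁆ ∈ tens S'' V'' := by
  refine map_mem_of_mem_tens (LieAlgebra.ad ℂ (A ⊗[ℂ] g) w) (fun b hb y hy => ?_) hw'
  rw [LieAlgebra.ad_apply, ← lie_skew]
  refine neg_mem (map_mem_of_mem_tens (LieAlgebra.ad ℂ (A ⊗[ℂ] g) (b ⊗ₜ[ℂ] y))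
    (fun a ha x hx => ?_) hw)
  rw [LieAlgebra.ad_apply, ← lie_skew]
  exact neg_mem (tmul_mem_tens (hS a ha b hb) (hV x hx y hy))

theorem ext_mem_of_mem_tens (κ : InvForm g) {S S' S'' : Submodule ℂ A} {V V' : Submodule ℂ g}
    (hS : ∀ a ∈ S, ∀ b ∈ S', ∀ x ∈ V, ∀ y ∈ V', κ.form x y • (a * b) ∈ S'')
    {w w' : A ⊗[ℂ] g} (hw : w ∈ tens S V) (hw' : w' ∈ tens S' V') : κ.ext A w w' ∈ S'' := by
  refine map_mem_of_mem_tens ((κ.ext A w).restrictScalars ℂ) (fun b hb y hy => ?_) hw'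
  rw [LinearMap.restrictScalars_apply, κ.ext_symm]
  refine map_mem_of_mem_tens ((κ.ext A (b ⊗ₜ[ℂ] y)).restrictScalars ℂ) (fun a ha x hx => ?_) hw
  rw [LinearMap.restrictScalars_apply, κ.ext_symm, InvForm.ext_tmul]
  exact hS a ha b hb x hx y hy

theorem ext_eq_zero_of_mem_tens (κ : InvForm g) {V V' : Submodule ℂ g}
    (h : ∀ x ∈ V, ∀ y ∈ V', κ.form x y = 0) {w w' : A ⊗[ℂ] g} (hw : w ∈ tens ⊤ V)
    (hw' : w' ∈ tens ⊤ V') : κ.ext A w w' = 0 := by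
  have := ext_mem_of_mem_tens (S'' := ⊥) κ
    (fun a _ b _ x hx y hy => by simp [h x hx y hy]) hw hw'
  simpa using this

theorem derExt_mem_tens {S : Submodule ℂ A} {V : Submodule ℂ g} (D : Derivation ℂ A A)
    (hS : ∀ a ∈ S, D a ∈ S) {w : A ⊗[ℂ] g} (hw : w ∈ tens S V) : derExt g D w ∈ tens S V :=
  map_mem_of_mem_tens (derExt g D).toLinearMap
    (fun a ha _ hx => tmul_mem_tens (hS a ha) hx) hw

/-- The multiplication by `a ∈ A` on `A ⊗ g`, as a `ℂ`-linear map. -/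
def smulMap (a : A) : A ⊗[ℂ] g →ₗ[ℂ] A ⊗[ℂ] g := (LinearMap.lsmul A (A ⊗[ℂ] g) a).restrictScalars ℂ

theorem smulMap_apply (a : A) (w : A ⊗[ℂ] g) : smulMap a w = a • w := rfl

variable {B : Type*} [CommRing B] [Algebra ℂ B]

theorem rTensor_lie (φ : A →ₐ[ℂ] B) (w w' : A ⊗[ℂ] g) :
    LinearMap.rTensor g φ.toLinearMap ⁅w, w'⁆ =
      ⁅LinearMap.rTensor g φ.toLinearMap w, LinearMap.rTensor g φ.toLinearMap w'⁆ := by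
  induction w using TensorProduct.induction_on with
  | zero => simp
  | add x y hx hy => simp only [add_lie, map_add, hx, hy]
  | tmul a x =>
    induction w' using TensorProduct.induction_on with
    | zero => simp
    | add x y hx hy => simp only [lie_add, map_add, hx, hy]
    | tmul b y => simp

theorem ext_rTensor (κ : InvForm g) (φ : A →ₐ[ℂ] B) (w w' : A ⊗[ℂ] g) :
    κ.ext B (LinearMap.rTensor g φ.toLinearMap w) (LinearMap.rTensor g φ.toLinearMap w') =
      φ (κ.ext A w w') := by
  induction w using TensorProduct.induction_on with
  | zero => simp
  | add x y hx hy => simp only [map_add, LinearMap.add_apply, hx, hy]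
  | tmul a x =>
    induction w' using TensorProduct.induction_on with
    | zero => simp
    | add x y hx hy => simp only [map_add, hx, hy]
    | tmul b y => simp

theorem derExt_rTensor (φ : A →ₐ[ℂ] B) {D : Derivation ℂ A A} {E : Derivation ℂ B B}
    (h : ∀ a, E (φ a) = φ (D a)) (w : A ⊗[ℂ] g) :
    derExt g E (LinearMap.rTensor g φ.toLinearMap w) =
      LinearMap.rTensor g φ.toLinearMap (derExt g D w) := by
  induction w using TensorProduct.induction_on with
  | zero => simp
  | add x y hx hy => simp only [map_add, hx, hy]
  | tmul a x => simp [h]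

end Tens

theorem tens_locAlg_eq {g : Type*} [LieRing g] [LieAlgebra ℂ g] (p : LieSubalgebra ℂ g)
    (ι : Type*) [Fintype ι] :
    tens (Subalgebra.toSubmodule (locAlg ι)) p.toSubmodule = locCur p ι := by
  apply le_antisymm
  · exact Submodule.map₂_le.2 fun G hG h hh => Submodule.subset_span ⟨G, hG, h, hh, rfl⟩
  · refine Submodule.span_le.2 ?_
    rintro _ ⟨G, hG, h, hh, rfl⟩
    exact tmul_mem_tens hG hh

/-! ### The components with respect to `g = V ⊕ P` -/

section Components

variable {g : Type*} [LieRing g] [LieAlgebra ℂ g] {ι : Type*} [Fintype ι]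
variable {V P : Submodule ℂ g}

theorem compl1_tmul (hc : IsCompl V P) (G : FunK ι) (x : g) :
    compl1 ι hc (G ⊗ₜ[ℂ] x) = G ⊗ₜ[ℂ] V.projection P hc x := rfl

theorem compl2_tmul (hc : IsCompl V P) (G : FunK ι) (x : g) :
    compl2 ι hc (G ⊗ₜ[ℂ] x) = G ⊗ₜ[ℂ] P.projection V hc.symm x := rfl

theorem coordV_tmul (f : Module.Basis ι ℂ V) (hc : IsCompl V P) (α : ι) (G : FunK ι) (x : g) :
    coordV f hc α (G ⊗ₜ[ℂ] x) = f.coord α (V.projectionOnto P hc x) • G := by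
  simp [coordV]

theorem compl1_mem_tens (hc : IsCompl V P) {S : Submodule ℂ (FunK ι)} {w : FunK ι ⊗[ℂ] g}
    (hw : w ∈ tens S ⊤) : compl1 ι hc w ∈ tens S V :=
  map_mem_of_mem_tens _ (fun _ ha x _ => tmul_mem_tens ha (Submodule.projection_apply_mem hc x)) hw

theorem compl2_mem_tens (hc : IsCompl V P) {S : Submodule ℂ (FunK ι)} {w : FunK ι ⊗[ℂ] g}
    (hw : w ∈ tens S ⊤) : compl2 ι hc w ∈ tens S P :=
  map_mem_of_mem_tens _
    (fun _ ha x _ => tmul_mem_tens ha (Submodule.projection_apply_mem hc.symm x)) hw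

theorem compl1_of_mem_left (hc : IsCompl V P) {w : FunK ι ⊗[ℂ] g} (hw : w ∈ tens ⊤ V) :
    compl1 ι hc w = w :=
  eqOn_tens (compl1 ι hc) LinearMap.id (fun a _ x hx => by
    rw [compl1_tmul, Submodule.projection_apply_of_mem_left hc hx]; rfl) hw

theorem compl1_of_mem_right (hc : IsCompl V P) {w : FunK ι ⊗[ℂ] g} (hw : w ∈ tens ⊤ P) :
    compl1 ι hc w = 0 :=
  eqOn_tens (compl1 ι hc) 0 (fun a _ x hx => by
    rw [compl1_tmul, Submodule.projection_apply_of_mem_right hc hx, TensorProduct.tmul_zero]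
    rfl) hw

theorem compl1_add_compl2 (hc : IsCompl V P) (w : FunK ι ⊗[ℂ] g) :
    compl1 ι hc w + compl2 ι hc w = w :=
  eqOn_tens (compl1 ι hc + compl2 ι hc) LinearMap.id (fun a _ x _ => by
    rw [LinearMap.add_apply, compl1_tmul, compl2_tmul, ← TensorProduct.tmul_add,
      Submodule.projection_add_projection_eq_self]
    rfl) (mem_tens_top w)

theorem compl2_of_mem_left (hc : IsCompl V P) {w : FunK ι ⊗[ℂ] g} (hw : w ∈ tens ⊤ V) :
    compl2 ι hc w = 0 := by
  have := compl1_add_compl2 hc w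
  rwa [compl1_of_mem_left hc hw, add_eq_left] at this

theorem compl2_of_mem_right (hc : IsCompl V P) {w : FunK ι ⊗[ℂ] g} (hw : w ∈ tens ⊤ P) :
    compl2 ι hc w = w := by
  have := compl1_add_compl2 hc w
  rwa [compl1_of_mem_right hc hw, zero_add] at this

theorem eq_zero_of_mem_tens_of_mem_tens (hc : IsCompl V P) {w : FunK ι ⊗[ℂ] g}
    (h1 : w ∈ tens ⊤ V) (h2 : w ∈ tens ⊤ P) : w = 0 := by
  rw [← compl1_of_mem_left hc h1, compl1_of_mem_right hc h2]

theorem sum_coordV_tmul (f : Module.Basis ι ℂ V) (hc : IsCompl V P) (w : FunK ι ⊗[ℂ] g) :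
    ∑ α, coordV f hc α w ⊗ₜ[ℂ] (f α : g) = compl1 ι hc w := by
  induction w using TensorProduct.induction_on with
  | zero => simp
  | add w w' h h' => simp only [map_add, TensorProduct.add_tmul, Finset.sum_add_distrib, h, h']
  | tmul G x =>
    have h : (V.projectionOnto P hc x : g) =
        ∑ α, f.coord α (V.projectionOnto P hc x) • (f α : g) := by
      conv_lhs => rw [← f.sum_repr (V.projectionOnto P hc x)]
      rw [Submodule.coe_sum]
      rfl
    rw [compl1_tmul, ← Submodule.coe_projectionOnto_apply, h, TensorProduct.tmul_sum]
    refine Finset.sum_congr rfl fun α _ => ?_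
    rw [coordV_tmul, TensorProduct.tmul_smul, TensorProduct.smul_tmul']

theorem coordV_sum_tmul (f : Module.Basis ι ℂ V) (hc : IsCompl V P) (ξ : ι → FunK ι) (α : ι) :
    coordV f hc α (∑ β, ξ β ⊗ₜ[ℂ] (f β : g)) = ξ α := by
  classical
  rw [map_sum, Finset.sum_eq_single α]
  · rw [coordV_tmul, Submodule.projectionOnto_apply_left]
    simp
  · intro β _ h
    rw [coordV_tmul, Submodule.projectionOnto_apply_left]
    simp [h]
  · simp

theorem coordV_mem (f : Module.Basis ι ℂ V) (hc : IsCompl V P) (α : ι) {S : Submodule ℂ (FunK ι)}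
    {w : FunK ι ⊗[ℂ] g} (hw : w ∈ tens S ⊤) : coordV f hc α w ∈ S :=
  map_mem_of_mem_tens (coordV f hc α)
    (fun a ha x _ => by rw [coordV_tmul]; exact Submodule.smul_mem _ _ ha) hw

theorem compl1_smul (hc : IsCompl V P) (G : FunK ι) (w : FunK ι ⊗[ℂ] g) :
    compl1 ι hc (G • w) = G • compl1 ι hc w :=
  eqOn_tens (compl1 ι hc ∘ₗ smulMap G) (smulMap G ∘ₗ compl1 ι hc) (fun _ _ _ _ => rfl)
    (mem_tens_top w)

theorem compl2_smul (hc : IsCompl V P) (G : FunK ι) (w : FunK ι ⊗[ℂ] g) :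
    compl2 ι hc (G • w) = G • compl2 ι hc w :=
  eqOn_tens (compl2 ι hc ∘ₗ smulMap G) (smulMap G ∘ₗ compl2 ι hc) (fun _ _ _ _ => rfl)
    (mem_tens_top w)

theorem coordV_smul (f : Module.Basis ι ℂ V) (hc : IsCompl V P) (α : ι) (G : FunK ι)
    (w : FunK ι ⊗[ℂ] g) : coordV f hc α (G • w) = G * coordV f hc α w :=
  eqOn_tens (coordV f hc α ∘ₗ smulMap G) (LinearMap.mulLeft ℂ G ∘ₗ coordV f hc α)
    (fun a _ x _ => by
      rw [LinearMap.comp_apply, LinearMap.comp_apply, smulMap_apply, TensorProduct.smul_tmul',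
        coordV_tmul, coordV_tmul, smul_eq_mul, LinearMap.mulLeft_apply, mul_smul_comm])
    (mem_tens_top w)

theorem uDist_mem_tens (f : Module.Basis ι ℂ V) :
    uDist f ∈ tens (Subalgebra.toSubmodule (locAlg ι)) V :=
  Submodule.sum_mem _ fun α _ => tmul_mem_tens (aStar_mem_locAlg α) (f α).2

theorem uDist_mem_tens_top (f : Module.Basis ι ℂ V) : uDist f ∈ tens ⊤ V :=
  tens_mono le_top le_rfl (uDist_mem_tens f)

/-- The derivative of the generic point along `D` has the coordinates `D x_{α,n}`. -/
theorem derExt_lift_uDist (f : Module.Basis ι ℂ V) (D : Vect ι) :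
    derExt g (FunK.lift ι D) (uDist f) =
      ∑ α, FunK.lift ι D (FunK.aStar α) ⊗ₜ[ℂ] (f α : g) := by
  rw [uDist, map_sum]
  rfl

end Components

/-! ### The action of the generic point -/

section GenericPoint

variable {g : Type*} [LieRing g] [LieAlgebra ℂ g] {ι : Type*} [Fintype ι] {κ : InvForm g}
variable {V P : Submodule ℂ g}

/-- The projection of `Fun ⊗̂ ĝ` to `Fun ⊗̂ g((t))`, as a linear map. -/
def curMap (κ : InvForm g) (ι : Type*) [Fintype ι] : FunAff κ ι →ₗ[ℂ] FunK ι ⊗[ℂ] g where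
  toFun x := x.cur
  map_add' _ _ := rfl
  map_smul' _ _ := rfl

/-- The map `natV` as a linear map. -/
def natVMap (κ : InvForm g) (ι : Type*) [Fintype ι] (hc : IsCompl V P) :
    FunAff κ ι →ₗ[ℂ] FunAff κ ι where
  toFun x := natV hc x
  map_add' x y := by ext1 <;> simp [natV]
  map_smul' r x := by ext1 <;> simp [natV]

theorem natV_add_natP (hc : IsCompl V P) (x : FunAff κ ι) : natV hc x + natP hc x = x := by
  ext1
  · exact compl1_add_compl2 hc x.cur
  · exact zero_add _

theorem pow_adEnd_uPoint_cur (f : Module.Basis ι ℂ V) (k : ℕ) (x : FunAff κ ι) :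
    ((adEnd (uPoint κ f) ^ k) x).cur = (adEnd (uDist f) ^ k) x.cur := by
  induction k generalizing x with
  | zero => rfl
  | succ k ih => rw [pow_succ, pow_succ, Module.End.mul_apply, ih]; rfl

/-- The central terms cost one more power: `ad u(x)` kills `Fun ⊗ c`. -/
theorem isNilpotent_adEnd_uPoint (f : Module.Basis ι ℂ V) (hu : IsNilpotent (adEnd (uDist f))) :
    IsNilpotent (adEnd (uPoint κ f)) := by
  obtain ⟨N, hN⟩ := hu
  refine ⟨N + 1, LinearMap.ext fun x => ?_⟩
  have h : ((adEnd (uPoint κ f) ^ N) x).cur = 0 := by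
    rw [pow_adEnd_uPoint_cur, hN]
    rfl
  rw [pow_succ', Module.End.mul_apply, adEnd_apply]
  ext1
  · rw [Aff.cur_lie, h, lie_zero]; rfl
  · rw [Aff.cen_lie, h, map_zero, map_zero, map_zero, neg_zero]; rfl

theorem cur_nilEval (f : Module.Basis ι ℂ V) (hu : IsNilpotent (adEnd (uDist f)))
    (φ : PowerSeries ℂ) (x : FunAff κ ι) :
    (nilEval φ (adEnd (uPoint κ f)) x).cur = nilEval φ (adEnd (uDist f)) x.cur :=
  map_nilEval φ (isNilpotent_adEnd_uPoint f hu) hu (curMap κ ι) (fun _ => rfl) x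

theorem cur_expAff (f : Module.Basis ι ℂ V) (hu : IsNilpotent (adEnd (uDist f))) (a : AffLie κ) :
    (expAff f a).cur = nilEval expSeries (-adEnd (uDist f)) (FunAff.const ι a).cur := by
  rw [expAff, nilEval_neg _ (isNilpotent_adEnd_uPoint f hu), cur_nilEval f hu, nilEval_neg _ hu]

theorem nilEval_smul {T : Module.End ℂ (FunK ι ⊗[ℂ] g)}
    (hT : IsNilpotent T) (hs : ∀ (G : FunK ι) w, T (G • w) = G • T w) (φ : PowerSeries ℂ)
    (G : FunK ι) (w : FunK ι ⊗[ℂ] g) : nilEval φ T (G • w) = G • nilEval φ T w :=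
  (map_nilEval φ hT hT (smulMap G) (fun w => (hs G w).symm) w).symm

theorem adEnd_smul (v : FunK ι ⊗[ℂ] g) (G : FunK ι) (w : FunK ι ⊗[ℂ] g) :
    adEnd v (G • w) = G • adEnd v w := lie_smul G v w

/-- The subspace `Fun ⊗̂ V((t))` of `Fun ⊗̂ ĝ`, without central terms. -/
def affSub (κ : InvForm g) (ι : Type*) [Fintype ι] (V : Submodule ℂ g) :
    Submodule ℂ (FunAff κ ι) where
  carrier := {x | x.cur ∈ tens ⊤ V ∧ x.cen = 0}
  add_mem' hx hy := ⟨add_mem hx.1 hy.1, by rw [Aff.cen_add, hx.2, hy.2, add_zero]⟩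
  zero_mem' := ⟨zero_mem _, rfl⟩
  smul_mem' r _ hx := ⟨Submodule.smul_mem _ r hx.1, by rw [Aff.cen_smul, hx.2, smul_zero]⟩

/-- As the form vanishes on `V`, the bracket of `Fun ⊗̂ V((t))` has no central terms. -/
theorem lie_mem_affSub (hV : ∀ x ∈ V, ∀ y ∈ V, ⁅x, y⁆ ∈ V)
    (hκ : ∀ x ∈ V, ∀ y ∈ V, κ.form x y = 0) {x y : FunAff κ ι} (hx : x ∈ affSub κ ι V)
    (hy : y ∈ affSub κ ι V) : ⁅x, y⁆ ∈ affSub κ ι V := by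
  refine ⟨lie_mem_tens (fun _ _ _ _ => Submodule.mem_top) hV hx.1 hy.1, ?_⟩
  rw [Aff.cen_lie, ext_eq_zero_of_mem_tens κ hκ hx.1 (derExt_mem_tens _ (fun _ _ => Submodule.mem_top) hy.1),
    map_zero, neg_zero]

theorem uPoint_mem_affSub (f : Module.Basis ι ℂ V) : uPoint κ f ∈ affSub κ ι V :=
  ⟨uDist_mem_tens_top f, rfl⟩

theorem natV_mem_affSub (hc : IsCompl V P) (x : FunAff κ ι) : natV hc x ∈ affSub κ ι V :=
  ⟨compl1_mem_tens hc (mem_tens_top _), rfl⟩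

theorem nilEval_mem_affSub (hV : ∀ x ∈ V, ∀ y ∈ V, ⁅x, y⁆ ∈ V)
    (hκ : ∀ x ∈ V, ∀ y ∈ V, κ.form x y = 0) (f : Module.Basis ι ℂ V) (φ : PowerSeries ℂ)
    {x : FunAff κ ι} (hx : x ∈ affSub κ ι V) :
    nilEval φ (adEnd (uPoint κ f)) x ∈ affSub κ ι V :=
  nilEval_mem φ _ (fun _ hy => lie_mem_affSub hV hκ (uPoint_mem_affSub f) hy) hx

theorem vectAct_uPoint_mem_affSub (f : Module.Basis ι ℂ V) (D : Vect ι) :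
    vectAct D (uPoint κ f) ∈ affSub κ ι V :=
  ⟨derExt_mem_tens _ (fun _ _ => Submodule.mem_top) (uDist_mem_tens_top f), map_zero D.1⟩

theorem tAff_mem_affSub (hV : ∀ x ∈ V, ∀ y ∈ V, ⁅x, y⁆ ∈ V)
    (hκ : ∀ x ∈ V, ∀ y ∈ V, κ.form x y = 0) (f : Module.Basis ι ℂ V) (hc : IsCompl V P)
    (a : AffLie κ) : tAff f hc a ∈ affSub κ ι V :=
  nilEval_mem_affSub hV hκ f _ (natV_mem_affSub hc _)

end GenericPoint

/-! ### Constants -/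

section Const

variable {g : Type*} [LieRing g] [LieAlgebra ℂ g] {ι : Type*} [Fintype ι] {κ : InvForm g}

/-- The map `FunAff.const` as a linear map. -/
def constMap (κ : InvForm g) (ι : Type*) [Fintype ι] : AffLie κ →ₗ[ℂ] FunAff κ ι where
  toFun a := FunAff.const ι a
  map_add' a b := by ext1 <;> simp [FunAff.const]
  map_smul' r a := by ext1 <;> simp [FunAff.const, Algebra.algebraMap_eq_smul_one, mul_smul]

theorem const_lie (a b : AffLie κ) :
    FunAff.const ι ⁅a, b⁆ = ⁅FunAff.const ι a, FunAff.const ι b⁆ := by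
  ext1
  · exact rTensor_lie (FunK.const ι) _ _
  · rw [Aff.cen_lie]
    change algebraMap ℂ (Fun ι) (-lauRes (κ.ext Lau a.cur (derExt g lauD b.cur))) =
      -FunK.res ι (κ.ext (FunK ι) (LinearMap.rTensor g (FunK.const ι).toLinearMap a.cur)
        (derExt g (FunK.der ι) (LinearMap.rTensor g (FunK.const ι).toLinearMap b.cur)))
    rw [derExt_rTensor (FunK.const ι) (D := lauD) (fun _ => rfl)]
    refine Eq.trans ?_ (congrArg (fun G => -FunK.res ι G)
      (ext_rTensor κ (FunK.const ι) a.cur (derExt g lauD b.cur)).symm)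
    rw [map_neg]
    rfl

theorem vectAct_const (D : Vect ι) (a : AffLie κ) : vectAct D (FunAff.const ι a) = 0 := by
  ext1
  · change derExt g (FunK.lift ι D) (LinearMap.rTensor g (FunK.const ι).toLinearMap a.cur) = 0
    induction a.cur using TensorProduct.induction_on with
    | zero => simp
    | add x y hx hy => simp only [map_add, hx, hy, add_zero]
    | tmul G x =>
      rw [LinearMap.rTensor_tmul, derExt_tmul]
      exact (congrArg (· ⊗ₜ[ℂ] x) (lift_const D G)).trans (TensorProduct.zero_tmul _ _)
  · exact D.1.map_algebraMap _

/-- Evaluation of the functions at the point `0` is a left inverse of the inclusion of the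
constants. -/
theorem const_injective : Function.Injective (FunAff.const (κ := κ) ι) := by
  intro a b h
  have hval : ∃ e : FunK ι →ₗ[ℂ] Lau, ∀ G, e (FunK.const ι G) = G :=
    ⟨{ toFun := fun G => G 0, map_add' := fun _ _ => rfl, map_smul' := fun _ _ => rfl },
      fun _ => rfl⟩
  obtain ⟨e, he⟩ := hval
  have key : ∀ w : Lau ⊗[ℂ] g,
      LinearMap.rTensor g e (LinearMap.rTensor g (FunK.const ι).toLinearMap w) = w := fun w => by
    rw [← LinearMap.comp_apply, ← LinearMap.rTensor_comp]
    have : e ∘ₗ (FunK.const ι).toLinearMap = LinearMap.id := LinearMap.ext he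
    rw [this, LinearMap.rTensor_id]
    rfl
  ext1
  · rw [← key a.cur, ← key b.cur]
    exact congrArg (fun x : FunAff κ ι => LinearMap.rTensor g e x.cur) h
  · exact congrArg (fun x : FunAff κ ι => x.cen 0) h

end Const

/-! ### Exponentials in the ambient Lie algebra -/

section AmbExp

variable {g : Type*} [LieRing g] [LieAlgebra ℂ g] {ι : Type*} [Fintype ι] {κ : InvForm g}

theorem vectAct_zero_left (y : FunAff κ ι) : vectAct (0 : Vect ι) y = 0 := by
  have := smul_vectAct (0 : ℂ) (0 : Vect ι) y
  rwa [zero_smul, zero_smul] at this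

theorem adEnd_amb (y : FunAff κ ι) (X : Amb κ ι) :
    adEnd (Amb.mk 0 0 y) X = Amb.mk 0 0 (⁅y, X.aff⁆ - vectAct X.vec y) := by
  rw [adEnd_apply]
  ext1
  · simp
  · simp
  · rw [Amb.aff_lie, Amb.aff_mk, Amb.vec_mk, Amb.aff_mk, vectAct_zero_left]
    abel

/-- The inclusion of `Fun ⊗̂ ĝ` into the ambient Lie algebra. -/
def ambMap (κ : InvForm g) (ι : Type*) [Fintype ι] : FunAff κ ι →ₗ[ℂ] Amb κ ι where
  toFun y := Amb.mk 0 0 y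
  map_add' x y := by ext1 <;> simp
  map_smul' r x := by ext1 <;> simp

theorem adEnd_ambMap (y x : FunAff κ ι) :
    ambMap κ ι (adEnd y x) = adEnd (Amb.mk 0 0 y) (ambMap κ ι x) := by
  rw [adEnd_amb]
  change Amb.mk 0 0 ⁅y, x⁆ = Amb.mk 0 0 (⁅y, x⁆ - vectAct 0 y)
  rw [vectAct_zero_left, sub_zero]

theorem isNilpotent_adEnd_amb {y : FunAff κ ι} (hy : IsNilpotent (adEnd y)) :
    IsNilpotent (adEnd (Amb.mk 0 0 y)) := by
  obtain ⟨N, hN⟩ := hy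
  have hk : ∀ k x, (adEnd (Amb.mk 0 0 y) ^ k) (ambMap κ ι x) = ambMap κ ι ((adEnd y ^ k) x) :=
    fun k => by
    induction k with
    | zero => intro x; rfl
    | succ k ih =>
      intro x
      rw [pow_succ, Module.End.mul_apply, ← adEnd_ambMap, ih, pow_succ, Module.End.mul_apply]
  refine ⟨N + 1, LinearMap.ext fun X => ?_⟩
  rw [pow_succ, Module.End.mul_apply, adEnd_amb]
  refine (hk N _).trans ?_
  rw [hN, LinearMap.zero_apply, map_zero]
  rfl

/-- The exponential of `ad y` for `y ∈ Fun ⊗̂ ĝ`: it moves a vector field `D` to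
`D - ((e ^ {ad y} - 1) / ad y) (D y)`. -/
theorem nilEval_expSeries_amb {y : FunAff κ ι} (hy : IsNilpotent (adEnd y)) (X : Amb κ ι) :
    nilEval expSeries (adEnd (Amb.mk 0 0 y)) X =
      Amb.mk X.vec X.fn (nilEval expSeries (adEnd y) X.aff -
        nilEval expQuot (adEnd y) (vectAct X.vec y)) := by
  have hA := isNilpotent_adEnd_amb hy
  have hA' := map_nilEval expQuot hy hA (ambMap κ ι) (adEnd_ambMap y)
    (⁅y, X.aff⁆ - vectAct X.vec y)
  rw [nilEval_expSeries_apply hA, nilEval_expSeries_apply hy, adEnd_amb]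
  refine (congrArg (X + ·) hA'.symm).trans ?_
  rw [map_sub (nilEval expQuot (adEnd y))]
  ext1
  · exact add_zero _
  · exact add_zero _
  · exact (add_sub_assoc _ _ _).symm

end AmbExp

/-! ### The homomorphism -/

section Hom

variable {g : Type*} [LieRing g] [LieAlgebra ℂ g] {ι : Type*} [Fintype ι] {κ : InvForm g}
variable {V P : Submodule ℂ g}

/-- A vector field that does not move the generic point is zero. -/
theorem eq_zero_of_vectAct_uPoint (f : Module.Basis ι ℂ V) (hc : IsCompl V P) {D : Vect ι}
    (h : vectAct D (uPoint κ f) = 0) : D = 0 := by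
  have h1 : ∀ α, FunK.lift ι D (FunK.aStar α) = 0 := fun α => by
    rw [← coordV_sum_tmul f hc (fun α => FunK.lift ι D (FunK.aStar α)) α, ← derExt_lift_uDist]
    exact (congrArg (fun x : FunAff κ ι => coordV f hc α x.cur) h).trans (map_zero _)
  exact Vect.ext_coord fun α n => congrArg (FunK.coeff n) (h1 α)

/-- The vector field `-∑ α, ∑ n, ∂_{x_{α,n}} [tAff a]_{α,n}`. -/
def piVect (f : Module.Basis ι ℂ V) (hc : IsCompl V P) (a : AffLie κ) : Vect ι :=
  vf fun α => -coordV f hc α (tAff f hc a).cur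

theorem vectAct_piVect (hV : ∀ x ∈ V, ∀ y ∈ V, ⁅x, y⁆ ∈ V)
    (hκ : ∀ x ∈ V, ∀ y ∈ V, κ.form x y = 0) (f : Module.Basis ι ℂ V) (hc : IsCompl V P)
    (a : AffLie κ) : vectAct (piVect f hc a) (uPoint κ f) = -tAff f hc a := by
  have hT := tAff_mem_affSub hV hκ f hc a
  ext1
  · refine (derExt_lift_uDist f (piVect f hc a)).trans ?_
    simp only [piVect, lift_vf_aStar, TensorProduct.neg_tmul, Finset.sum_neg_distrib]
    rw [sum_coordV_tmul f hc, compl1_of_mem_left hc hT.1]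
    rfl
  · rw [(vectAct_uPoint_mem_affSub f _).2, Aff.cen_neg, hT.2, neg_zero]

/-- The element `π(a)` of the ambient Lie algebra. -/
def piAmb (f : Module.Basis ι ℂ V) (hc : IsCompl V P) (a : AffLie κ) : Amb κ ι :=
  Amb.mk (piVect f hc a) 0 (natP hc (expAff f a))

/-- The automorphism `e^{-ad u(x)}` of the ambient Lie algebra. -/
def expAmb (κ : InvForm g) (f : Module.Basis ι ℂ V) : Module.End ℂ (Amb κ ι) :=
  nilEval expSeries (adEnd (Amb.mk 0 0 (-uPoint κ f)))

theorem isNilpotent_adEnd_neg_uPoint (f : Module.Basis ι ℂ V)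
    (hu : IsNilpotent (adEnd (uDist f))) : IsNilpotent (adEnd (-uPoint κ f)) := by
  rw [adEnd_neg]
  exact (isNilpotent_adEnd_uPoint f hu).neg

theorem expAmb_apply (f : Module.Basis ι ℂ V) (hu : IsNilpotent (adEnd (uDist f)))
    (D : Vect ι) (x : FunAff κ ι) :
    expAmb κ f (Amb.mk D 0 x) = Amb.mk D 0 (nilEval expSeries (-adEnd (uPoint κ f)) x +
      nilEval (PowerSeries.evalNegHom expQuot) (adEnd (uPoint κ f)) (vectAct D (uPoint κ f))) := by
  have h : vectAct D (-uPoint κ f) = -vectAct D (uPoint κ f) := by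
    have := vectAct_smul (-1 : ℂ) D (uPoint κ f)
    rwa [neg_one_smul, neg_one_smul] at this
  rw [expAmb, nilEval_expSeries_amb (isNilpotent_adEnd_neg_uPoint f hu), adEnd_neg, Amb.vec_mk,
    Amb.fn_mk, Amb.aff_mk, h, map_neg, sub_neg_eq_add,
    nilEval_neg expQuot (isNilpotent_adEnd_uPoint f hu)]

theorem expAmb_lie (f : Module.Basis ι ℂ V) (hu : IsNilpotent (adEnd (uDist f))) (X Y : Amb κ ι) :
    expAmb κ f ⁅X, Y⁆ = ⁅expAmb κ f X, expAmb κ f Y⁆ :=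
  nilEval_expSeries_lie (isNilpotent_adEnd_amb (isNilpotent_adEnd_neg_uPoint f hu)) X Y

/-- The element `π(a)` is the image under `e^{-ad u(x)}` of the sum of a vector field and of the
constant `a`: the vector field is chosen such that the component in `Fun ⊗̂ V((t))` of
`e^{-ad u(x)} a` is cancelled. -/
theorem expAmb_piVect (hV : ∀ x ∈ V, ∀ y ∈ V, ⁅x, y⁆ ∈ V)
    (hκ : ∀ x ∈ V, ∀ y ∈ V, κ.form x y = 0) (f : Module.Basis ι ℂ V)
    (hu : IsNilpotent (adEnd (uDist f))) (hc : IsCompl V P) (a : AffLie κ) :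
    expAmb κ f (Amb.mk (piVect f hc a) 0 (FunAff.const ι a)) = piAmb f hc a := by
  have hU := isNilpotent_adEnd_uPoint (κ := κ) f hu
  have h : nilEval (PowerSeries.evalNegHom expQuot) (adEnd (uPoint κ f)) (tAff f hc a) =
      natV hc (expAff f a) := by
    rw [tAff, ← Module.End.mul_apply, ← nilEval_mul _ _ hU, evalNegHom_expQuot_mul_bernPlus,
      nilEval_one hU, Module.End.one_apply]
  rw [expAmb_apply f hu, vectAct_piVect hV hκ, map_neg, h, piAmb]
  congr 1
  exact (sub_eq_add_neg _ _).symm.trans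
    (sub_eq_of_eq_add' (natV_add_natP hc (expAff f a)).symm)

theorem vectAct_cur_mem_tens (D : Vect ι) {x : FunAff κ ι} (hx : x.cur ∈ tens ⊤ P) :
    (vectAct D x).cur ∈ tens ⊤ P :=
  derExt_mem_tens _ (fun _ _ => Submodule.mem_top) hx

theorem natP_cur_mem_tens (hc : IsCompl V P) (x : FunAff κ ι) : (natP hc x).cur ∈ tens ⊤ P :=
  compl2_mem_tens hc (mem_tens_top _)

/-- The difference of `⁅π(a), π(b)⁆` and `π(⁅a, b⁆)` is `e^{-ad u(x)} Y` for a vector field `Y`. On the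
one hand its components in `Fun ⊗̂ ĝ` are those of elements of `P`, on the other hand they lie in
`Fun ⊗̂ V((t))`. Hence they vanish, `Y` does not move the generic point, and `Y = 0`. -/
theorem piAmb_lie (hV : ∀ x ∈ V, ∀ y ∈ V, ⁅x, y⁆ ∈ V) (hP : ∀ x ∈ P, ∀ y ∈ P, ⁅x, y⁆ ∈ P)
    (hκ : ∀ x ∈ V, ∀ y ∈ V, κ.form x y = 0) (f : Module.Basis ι ℂ V)
    (hu : IsNilpotent (adEnd (uDist f))) (hc : IsCompl V P) (a b : AffLie κ) :
    piAmb f hc ⁅a, b⁆ = ⁅piAmb f hc a, piAmb f hc b⁆ := by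
  have hU := isNilpotent_adEnd_uPoint (κ := κ) f hu
  set Y : Vect ι := ⁅piVect f hc a, piVect f hc b⁆ - piVect f hc ⁅a, b⁆ with hY
  set w := nilEval (PowerSeries.evalNegHom expQuot) (adEnd (uPoint κ f))
    (vectAct Y (uPoint κ f)) with hw
  have h1 : ⁅piAmb f hc a, piAmb f hc b⁆ - piAmb f hc ⁅a, b⁆ = Amb.mk Y 0 w := by
    have e : ⁅Amb.mk (piVect f hc a) 0 (FunAff.const ι a),
        Amb.mk (piVect f hc b) 0 (FunAff.const ι b)⁆ -
        Amb.mk (piVect f hc ⁅a, b⁆) 0 (FunAff.const ι ⁅a, b⁆) = Amb.mk (κ := κ) Y 0 0 := by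
      refine Amb.ext rfl ?_ ?_
      · change (piVect f hc a).1 0 - (piVect f hc b).1 0 - 0 = 0
        simp
      · change vectAct _ (FunAff.const ι b) - vectAct _ (FunAff.const ι a) +
          ⁅FunAff.const ι a, FunAff.const ι b⁆ - FunAff.const ι ⁅a, b⁆ = 0
        rw [vectAct_const, vectAct_const, const_lie]
        simp
    rw [← expAmb_piVect hV hκ f hu hc a, ← expAmb_piVect hV hκ f hu hc b,
      ← expAmb_piVect hV hκ f hu hc ⁅a, b⁆, ← expAmb_lie f hu, ← map_sub, e, expAmb_apply f hu,
      map_zero, zero_add]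
  have hwV : w ∈ affSub κ ι V :=
    nilEval_mem_affSub hV hκ f _ (vectAct_uPoint_mem_affSub f Y)
  have hwP : w.cur ∈ tens ⊤ P := by
    have e : w.cur = (⁅piAmb f hc a, piAmb f hc b⁆ - piAmb f hc ⁅a, b⁆).aff.cur := by
      rw [h1]
      rfl
    rw [e]
    refine sub_mem (add_mem (sub_mem ?_ ?_) ?_) (natP_cur_mem_tens hc _)
    · exact vectAct_cur_mem_tens _ (natP_cur_mem_tens hc _)
    · exact vectAct_cur_mem_tens _ (natP_cur_mem_tens hc _)
    · exact lie_mem_tens (fun _ _ _ _ => Submodule.mem_top) hP (natP_cur_mem_tens hc _)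
        (natP_cur_mem_tens hc _)
  have hw0 : w = 0 := Aff.ext (eq_zero_of_mem_tens_of_mem_tens hc hwV.1 hwP) hwV.2
  have hY0 : Y = 0 := by
    refine eq_zero_of_vectAct_uPoint (κ := κ) f hc ?_
    have e : nilEval bernPlus (adEnd (uPoint κ f)) w = vectAct Y (uPoint κ f) := by
      rw [hw, ← Module.End.mul_apply, ← nilEval_mul _ _ hU, mul_comm,
        evalNegHom_expQuot_mul_bernPlus, nilEval_one hU, Module.End.one_apply]
    rw [← e, hw0, map_zero]
  rw [hY0, hw0] at h1
  exact (sub_eq_zero.1 h1).symm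

/-- The map `a ↦ π(a)` is linear. -/
def piLin (κ : InvForm g) (f : Module.Basis ι ℂ V) (hc : IsCompl V P) :
    AffLie κ →ₗ[ℂ] Amb κ ι where
  toFun a := piAmb f hc a
  map_add' a b := by
    have hE : expAff f (a + b) = expAff f a + expAff f b :=
      (congrArg _ (map_add (constMap κ ι) a b)).trans (map_add _ _ _)
    have hT : tAff f hc (a + b) = tAff f hc a + tAff f hc b := by
      rw [tAff, hE]
      exact (congrArg _ (map_add (natVMap κ ι hc) _ _)).trans (map_add _ _ _)
    refine Amb.ext ?_ (add_zero 0).symm ?_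
    · change piVect f hc (a + b) = piVect f hc a + piVect f hc b
      rw [piVect, hT, piVect, piVect, vf_add]
      congr 1
      ext1 α
      rw [Aff.cur_add, map_add, neg_add]
      rfl
    · change natP hc (expAff f (a + b)) = natP hc (expAff f a) + natP hc (expAff f b)
      rw [hE]
      ext1 <;> simp [natP]
  map_smul' r a := by
    have hE : expAff f (r • a) = r • expAff f a :=
      (congrArg _ (map_smul (constMap κ ι) r a)).trans (map_smul _ _ _)
    have hT : tAff f hc (r • a) = r • tAff f hc a := by
      rw [tAff, hE]
      exact (congrArg _ (map_smul (natVMap κ ι hc) r _)).trans (map_smul _ _ _)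
    refine Amb.ext ?_ (smul_zero r).symm ?_
    · change piVect f hc (r • a) = r • piVect f hc a
      rw [piVect, hT, piVect, vf_smul]
      congr 1
      ext1 α
      rw [Aff.cur_smul, map_smul, ← smul_neg]
      rfl
    · change natP hc (expAff f (r • a)) = r • natP hc (expAff f a)
      rw [hE]
      ext1 <;> simp [natP]

theorem piAmb_injective (hV : ∀ x ∈ V, ∀ y ∈ V, ⁅x, y⁆ ∈ V)
    (hκ : ∀ x ∈ V, ∀ y ∈ V, κ.form x y = 0) (f : Module.Basis ι ℂ V)
    (hu : IsNilpotent (adEnd (uDist f))) (hc : IsCompl V P) :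
    Function.Injective (piAmb (κ := κ) f hc) := by
  refine (injective_iff_map_eq_zero (piLin κ f hc)).2 fun a (ha : piAmb f hc a = 0) => ?_
  have hA := isNilpotent_adEnd_amb (isNilpotent_adEnd_neg_uPoint (κ := κ) f hu)
  have hinj : Function.Injective (expAmb κ f) := fun X Y h => by
    have h' : ∀ X, nilEval (PowerSeries.evalNegHom expSeries)
        (adEnd (Amb.mk 0 0 (-uPoint κ f))) (expAmb κ f X) = X := fun X => by
      rw [expAmb, ← Module.End.mul_apply, ← nilEval_mul _ _ hA, mul_comm,
        expSeries_mul_evalNegHom, nilEval_one hA, Module.End.one_apply]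
    rw [← h' X, h, h' Y]
  rw [← expAmb_piVect hV hκ f hu hc a, ← map_zero (expAmb κ f)] at ha
  have h0 : FunAff.const ι a = FunAff.const ι (0 : AffLie κ) :=
    (congrArg Amb.aff (hinj ha)).trans (map_zero (constMap κ ι)).symm
  exact const_injective h0

end Hom

/-! ### Vector fields as convergent sums -/

section Sums

variable {ι : Type*} [Fintype ι]

open Classical in
theorem partialX_coordFun (α β : ι) (m n : ℤ) :
    (partialX α m).1 (coordFun β n) = if α = β ∧ m = n then 1 else 0 := by
  rw [partialX, vf_coordFun]
  ext u
  by_cases h : α = β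
  · subst h
    simp only [Pi.single_eq_same, true_and, FunK.coeff_apply, FunK.const_apply, tPow]
    by_cases hm : m = n
    · subst hm; simp
    · rw [HahnSeries.coeff_single_of_ne (Ne.symm hm), if_neg hm]; simp
  · rw [Pi.single_eq_of_ne (Ne.symm h), if_neg (fun h' => h h'.1), map_zero]

/-- On a polynomial in finitely many coordinate functions a vector field is the sum of finitely many
of its terms. -/
theorem exists_sum_partialX (ξ : ι → FunK ι) {q : Fun ι}
    (hq : q ∈ Algebra.adjoin ℂ (Set.range fun i : ι × ℤ => coordFun i.1 i.2)) :
    ∃ t : Finset (ι × ℤ), ∀ s : Finset (ι × ℤ), t ⊆ s →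
      ∑ i ∈ s, FunK.coeff i.2 (ξ i.1) * (partialX i.1 i.2).1 q = (vf ξ).1 q := by
  classical
  induction hq using Algebra.adjoin_induction with
  | mem p h =>
    obtain ⟨j, rfl⟩ := h
    refine ⟨{j}, fun s hs => ?_⟩
    rw [Finset.sum_eq_single_of_mem j (hs (Finset.mem_singleton_self j)), vf_coordFun,
      partialX_coordFun, if_pos ⟨rfl, rfl⟩, mul_one]
    intro i _ hij
    rw [partialX_coordFun, if_neg fun h => hij (Prod.ext h.1 h.2), mul_zero]
  | algebraMap r => exact ⟨∅, fun s _ => by simp⟩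
  | add p q _ _ h1 h2 =>
    obtain ⟨t1, h1⟩ := h1
    obtain ⟨t2, h2⟩ := h2
    refine ⟨t1 ∪ t2, fun s hs => ?_⟩
    rw [map_add, ← h1 s (Finset.union_subset_left hs), ← h2 s (Finset.union_subset_right hs),
      ← Finset.sum_add_distrib]
    exact Finset.sum_congr rfl fun i _ => by rw [map_add, mul_add]
  | mul p q _ _ h1 h2 =>
    obtain ⟨t1, h1⟩ := h1
    obtain ⟨t2, h2⟩ := h2
    refine ⟨t1 ∪ t2, fun s hs => ?_⟩
    rw [Derivation.leibniz, ← h1 s (Finset.union_subset_left hs),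
      ← h2 s (Finset.union_subset_right hs), Finset.smul_sum, Finset.smul_sum,
      ← Finset.sum_add_distrib]
    refine Finset.sum_congr rfl fun i _ => ?_
    rw [Derivation.leibniz]
    simp only [smul_eq_mul]
    ring

/-- Functions that agree on the lattice `t ^ k ū[[t]]` have the same derivatives there along
vector fields with values in this lattice. -/
theorem vf_apply_congr {F G : Fun ι} {k : ℤ} (h : ∀ u ∈ lattice ι k, F u = G u) (ξ : ι → FunK ι)
    {u : ι → Lau} (hu : u ∈ lattice ι k) (hξ : (fun α => ξ α u) ∈ lattice ι k) :
    (vf ξ).1 F u = (vf ξ).1 G u := dirDeriv_congr h hu hξ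

theorem hasSum_vf (ξ : ι → FunK ι) (F : Fun ι) :
    HasSum (fun i : ι × ℤ => FunK.coeff i.2 (ξ i.1) * (partialX i.1 i.2).1 F) ((vf ξ).1 F) := by
  classical
  rw [HasSum, SummationFilter.unconditional_filter]
  refine ((Fun.hasBasis_nhds _).tendsto_right_iff).2 fun n _ => ?_
  obtain ⟨k, hkn, hk⟩ := exists_lattice_map ξ n
  -- on the lattice `t ^ k ū[[t]]` the function is a polynomial in finitely many coordinates
  obtain ⟨q, hq, hFq⟩ := F.exists_coord k
  obtain ⟨t, ht⟩ := exists_sum_partialX ξ hq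
  refine Filter.eventually_atTop.2 ⟨t, fun s hs u hu => ?_⟩
  have huk := lattice_anti hkn hu
  rw [vf_apply_congr hFq ξ huk (hk u hu), ← ht s hs, Fun.sum_apply, Fun.sum_apply]
  refine Finset.sum_congr rfl fun i _ => ?_
  rw [Fun.mul_apply, Fun.mul_apply]
  rcases lt_or_ge i.2 k with h | h
  -- the terms below `t ^ k` have vanishing coefficients, the other `∂_{x_{α,n}}` preserve the lattice
  · have : FunK.coeff i.2 (ξ i.1) u = 0 := hk u hu i.1 i.2 h
    rw [this, zero_mul, zero_mul]
  · congr 1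
    refine vf_apply_congr hFq _ huk fun α m hm => ?_
    beta_reduce
    by_cases hα : α = i.1
    · subst hα
      rw [Pi.single_eq_same, FunK.const_apply, tPow, HahnSeries.coeff_single_of_ne (by omega)]
    · rw [Pi.single_eq_of_ne hα, FunK.zero_apply, HahnSeries.coeff_zero]

theorem sum_resVect (G : ι → FunK ι) : ∑ α, resVect α (G α) = vf G := by
  classical
  refine Vect.ext_coord fun β n => ?_
  have h : (∑ α, resVect α (G α)).1 (coordFun β n) =
      ∑ α, (resVect α (G α)).1 (coordFun β n) :=
    map_sum (⟨⟨fun D : Vect ι => D.1 (coordFun β n), rfl⟩, fun _ _ => rfl⟩ : Vect ι →+ Fun ι) _ _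
  rw [vf_coordFun, h, Finset.sum_eq_single β]
  · rw [resVect, vf_coordFun, Pi.single_eq_same]
  · intro α _ h
    rw [resVect, vf_coordFun, Pi.single_eq_of_ne (Ne.symm h), map_zero]
  · simp

theorem neg_vf (G : ι → FunK ι) : -vf G = vf fun α => -G α := by
  rw [← neg_one_smul ℂ (vf G), vf_smul, neg_one_smul]
  rfl

end Sums

/-! ### The central component -/

section Central

variable {g : Type*} [LieRing g] [LieAlgebra ℂ g] {ι : Type*} [Fintype ι] {κ : InvForm g}
variable {V P : Submodule ℂ g}

/-- By invariance of the form, `ad (-u)` is adjoint to `ad u`. -/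
theorem ext_pow_adEnd (u z w : FunK ι ⊗[ℂ] g) (k : ℕ) :
    κ.ext (FunK ι) z ((adEnd (-u) ^ k) w) = κ.ext (FunK ι) ((adEnd u ^ k) z) w := by
  induction k generalizing z with
  | zero => rfl
  | succ k ih =>
    rw [pow_succ', pow_succ, Module.End.mul_apply, Module.End.mul_apply, adEnd_apply (-u),
      ← InvForm.ext_inv, ih, adEnd_apply, lie_neg, lie_skew]

/-- The central component of `e^{-ad u(x)} a`. The `k`-th power of `-ad u(x)` contributes
`-Res (∂_t u, (-ad u) ^ (k - 1) a) = -Res ((ad u) ^ (k - 1) ∂_t u, a)` to it. -/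
theorem cen_expAff (f : Module.Basis ι ℂ V) (hu : IsNilpotent (adEnd (uDist f))) (a : AffLie κ) :
    (expAff f a).cen = algebraMap ℂ (Fun ι) a.cen -
      FunK.res ι (κ.ext (FunK ι) (nilEval expQuot (adEnd (uDist f))
        (derExt g (FunK.der ι) (uDist f))) (FunAff.const ι a).cur) := by
  obtain ⟨N, hN⟩ := id hu
  obtain ⟨M, hM⟩ := isNilpotent_adEnd_neg_uPoint (κ := κ) f hu
  have hcen : ∀ k, ((adEnd (-uPoint κ f) ^ k)
      (adEnd (-uPoint κ f) (FunAff.const ι a))).cen =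
      -FunK.res ι (κ.ext (FunK ι) ((adEnd (uDist f) ^ k) (derExt g (FunK.der ι) (uDist f)))
        (FunAff.const ι a).cur) := fun k => by
    have hcur : ((adEnd (-uPoint κ f) ^ k) (FunAff.const ι a)).cur =
        (adEnd (-uDist f) ^ k) (FunAff.const ι a).cur := by
      induction k with
      | zero => rfl
      | succ k ih => rw [pow_succ', pow_succ', Module.End.mul_apply, Module.End.mul_apply, ← ih]; rfl
    rw [← Module.End.mul_apply, ← pow_succ, pow_succ', Module.End.mul_apply, adEnd_apply,
      Aff.cen_lie, hcur, Aff.res_swap, neg_neg]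
    change FunK.res ι (κ.ext (FunK ι) (derExt g (FunK.der ι) (-uDist f)) _) = _
    rw [map_neg, map_neg, LinearMap.neg_apply, ext_pow_adEnd, map_neg]
  have hcenMap : ∀ (s : Finset ℕ) (F : ℕ → FunAff κ ι),
      (∑ k ∈ s, F k).cen = ∑ k ∈ s, (F k).cen := fun s F =>
    map_sum (⟨⟨fun x : FunAff κ ι => x.cen, rfl⟩, fun _ _ => rfl⟩ : FunAff κ ι →+ Fun ι) F s
  rw [expAff, ← adEnd_neg, nilEval_expSeries_apply ⟨M, hM⟩, Aff.cen_add, sub_eq_add_neg]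
  refine congrArg₂ (· + ·) rfl ?_
  rw [nilEval_apply _ (pow_eq_zero_of_le (le_max_right N M) hM), hcenMap,
    nilEval_apply _ (pow_eq_zero_of_le (le_max_left N M) hN), map_sum, LinearMap.sum_apply,
    map_sum, ← Finset.sum_neg_distrib]
  refine Finset.sum_congr rfl fun k _ => ?_
  rw [Aff.cen_smul, hcen, LinearMap.map_smul_of_tower, LinearMap.smul_apply, map_smul, smul_neg]

end Central

/-! ### Locality -/

section Locality

variable {g : Type*} [LieRing g] [LieAlgebra ℂ g] {ι : Type*} [Fintype ι] {κ : InvForm g}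
variable {V P : Submodule ℂ g}

theorem const_cur_mem_tens (a : AffLie κ) :
    (FunAff.const ι a).cur ∈ tens (Subalgebra.toSubmodule (locAlg ι)) ⊤ := by
  change LinearMap.rTensor g (FunK.const ι).toLinearMap a.cur ∈ _
  induction a.cur using TensorProduct.induction_on with
  | zero => rw [map_zero]; exact zero_mem _
  | add x y hx hy => rw [map_add]; exact add_mem hx hy
  | tmul G x => exact tmul_mem_tens (const_mem_locAlg G) Submodule.mem_top

theorem nilEval_adEnd_uDist_mem_tens (f : Module.Basis ι ℂ V) (φ : PowerSeries ℂ)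
    {w : FunK ι ⊗[ℂ] g} (hw : w ∈ tens (Subalgebra.toSubmodule (locAlg ι)) ⊤) :
    nilEval φ (adEnd (uDist f)) w ∈ tens (Subalgebra.toSubmodule (locAlg ι)) ⊤ :=
  nilEval_mem φ _ (fun _ hy => lie_mem_tens (fun _ ha _ hb => (locAlg ι).mul_mem ha hb)
    (fun _ _ _ _ => Submodule.mem_top) (uDist_mem_tens f) hy) hw

/-- The element `e^{-ad u} a` is local, as `a` and `u` are. -/
theorem expAff_cur_mem_tens (f : Module.Basis ι ℂ V) (hu : IsNilpotent (adEnd (uDist f)))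
    (a : AffLie κ) : (expAff f a).cur ∈ tens (Subalgebra.toSubmodule (locAlg ι)) ⊤ := by
  rw [cur_expAff f hu, nilEval_neg _ hu]
  exact nilEval_adEnd_uDist_mem_tens f _ (const_cur_mem_tens a)

theorem algebraMap_mem_locFun (r : ℂ) : algebraMap ℂ (Fun ι) r ∈ locFun ι := by
  refine ⟨FunK.const ι (r • tPow (-1)), const_mem_locAlg _, ?_⟩
  ext u
  change (r • tPow (-1)).coeff (-1) = r
  simp [tPow]

theorem cen_expAff_mem_locFun (f : Module.Basis ι ℂ V) (hu : IsNilpotent (adEnd (uDist f)))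
    (a : AffLie κ) : (expAff f a).cen ∈ locFun ι := by
  rw [cen_expAff f hu]
  refine sub_mem (algebraMap_mem_locFun _) (Submodule.mem_map_of_mem ?_)
  refine ext_mem_of_mem_tens κ (fun G hG G' hG' x _ y _ =>
    Submodule.smul_mem (Subalgebra.toSubmodule (locAlg ι)) (κ.form x y)
      ((locAlg ι).mul_mem hG hG')) (nilEval_adEnd_uDist_mem_tens f _ ?_) (const_cur_mem_tens a)
  exact derExt_mem_tens _ (fun _ => der_mem_locAlg) (tens_mono le_rfl le_top (uDist_mem_tens f))

theorem piAmb_mem_Rloc {p : LieSubalgebra ℂ g} (f : Module.Basis ι ℂ V)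
    (hu : IsNilpotent (adEnd (uDist f))) (hc : IsCompl V p.toSubmodule) (a : AffLie κ) :
    piAmb f hc a ∈ Rloc κ p ι := by
  have hE := expAff_cur_mem_tens f hu a
  refine ⟨⟨_, fun α => neg_mem (coordV_mem (S := Subalgebra.toSubmodule (locAlg ι)) f hc α ?_),
    rfl⟩, zero_mem _, ?_, cen_expAff_mem_locFun f hu a⟩
  · rw [tAff, cur_nilEval f hu]
    exact nilEval_adEnd_uDist_mem_tens f _ (tens_mono le_rfl le_top (compl1_mem_tens hc hE))
  · rw [← tens_locAlg_eq]
    exact compl2_mem_tens hc hE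

end Locality

/-! ### The formal distributions -/

section Distributions

variable {g : Type*} [LieRing g] [LieAlgebra ℂ g] {ι : Type*} [Fintype ι] {κ : InvForm g}
variable {V P : Submodule ℂ g}

theorem cur_const_mode (a : g) (n : ℤ) :
    (FunAff.const ι (AffLie.mode κ a n)).cur = zPow ι n • ((1 : FunK ι) ⊗ₜ[ℂ] a) := by
  rw [TensorProduct.smul_tmul', smul_eq_mul, mul_one]
  rfl

theorem cur_expAff_mode (f : Module.Basis ι ℂ V) (hu : IsNilpotent (adEnd (uDist f))) (a : g)
    (n : ℤ) : (expAff f (AffLie.mode κ a n)).cur = zPow ι n • expDist f a := by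
  rw [cur_expAff f hu, cur_const_mode, expDist]
  exact nilEval_smul hu.neg (fun G w => by
    rw [LinearMap.neg_apply, LinearMap.neg_apply, adEnd_smul, smul_neg]) _ _ _

theorem cur_tAff_mode (f : Module.Basis ι ℂ V) (hu : IsNilpotent (adEnd (uDist f)))
    (hc : IsCompl V P) (a : g) (n : ℤ) :
    (tAff f hc (AffLie.mode κ a n)).cur = zPow ι n • tDist f hc a := by
  rw [tAff, cur_nilEval f hu, natV, Aff.cur_mk, cur_expAff_mode f hu, compl1_smul, tDist]
  exact nilEval_smul hu (adEnd_smul _) _ _ _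

theorem piVect_mode (f : Module.Basis ι ℂ V) (hu : IsNilpotent (adEnd (uDist f)))
    (hc : IsCompl V P) (a : g) (n : ℤ) :
    piVect f hc (AffLie.mode κ a n) =
      -∑ α, resVect α (zPow ι n * coordV f hc α (tDist f hc a)) := by
  rw [sum_resVect (fun α => zPow ι n * coordV f hc α (tDist f hc a)), neg_vf, piVect]
  simp only [cur_tAff_mode f hu, coordV_smul]

theorem piAmb_mode (f : Module.Basis ι ℂ V) (hu : IsNilpotent (adEnd (uDist f)))
    (hc : IsCompl V P) (a : g) (n : ℤ) :
    piAmb f hc (AffLie.mode κ a n) = distD κ f hc a n + distA κ f hc a n + distC κ f a n := by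
  refine Amb.ext ?_ ?_ (Aff.ext ?_ ?_)
  · change piVect f hc _ = _ + 0 + 0
    rw [add_zero, add_zero]
    exact piVect_mode f hu hc a n
  · change (0 : Fun ι) = 0 + 0 + 0
    rw [add_zero, add_zero]
  · change compl2 ι hc (expAff f _).cur = 0 + zPow ι n • compl2 ι hc (expDist f a) + 0
    rw [cur_expAff_mode f hu, compl2_smul, zero_add, add_zero]
  · change (expAff f (AffLie.mode κ a n)).cen = 0 + 0 + -FunK.res ι _
    rw [cen_expAff f hu, cur_const_mode, map_smul, smul_eq_mul, add_zero, zero_add,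
      ← zero_sub (FunK.res ι _)]
    congr 1

theorem expAff_c (f : Module.Basis ι ℂ V) (hu : IsNilpotent (adEnd (uDist f))) :
    expAff f (AffLie.c κ) = FunAff.const ι (AffLie.c κ) := by
  have h : (FunAff.const ι (AffLie.c κ)).cur = 0 := map_zero _
  ext1
  · rw [cur_expAff f hu, h, map_zero]
  · rw [cen_expAff f hu, h, map_zero, map_zero, sub_zero]
    rfl

theorem piAmb_c (f : Module.Basis ι ℂ V) (hu : IsNilpotent (adEnd (uDist f)))
    (hc : IsCompl V P) :
    piAmb f hc (AffLie.c κ) = Amb.mk 0 0 (FunAff.const ι (AffLie.c κ)) := by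
  have h : (FunAff.const ι (AffLie.c κ)).cur = 0 := map_zero _
  have hV : natV hc (expAff f (AffLie.c κ)) = 0 := by
    rw [expAff_c f hu, natV, h, map_zero]
    rfl
  have hP : natP hc (expAff f (AffLie.c κ)) = FunAff.const ι (AffLie.c κ) := by
    have := natV_add_natP hc (expAff f (AffLie.c κ))
    rw [hV, zero_add] at this
    exact this.trans (expAff_c f hu)
  have hT : tAff f hc (AffLie.c κ) = 0 := by rw [tAff, hV, map_zero]
  rw [piAmb, hP]
  congr 1
  rw [piVect, hT]
  refine Eq.trans ?_ vf_zero
  congr 1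
  ext1 α
  rw [Aff.cur_zero, map_zero, neg_zero]
  rfl

theorem one_tmul_mem_tens {W : Submodule ℂ g} {a : g} (ha : a ∈ W) :
    (1 : FunK ι) ⊗ₜ[ℂ] a ∈ tens ⊤ W := tmul_mem_tens Submodule.mem_top ha

/-- The distribution `C(a,z)` vanishes for `a` orthogonal to `V`. -/
theorem distC_eq_zero (hV : ∀ x ∈ V, ∀ y ∈ V, ⁅x, y⁆ ∈ V) (f : Module.Basis ι ℂ V) {a : g}
    (ha : ∀ x ∈ V, κ.form x a = 0) (n : ℤ) : distC κ f a n = 0 := by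
  have h : κ.ext (FunK ι) (nilEval expQuot (adEnd (uDist f)) (derExt g (FunK.der ι) (uDist f)))
      (1 ⊗ₜ[ℂ] a) = 0 := by
    refine ext_eq_zero_of_mem_tens (V' := Submodule.span ℂ {a}) κ (fun x hx y hy => ?_)
      (nilEval_mem _ _ (fun _ hy => lie_mem_tens (fun _ _ _ _ => Submodule.mem_top) hV
        (uDist_mem_tens_top f) hy)
        (derExt_mem_tens _ (fun _ _ => Submodule.mem_top) (uDist_mem_tens_top f)))
      (one_tmul_mem_tens (Submodule.mem_span_singleton_self a))
    obtain ⟨r, rfl⟩ := Submodule.mem_span_singleton.1 hy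
    rw [map_smul, ha x hx, smul_zero]
  rw [distC, h, mul_zero, map_zero, neg_zero]
  rfl

/-- For `a ∈ V` the element `e^{-ad u} a` lies in `Fun ⊗̂ V((z))`, so that only the vector fields
remain. -/
theorem piAmb_mode_of_mem_left (hV : ∀ x ∈ V, ∀ y ∈ V, ⁅x, y⁆ ∈ V)
    (hκ : ∀ x ∈ V, ∀ y ∈ V, κ.form x y = 0) (f : Module.Basis ι ℂ V)
    (hu : IsNilpotent (adEnd (uDist f))) (hc : IsCompl V P) {a : g} (ha : a ∈ V) (n : ℤ) :
    piAmb f hc (AffLie.mode κ a n) = distNil κ f hc a n := by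
  have hE : expDist f a ∈ tens (⊤ : Submodule ℂ (FunK ι)) V := by
    rw [expDist, nilEval_neg _ hu]
    exact nilEval_mem _ _ (fun _ hy => lie_mem_tens (fun _ _ _ _ => Submodule.mem_top) hV
      (uDist_mem_tens_top f) hy) (one_tmul_mem_tens ha)
  have hT : tDist f hc a = nilEval bernMinus (adEnd (uDist f)) (1 ⊗ₜ[ℂ] a) := by
    rw [tDist, compl1_of_mem_left hc hE, expDist, nilEval_neg _ hu, ← Module.End.mul_apply,
      ← nilEval_mul _ _ hu, bernPlus_mul_evalNegHom_expSeries]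
  rw [piAmb_mode f hu, distC_eq_zero hV f (fun x hx => hκ x hx a ha), add_zero, distA,
    compl2_of_mem_left hc hE, smul_zero]
  refine (add_zero _).trans ?_
  rw [distD, hT, distNil]

/-- If `⁅V, a⁆ ⊆ V` and `a ∈ P`, then `a` and `e^{-ad u} a - a` are the components of `e^{-ad u} a`. -/
theorem piAmb_mode_of_mem_right (hV : ∀ x ∈ V, ∀ y ∈ V, ⁅x, y⁆ ∈ V) (f : Module.Basis ι ℂ V)
    (hu : IsNilpotent (adEnd (uDist f))) (hc : IsCompl V P) {a : g} (ha : a ∈ P)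
    (haV : ∀ x ∈ V, ⁅x, a⁆ ∈ V) (haκ : ∀ x ∈ V, κ.form x a = 0) (n : ℤ) :
    piAmb f hc (AffLie.mode κ a n) = distLevi κ f hc a n := by
  have ha' := one_tmul_mem_tens (ι := ι) ha
  have hE : expDist f a - 1 ⊗ₜ[ℂ] a ∈ tens (⊤ : Submodule ℂ (FunK ι)) V := by
    rw [expDist, nilEval_neg _ hu]
    refine nilEval_sub_self_mem coeff_zero_evalNegHom_expSeries hu (fun _ hy => lie_mem_tens
      (fun _ _ _ _ => Submodule.mem_top) hV (uDist_mem_tens_top f) hy) ?_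
    refine lie_mem_tens (V' := Submodule.span ℂ {a}) (S' := ⊤)
      (fun _ _ _ _ => Submodule.mem_top) (fun x hx y hy => ?_)
      (uDist_mem_tens_top f) (one_tmul_mem_tens (Submodule.mem_span_singleton_self a))
    obtain ⟨r, rfl⟩ := Submodule.mem_span_singleton.1 hy
    rw [lie_smul]
    exact V.smul_mem r (haV x hx)
  have h1 : compl1 ι hc (expDist f a) = expDist f a - 1 ⊗ₜ[ℂ] a := by
    have := compl1_of_mem_left hc hE
    rwa [map_sub, compl1_of_mem_right hc ha', sub_zero] at this
  have h2 : compl2 ι hc (expDist f a) = 1 ⊗ₜ[ℂ] a := by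
    have := compl2_of_mem_left hc hE
    rwa [map_sub, compl2_of_mem_right hc ha', sub_eq_zero] at this
  have hT : tDist f hc a = -adEnd (uDist f) (1 ⊗ₜ[ℂ] a) := by
    have e : bernPlus * (1 - PowerSeries.evalNegHom expSeries) = PowerSeries.X := by
      rw [← X_mul_evalNegHom_expQuot, mul_left_comm, mul_comm bernPlus,
        evalNegHom_expQuot_mul_bernPlus, mul_one]
    have e' : expDist f a - 1 ⊗ₜ[ℂ] a =
        -nilEval (1 - PowerSeries.evalNegHom expSeries) (adEnd (uDist f)) (1 ⊗ₜ[ℂ] a) := by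
      rw [nilEval_sub, nilEval_one hu, LinearMap.sub_apply, neg_sub, expDist, nilEval_neg _ hu]
      rfl
    rw [tDist, h1, e', map_neg, ← Module.End.mul_apply, ← nilEval_mul _ _ hu, e, nilEval_X hu]
  rw [piAmb_mode f hu, distC_eq_zero hV f haκ, add_zero, distA, h2, distD, hT, distLevi]
  refine Amb.ext ?_ (add_zero _) ?_
  · refine (add_zero _).trans ?_
    change -_ = _
    rw [sum_resVect (fun α => zPow ι n * coordV f hc α (-adEnd (uDist f) (1 ⊗ₜ[ℂ] a))), neg_vf]
    simp only [map_neg, mul_neg, neg_neg]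
    exact (sum_resVect _).symm
  · refine (zero_add _).trans ?_
    rw [TensorProduct.smul_tmul', smul_eq_mul, mul_one]
    rfl

end Distributions

/-! ### The grading of `g` -/

section Grading

open LieAlgebra LieAlgebra.IsKilling LieModule

variable {g : Type*} [LieRing g] [LieAlgebra ℂ g] [FiniteDimensional ℂ g] [IsKilling ℂ g]
variable {H : LieSubalgebra ℂ g} [H.IsCartanSubalgebra]

/-- The sum of the weight spaces of grade at most `k`. -/
def gradeLE (b : (rootSystem H).Base) (Sig : Set H.root) (k : ℤ) : Submodule ℂ g :=
  ⨆ (χ : Weight ℂ H g) (_ : ∃ n : ℤ, grade b Sig χ.toLinear = n ∧ n ≤ k),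
    (genWeightSpace g χ).toSubmodule

theorem gradeLE_mono (b : (rootSystem H).Base) (Sig : Set H.root) {k l : ℤ} (h : k ≤ l) :
    gradeLE b Sig k ≤ gradeLE b Sig l :=
  iSup₂_le fun χ hχ => le_iSup₂_of_le (f := fun (χ : Weight ℂ H g)
    (_ : ∃ n : ℤ, grade b Sig χ.toLinear = n ∧ n ≤ l) => (genWeightSpace g χ).toSubmodule) χ
    (hχ.imp fun _ hn => ⟨hn.1, hn.2.trans h⟩) le_rfl

theorem genWeightSpace_le_gradeLE (b : (rootSystem H).Base) (Sig : Set H.root) {k n : ℤ}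
    {χ : Weight ℂ H g} (hn : grade b Sig χ.toLinear = n) (h : n ≤ k) :
    (genWeightSpace g χ).toSubmodule ≤ gradeLE b Sig k :=
  le_iSup₂_of_le (f := fun (χ : Weight ℂ H g)
    (_ : ∃ n : ℤ, grade b Sig χ.toLinear = n ∧ n ≤ k) => (genWeightSpace g χ).toSubmodule) χ
    ⟨n, hn, h⟩ le_rfl

theorem exists_grade (b : (rootSystem H).Base) (Sig : Set H.root) (χ : Weight ℂ H g) :
    ∃ n : ℤ, grade b Sig χ.toLinear = n := by
  by_cases h0 : χ.IsZero
  · refine ⟨0, ?_⟩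
    have : χ.toLinear = 0 := by
      ext z
      exact congrFun h0 z
    rw [this, map_zero, Int.cast_zero]
  · have hmem : χ ∈ H.root := by simpa using h0
    rcases b.root_mem_or_neg_mem ⟨χ, hmem⟩ with h | h
    · obtain ⟨n, hn, -⟩ := grade_posCone b Sig h
      exact ⟨n, by rw [Int.cast_natCast]; exact hn⟩
    · obtain ⟨n, hn, -⟩ := grade_posCone b Sig h
      rw [map_neg] at hn
      exact ⟨-n, by rw [Int.cast_neg, Int.cast_natCast, ← hn, neg_neg]; rfl⟩

/-- A bilinear map that sends pairs of weight vectors of grades at most `k` and `l` into `Q` does so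
for all pairs of elements of the sums of these weight spaces. -/
theorem map_mem_of_mem_gradeLE (b : (rootSystem H).Base) (Sig : Set H.root) {M : Type*}
    [AddCommGroup M] [Module ℂ M] (B : g →ₗ[ℂ] g →ₗ[ℂ] M) (Q : Submodule ℂ M) {k l : ℤ}
    (h : ∀ (χ ψ : Weight ℂ H g) (n m : ℤ), grade b Sig χ.toLinear = n → n ≤ k →
      grade b Sig ψ.toLinear = m → m ≤ l → ∀ x ∈ genWeightSpace g χ, ∀ y ∈ genWeightSpace g ψ,
      B x y ∈ Q) {x y : g} (hx : x ∈ gradeLE b Sig k) (hy : y ∈ gradeLE b Sig l) : B x y ∈ Q := by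
  have h1 : gradeLE b Sig k ≤ Q.comap (B.flip y) := by
    refine iSup₂_le fun χ ⟨n, hn, hnk⟩ x hx => ?_
    have h2 : gradeLE b Sig l ≤ Q.comap (B x) :=
      iSup₂_le fun ψ ⟨m, hm, hml⟩ y hy => h χ ψ n m hn hnk hm hml x hx y hy
    exact h2 hy
  exact h1 hx

theorem lie_mem_gradeLE (b : (rootSystem H).Base) (Sig : Set H.root) {k l : ℤ} {x y : g}
    (hx : x ∈ gradeLE b Sig k) (hy : y ∈ gradeLE b Sig l) : ⁅x, y⁆ ∈ gradeLE b Sig (k + l) := by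
  refine map_mem_of_mem_gradeLE b Sig (LieModule.toEnd ℂ g g : g →ₗ[ℂ] Module.End ℂ g)
    (gradeLE b Sig (k + l))
    (fun χ ψ n m hn hnk hm hml x hx y hy => ?_) hx hy
  have h1 : ⁅x, y⁆ ∈ genWeightSpace g ((χ : H → ℂ) + (ψ : H → ℂ)) :=
    lie_mem_genWeightSpace_of_mem_genWeightSpace hx hy
  by_cases hb : genWeightSpace g ((χ : H → ℂ) + (ψ : H → ℂ)) = ⊥
  · rw [hb, LieSubmodule.mem_bot] at h1
    change ⁅x, y⁆ ∈ _
    rw [h1]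
    exact zero_mem _
  · have e : (⟨_, hb⟩ : Weight ℂ H g).toLinear = χ.toLinear + ψ.toLinear := by
      ext z
      rfl
    exact genWeightSpace_le_gradeLE b Sig (χ := ⟨_, hb⟩) (n := n + m)
      (by rw [e, map_add, hn, hm, Int.cast_add]) (add_le_add hnk hml) h1

theorem killingForm_eq_zero_of_mem_gradeLE (b : (rootSystem H).Base) (Sig : Set H.root) {k l : ℤ}
    (hkl : k + l < 0) {x y : g} (hx : x ∈ gradeLE b Sig k) (hy : y ∈ gradeLE b Sig l) :
    killingForm ℂ g x y = 0 := by
  refine (Submodule.mem_bot ℂ).1 (map_mem_of_mem_gradeLE b Sig (killingForm ℂ g) ⊥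
    (fun χ ψ n m hn hnk hm hml x hx y hy => (Submodule.mem_bot ℂ).2 ?_) hx hy)
  refine killingForm_apply_eq_zero_of_mem_rootSpace_of_add_ne_zero ℂ g H hx hy fun h => ?_
  have e : χ.toLinear + ψ.toLinear = 0 := by
    ext z
    exact congrFun h z
  have e' := congrArg (grade b Sig) e
  rw [map_add, map_zero, hn, hm] at e'
  have : n + m = 0 := by exact_mod_cast e'
  omega

theorem nilradOpp_eq_gradeLE (b : (rootSystem H).Base) {Sig : Set H.root} (hS : Sig ⊆ b.support) :
    nilradOpp b Sig = gradeLE b Sig (-1) := by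
  rw [nilradOpp_eq b hS]
  refine iSup_congr fun χ => iSup_congr_Prop ?_ fun _ => rfl
  obtain ⟨n, hn⟩ := exists_grade b Sig χ
  rw [hn]
  constructor
  · refine fun h => ⟨n, rfl, ?_⟩
    by_contra h'
    exact h ⟨n.toNat, by exact_mod_cast (Int.toNat_of_nonneg (by omega)).symm⟩
  · rintro ⟨m, hm, hm'⟩ ⟨j, hj⟩
    have h1 : n = m := by exact_mod_cast hm
    have h2 : n = j := by exact_mod_cast hj
    omega

theorem levi_le_gradeLE (b : (rootSystem H).Base) {Sig : Set H.root} (hS : Sig ⊆ b.support) :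
    levi Sig ≤ gradeLE b Sig 0 := by
  refine sup_le ?_ (iSup₂_le fun α hα => ?_)
  · by_cases hb : (rootSpace H (0 : H → ℂ)) = ⊥
    · rw [rootSpace_zero_eq] at hb
      have : H.toSubmodule = ⊥ := congrArg LieSubmodule.toSubmodule hb
      rw [this]
      exact bot_le
    · refine le_trans (rootSpace_weight_zero (χ := ⟨0, hb⟩) rfl).ge
        (genWeightSpace_le_gradeLE b Sig (n := 0) ?_ le_rfl)
      have : (⟨0, hb⟩ : Weight ℂ H g).toLinear = 0 := rfl
      rw [this, map_zero, Int.cast_zero]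
  · refine genWeightSpace_le_gradeLE b Sig (n := 0) ?_ le_rfl
    rw [Int.cast_zero]
    exact grade_latticeSpan b hS hα

/-- As there are only finitely many weights, their grades are bounded. -/
theorem exists_gradeLE_eq (b : (rootSystem H).Base) (Sig : Set H.root) :
    ∃ M : ℕ, gradeLE b Sig M = ⊤ ∧ gradeLE b Sig (-M - 1) = ⊥ := by
  choose n hn using exists_grade b Sig
  obtain ⟨M, hM⟩ := (Set.finite_range fun χ => (n χ).natAbs).bddAbove
  have hM' : ∀ χ, (n χ).natAbs ≤ M := fun χ => hM ⟨χ, rfl⟩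
  refine ⟨M, ?_, ?_⟩
  · have htop : ⨆ χ : Weight ℂ H g, (genWeightSpace g χ).toSubmodule = ⊤ := by
      rw [← LieSubmodule.iSup_toSubmodule, iSup_genWeightSpace_eq_top', LieSubmodule.top_toSubmodule]
    rw [eq_top_iff, ← htop]
    exact iSup_le fun χ => genWeightSpace_le_gradeLE b Sig (hn χ) (by have := hM' χ; omega)
  · refine eq_bot_iff.2 (iSup₂_le fun χ ⟨m, hm, hm'⟩ => ?_)
    have h1 : n χ = m := by
      have := (hn χ).symm.trans hm
      exact_mod_cast this
    have := hM' χ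
    omega

/-- The operator `ad u(z)` lowers the grade, which is bounded. -/
theorem isNilpotent_adEnd_uDist {ι : Type*} [Fintype ι] (b : (rootSystem H).Base)
    {Sig : Set H.root} (hS : Sig ⊆ b.support) (f : Module.Basis ι ℂ (nilradOpp b Sig)) :
    IsNilpotent (adEnd (uDist f)) := by
  obtain ⟨M, hM, hM'⟩ := exists_gradeLE_eq b Sig
  have hk : ∀ (k : ℕ) (w : FunK ι ⊗[ℂ] g),
      (adEnd (uDist f) ^ k) w ∈ tens (⊤ : Submodule ℂ (FunK ι)) (gradeLE b Sig (M - k)) :=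
    fun k w => by
    induction k with
    | zero =>
      rw [Nat.cast_zero, sub_zero, hM]
      exact mem_tens_top w
    | succ k ih =>
      rw [pow_succ', Module.End.mul_apply]
      refine lie_mem_tens (fun _ _ _ _ => Submodule.mem_top) (fun x hx y hy => ?_)
        (uDist_mem_tens_top f) ih
      rw [nilradOpp_eq_gradeLE b hS] at hx
      have := lie_mem_gradeLE b Sig hx hy
      rwa [show (-1 : ℤ) + (M - k) = M - (k + 1 : ℕ) by push_cast; ring] at this
  refine ⟨2 * M + 1, LinearMap.ext fun w => ?_⟩
  have h := hk (2 * M + 1) w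
  rw [show (M : ℤ) - (2 * M + 1 : ℕ) = -M - 1 by push_cast; ring, hM'] at h
  rw [tens, Submodule.map₂_bot_right] at h
  exact (Submodule.mem_bot ℂ).1 h

end Grading

end FreeField

end

theorem mainTheorem1 {g : Type*} [LieRing g] [LieAlgebra ℂ g] [FiniteDimensional ℂ g]
    [LieAlgebra.IsSimple ℂ g] (H : LieSubalgebra ℂ g) [H.IsCartanSubalgebra]
    (b : (LieAlgebra.IsKilling.rootSystem H).Base)
    (θ : H.root) (hθ : FreeField.IsMaximalRoot b θ)
    (Sig : Set H.root) (hSig : Sig ⊆ b.support)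
    {ι : Type*} [Fintype ι] (f : Module.Basis ι ℂ (FreeField.nilradOpp b Sig)) :
    IsNilpotent (FreeField.adEnd (FreeField.uPoint (FreeField.normForm θ) f)) ∧
    IsNilpotent (FreeField.adEnd (FreeField.uDist f)) ∧
    ∃ π : FreeField.AffLie (FreeField.normForm θ) →ₗ⁅ℂ⁆
        FreeField.Rloc (FreeField.normForm θ) (FreeField.parabolic b hSig) ι,
      Function.Injective π ∧
      (∀ a : FreeField.AffLie (FreeField.normForm θ),
        (∀ F : FreeField.Fun ι, HasSum
          (fun i : ι × ℤ =>
            -(FreeField.FunK.coeff i.2 (FreeField.coordV f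
                (FreeField.isCompl_parabolic b hSig) i.1
                (FreeField.tAff f (FreeField.isCompl_parabolic b hSig) a).cur) *
              (FreeField.partialX i.1 i.2).1 F))
          ((π a).1.vec.1 F)) ∧
        (π a).1.fn = 0 ∧
        (π a).1.aff = FreeField.natP (FreeField.isCompl_parabolic b hSig)
          (FreeField.expAff f a)) ∧
      (π (FreeField.AffLie.c (FreeField.normForm θ))).1 =
        FreeField.Amb.mk 0 0 (FreeField.FunAff.const ι
          (FreeField.AffLie.c (FreeField.normForm θ))) ∧
      (∀ (a : g) (n : ℤ), (π (FreeField.AffLie.mode (FreeField.normForm θ) a n)).1 =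
        FreeField.distD (FreeField.normForm θ) f (FreeField.isCompl_parabolic b hSig) a n +
        FreeField.distA (FreeField.normForm θ) f (FreeField.isCompl_parabolic b hSig) a n +
        FreeField.distC (FreeField.normForm θ) f a n) ∧
      (∀ a ∈ FreeField.nilradOpp b Sig, ∀ n : ℤ,
        (π (FreeField.AffLie.mode (FreeField.normForm θ) a n)).1 =
          FreeField.distNil (FreeField.normForm θ) f (FreeField.isCompl_parabolic b hSig) a n) ∧
      (∀ a ∈ FreeField.levi Sig, ∀ n : ℤ,
        (π (FreeField.AffLie.mode (FreeField.normForm θ) a n)).1 =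
          FreeField.distLevi (FreeField.normForm θ) f
            (FreeField.isCompl_parabolic b hSig) a n) := by
  open FreeField in
  have hu := isNilpotent_adEnd_uDist b hSig f
  have hc := isCompl_parabolic b hSig
  have hVeq := nilradOpp_eq_gradeLE b hSig
  have hV : ∀ x ∈ nilradOpp b Sig, ∀ y ∈ nilradOpp b Sig, ⁅x, y⁆ ∈ nilradOpp b Sig := by
    rw [hVeq]
    exact fun x hx y hy => gradeLE_mono b Sig (by norm_num) (lie_mem_gradeLE b Sig hx hy)
  have hl : ∀ a ∈ levi Sig, ∀ x ∈ nilradOpp b Sig, ⁅x, a⁆ ∈ nilradOpp b Sig := by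
    rw [hVeq]
    exact fun a ha x hx => gradeLE_mono b Sig (by norm_num)
      (lie_mem_gradeLE b Sig hx (levi_le_gradeLE b hSig ha))
  have hκ0 : ∀ x ∈ nilradOpp b Sig, ∀ y ∈ gradeLE b Sig 0, (normForm θ).form x y = 0 := by
    rw [hVeq]
    intro x hx y hy
    rw [normForm, LinearMap.smul_apply, LinearMap.smul_apply,
      killingForm_eq_zero_of_mem_gradeLE b Sig (by norm_num) hx hy, smul_zero]
  have hκ : ∀ x ∈ nilradOpp b Sig, ∀ y ∈ nilradOpp b Sig, (normForm θ).form x y = 0 :=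
    fun x hx y hy => hκ0 x hx y (gradeLE_mono b Sig (by norm_num) (hVeq ▸ hy))
  have hP : ∀ x ∈ (parabolic b hSig).toSubmodule, ∀ y ∈ (parabolic b hSig).toSubmodule,
      ⁅x, y⁆ ∈ (parabolic b hSig).toSubmodule := fun x hx y hy =>
    (parabolic b hSig).lie_mem hx hy
  refine ⟨isNilpotent_adEnd_uPoint f hu, hu,
    { toFun := fun a => ⟨piAmb f hc a, piAmb_mem_Rloc f hu hc a⟩
      map_add' := fun a a' => Subtype.ext (map_add (piLin (normForm θ) f hc) a a')
      map_smul' := fun r a => Subtype.ext (map_smul (piLin (normForm θ) f hc) r a)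
      map_lie' := fun {a a'} => Subtype.ext (piAmb_lie hV hP hκ f hu hc a a') },
    fun a a' h => piAmb_injective hV hκ f hu hc (congrArg Subtype.val h),
    fun a => ⟨fun F => ?_, rfl, rfl⟩, piAmb_c f hu hc, piAmb_mode f hu hc,
    fun a ha n => piAmb_mode_of_mem_left hV hκ f hu hc ha n,
    fun a ha n => piAmb_mode_of_mem_right hV f hu hc ?_ (hl a ha) ?_ n⟩
  · have h := hasSum_vf (fun α => -coordV f hc α (tAff f hc a).cur) F
    simp only [map_neg, neg_mul] at h
    exact h
  · exact Submodule.mem_sup_left ha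
  · exact fun x hx => hκ0 x hx a (levi_le_gradeLE b hSig ha)
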